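/- Six-derivative gravity in four dimensions is the theory with the action $$S=\int d^4x\sqrt{-g}\,\Big[\gamma(R-2\Lambda)+\beta R^2-\alpha C_{abcd}C^{abcd}-\eta_1C_{abcd}\Box C^{abcd}+\eta_2R\Box R+\eta_3R^3+\eta_4RS_{ab}S^{ab}+\eta_5S_{ab}S^a{}_cS^{cb}+\eta_6S_{ab}S_{cd}C^{acbd}+\eta_7RC_{abcd}C^{abcd}+\eta_8C_{abcd}C^{abef}C^{cd}{}_{ef}\Big]$$ with real constants $\gamma,\Lambda,\alpha,\beta,\eta_1,\dots,\eta_8$, where $C_{abcd}$ is the Weyl tensor and $S_{ab}=R_{ab}-\frac14Rg_{ab}$. A smooth Lorentzian metric on an open set is a *vacuum solution* if it is a stationary point of $S$ under all smooth compactly supported variations of the metric. Put $c_1=2(18\eta_3+6\eta_7+\eta_8)$, $c_2=-3(3\eta_4+\eta_6)$, $c_3=36\eta_3+9\eta_4+3\eta_6+12\eta_7+2\eta_8$ and $\delta=\alpha-3\beta$. For $R_0>0$ consider $$ds^2=-f(r)\,dt^2+\frac{dr^2}{f(r)}+R_0^2(d\theta^2+\sin^2\theta\,d\phi^2)$$ where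 $f(r)\neq0$, $0<\theta<\pi$, and $r$ is in the set where $f$ is smooth (for $r^p$: $r>0$, and also $r<0$ if $p\in\mathbb Z$; for $(r+b)^{5/2}$: $r>-b$). In each of the following cases this metric is a vacuum solution; $a_i,a_p,b,c$ are arbitrary real constants unless specified, and $R_0$ is assumed to satisfy the stated relation (so the stated value of $R_0^2$ is positive and all denominators are nonzero). 1. *Nariai*, $f=a_0+a_1r+a_2r^2$ with $a_2=-1/R_0^2$: (a) $\Lambda=0$, $c_1\gamma^{-1}>0$, $R_0^2=\frac23\sqrt{c_1/\gamma}$; (b) more generally $9\gamma R_0^4(\Lambda R_0^2-1)+4c_1=0$. 2. *Bertotti–Robinson*, $f=a_0+a_1r+a_2r^2$ with $a_2=1/R_0^2$: (a) $\Lambda=0$, $c_2\gamma^{-1}>0$, $R_0^2=\frac23\sqrt{c_2/\gamma}$; (b) $\gamma=0=c_2$. 3. *Bachian versions*, $\Lambda=0$, $\alpha=3\beta$: $f=a_0+a_1r+a_2r^2$ with $R_0^2=\frac{\sqrt2}{3}\sqrt{\frac{c_1c_2\pm\sqrt{c_2^3(2c_1-c_2)}}{(c_2-c_1)\gamma}}$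 and $a_2=-\frac{9\gamma R_0^2}{2c_2}$, when $c_2^3(2c_1-c_2)\ge0$ and the outer radicand is positive. 4. *Linear*, $\gamma\ne0$: $f=a_0+a_1r$, $a_1\ne0$, with $R_0^2=\frac{2\delta\pm\sqrt{4\delta^2-3\gamma c_3}}{3\gamma}$ and $\Lambda=-\frac{2(\delta-3\gamma R_0^2)}{9\gamma R_0^4}$, when $4\delta^2-3\gamma c_3\ge0$. 5. *Arbitrary smooth $f$* (on any open set of $r$): (a) all couplings except possibly $\eta_5$ vanish (that is, $\gamma=\alpha=\beta=0$ and $\eta_i=0$ for $i\ne5$), any $R_0$; (b) $\gamma=\eta_1=\eta_2=0$, $\alpha=3\beta\ne0$, $\eta_6=-3\eta_4\ne0$, $\eta_7=-\frac34(12\eta_3+\eta_4)$, $\eta_8=\frac92(8\eta_3+\eta_4)$, $R_0^2=\eta_4/\beta$. 6. *Cubic*, $f=a_0+a_1r+a_2r^2+a_3r^3$, $a_3\neq0$, for $\gamma\ne0$, $\beta=0$, $\eta_1=3\eta_2=\frac16(6\eta_4-\eta_6)$, $\eta_3=-\frac1{108}(3\eta_4+4\eta_6+12\eta_7)$, $2\eta_1-6\eta_2+c_3=0$,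 $c_2/\gamma>0$, $R_0^2=\frac23\sqrt{c_2/\gamma}$: (a) $\Lambda=0$ and $a_1=\frac{a_2^2R_0^4-1}{3a_3R_0^4}$; (b) $\Lambda$ arbitrary, $\alpha=\frac12\,\mathrm{sgn}(\gamma)\sqrt{\gamma c_2}$ and $a_1=\frac{a_2^2R_0^4+2\Lambda R_0^2-1}{3a_3R_0^4}$. 7. $f=a_2r^2+a_pr^p$ with $a_p\ne0$, $p\in\mathbb R\setminus\{0,1\}$, for $\gamma=0$, $\alpha=3\beta$, $\eta_1=3\eta_2$, $\eta_6=-3\eta_4$, $\eta_7=\frac{6(p-2)(2p-3)\eta_2}{(p-1)p}-9\eta_3-\frac34\eta_4$, $\eta_8=-6(3\eta_3+\eta_7)$ and $$R_0^2=-\frac{4(p-2)(2p-3)\eta_2-(p-1)p\,\eta_4}{(p-1)p\,\beta+(p-3)(p-2)(p^2+p-4)a_2\eta_2}.$$ 8. $f=a_pr^p$ with $a_p\neq0$, $p\in\mathbb R\setminus\{0,1,\frac32,2,\frac{21\pm\sqrt{41}}{10}\}$, $R_0^2=\frac1{3\Lambda}$, for, with $q=p(5p-21)+20$, $$\alpha=9\eta_4\Lambda-\frac{\gamma(p-1)(3p-4)p^2}{36\Lambda(p-2)(2p-3)q}-\frac{12\eta_1\Lambda(p-2)(2p-3)}{(p-1)p},\quad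 \beta=-\frac{\gamma}{6\Lambda}+3\eta_4\Lambda-\frac{\gamma(p-1)(3p-4)p^2}{108\Lambda(p-2)(2p-3)q}-\frac{4\eta_1\Lambda(p-2)(2p-3)}{(p-1)p},$$ $$\eta_2=\frac{\eta_1}3+\frac{\gamma(p-1)p(2p-5)}{54\Lambda^2(p-2)q},\quad\eta_6=-3\eta_4,\quad \eta_7=-9\eta_3-\frac{3\eta_4}4+\frac{\gamma(7p-15)[13(p-4)p+48]}{216\Lambda^2(p-2)q}+\frac{2\eta_1(p-2)(2p-3)}{(p-1)p},$$ $$\eta_8=36\eta_3+\frac{9\eta_4}2+\gamma\frac{p[(373-61p)p-744]+480}{36\Lambda^2(p-2)q}-\frac{12\eta_1(p-2)(2p-3)}{(p-1)p}.$$ In the remaining cases $\gamma\ne0$, $\delta\neq0$. 9. $f=\frac{15\gamma r^2}{8\delta}+a_4r^4$, $a_4\ne0$, $R_0^2=-\frac{2\delta}{3\gamma}$, for $\eta_1=-69\eta_2=\frac{391\delta^2}{2214\gamma}$, $\eta_4=\frac{2(104\alpha-5847\beta)\delta}{16605\gamma}$, $\eta_6=\frac{2\delta(1201\alpha+1932\beta)}{5535\gamma}$,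 $\eta_7=-\frac{(1987\alpha-22566\beta)\delta}{33210\gamma}-9\eta_3$, $\eta_8=-\frac{\delta(4648\alpha+2661\beta)}{5535\gamma}+36\eta_3$, $\Lambda=-\frac{8883\gamma}{1312\delta}$. 10. The following functions with $c\ne0$: (a) $f=-\frac{96\gamma(r+b)^2}{19\delta}+c(r+b)^{5/2}$, $R_0^2=\frac{19\delta}{96\gamma}$, for $\eta_1=3\eta_2$, $\eta_8=\frac{19\delta(\alpha+141\beta)}{3072\gamma}-\frac{27\eta_2}8+36\eta_3$, $\eta_7=\frac{19(7\alpha-165\beta)\delta}{18432\gamma}+\frac{9\eta_2}{16}-9\eta_3$, $\eta_6=\frac{19(31\alpha-237\beta)\delta}{4608\gamma}-\frac{83\eta_2}{20}$, $\eta_4=-\frac{19(7\alpha-165\beta)\delta}{13824\gamma}+\frac{83\eta_2}{60}$, $\Lambda=-\frac{224\gamma}{361\delta}$; (b) $f=-\frac{8\gamma}{\delta}(r+b)^2+c(r+b)^{5/2}$, $R_0^2=-\frac{4\delta}{13\gamma}$, for $\eta_1=\eta_2=0$, $\eta_8=\frac{\delta(7\alpha-93\beta)}{52\gamma}+36\eta_3$,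 $\eta_7=-\frac{\delta(19\alpha-129\beta)}{312\gamma}-9\eta_3$, $\eta_6=\frac{\delta(\alpha+69\beta)}{78\gamma}$, $\eta_4=\frac{\delta(11\alpha-105\beta)}{234\gamma}$, $\Lambda=-\frac{247\gamma}{24\delta}$; (c) $f=-\frac{16\gamma}{17\delta}(r+b)^2+c(r+b)^{5/2}$, $R_0^2=\frac{17\delta}{16\gamma}$, for $\eta_1=\eta_2=0$, $\eta_8=-\frac{17\delta(7\alpha-93\beta)}{256\gamma}+36\eta_3$, $\eta_7=\frac{17\delta(19\alpha-129\beta)}{1536\gamma}-9\eta_3$, $\eta_6=-\frac{17\delta(\alpha+69\beta)}{384\gamma}$, $\eta_4=-\frac{17\delta(11\alpha-105\beta)}{1152\gamma}$, $\Lambda=\frac{304\gamma}{867\delta}$; (d) $f=\frac{3\gamma(r+b)^2}{2\delta}+c(r+b)^{5/2}$, $R_0^2=\frac{2\delta}{3\gamma}$, for $\eta_1=3\eta_2$, $\eta_8=-\frac{(37\alpha-516\beta)\delta}{135\gamma}-\frac{249\eta_2}{40}+36\eta_3$, $\eta_7=\frac{(361\alpha-1893\beta)\delta}{1620\gamma}+\frac{83\eta_2}{80}-9\eta_3$,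 $\eta_6=\frac{2(2\alpha-33\beta)\delta}{27\gamma}-\frac{9\eta_2}4$, $\eta_4=-\frac{(13\alpha-93\beta)\delta}{81\gamma}+\frac{3\eta_2}4$, $\Lambda=0$. -/

import Mathlib

open scoped ContDiff

namespace SixDerivativeGravity

noncomputable section

/-! ### Pseudo-Riemannian geometry in a coordinate chart of dimension four -/

/-- Points of a four-dimensional coordinate chart. -/
abbrev Coord : Type := Fin 4 → ℝ

/-- A (pseudo-Riemannian) metric in coordinates: the matrix of its components `g_{ab}`. -/
abbrev Metric : Type := Coord → Matrix (Fin 4) (Fin 4) ℝ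

/-- The components `T_{a₁ … a_k}` of a covariant tensor field of rank `k`. -/
abbrev TensorField (k : ℕ) : Type := (Fin k → Fin 4) → Coord → ℝ

/-- The partial derivative `∂_i F`. -/
def pd (i : Fin 4) (F : Coord → ℝ) (x : Coord) : ℝ :=
  fderiv ℝ F x (Pi.single i 1)

/-- The inverse metric `g^{ab}`. -/
def ginv (g : Metric) (a b : Fin 4) (x : Coord) : ℝ := (g x)⁻¹ a b

/-- The Christoffel symbols
`Γ^a_{bc} = ½ g^{ad} (∂_b g_{dc} + ∂_c g_{db} - ∂_d g_{bc})` of the Levi-Civita connection. -/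
def christoffel (g : Metric) (a b c : Fin 4) (x : Coord) : ℝ :=
  (1 / 2) * ∑ d, ginv g a d x *
    (pd b (fun y => g y d c) x + pd c (fun y => g y d b) x - pd d (fun y => g y b c) x)

/-- The covariant derivative; the index of the derivative is the first one:
`∇_e T_{a₁ … a_k} = ∂_e T_{a₁ … a_k} - ∑_j Γ^m_{e a_j} T_{a₁ … m … a_k}`. -/
def covDeriv (g : Metric) {k : ℕ} (T : TensorField k) : TensorField (k + 1) := fun I x =>
  pd (I 0) (T (fun j => I j.succ)) x
    - ∑ j : Fin k, ∑ m, christoffel g m (I 0) (I j.succ) x *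
        T (Function.update (fun i => I i.succ) j m) x

/-- The d'Alembertian `□ T = g^{ef} ∇_e ∇_f T`. -/
def box (g : Metric) {k : ℕ} (T : TensorField k) : TensorField k := fun I x =>
  ∑ e, ∑ f, ginv g e f x * covDeriv g (covDeriv g T) (Fin.cons e (Fin.cons f I)) x

/-- The components `T^{a₁ … a_k}` of a tensor with all its indices raised. -/
def raise (g : Metric) {k : ℕ} (T : TensorField k) : TensorField k := fun I x =>
  ∑ J : Fin k → Fin 4, (∏ j, ginv g (I j) (J j) x) * T J x

/-- The Riemann tensor `R^a_{bcd} = ∂_c Γ^a_{db} - ∂_d Γ^a_{cb} + Γ^a_{ce} Γ^e_{db}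
- Γ^a_{de} Γ^e_{cb}`. -/
def riemannUp (g : Metric) (a b c d : Fin 4) (x : Coord) : ℝ :=
  pd c (christoffel g a d b) x - pd d (christoffel g a c b) x
    + ∑ e, (christoffel g a c e x * christoffel g e d b x
        - christoffel g a d e x * christoffel g e c b x)

/-- The Riemann tensor `R_{abcd} = g_{ae} R^e_{bcd}`. -/
def riemann (g : Metric) (a b c d : Fin 4) (x : Coord) : ℝ :=
  ∑ e, g x a e * riemannUp g e b c d x

/-- The Ricci tensor `R_{bd} = R^a_{bad}`. -/
def ricci (g : Metric) (b d : Fin 4) (x : Coord) : ℝ := ∑ a, riemannUp g a b a d x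

/-- The Ricci scalar `R = g^{ab} R_{ab}`. -/
def ricciScalar (g : Metric) (x : Coord) : ℝ := ∑ a, ∑ b, ginv g a b x * ricci g a b x

/-- The traceless Ricci tensor `S_{ab} = R_{ab} - ¼ R g_{ab}`. -/
def tracelessRicci (g : Metric) (a b : Fin 4) (x : Coord) : ℝ :=
  ricci g a b x - (1 / 4) * ricciScalar g x * g x a b

/-- The Weyl tensor `C_{abcd}` in dimension four. -/
def weyl (g : Metric) (a b c d : Fin 4) (x : Coord) : ℝ :=
  riemann g a b c d x
    - (1 / 2) * (g x a c * ricci g b d x - g x a d * ricci g b c x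
        - g x b c * ricci g a d x + g x b d * ricci g a c x)
    + (ricciScalar g x / 6) * (g x a c * g x b d - g x a d * g x b c)

/-- The Weyl tensor as a tensor field of rank four. -/
def weylTensor (g : Metric) : TensorField 4 := fun I => weyl g (I 0) (I 1) (I 2) (I 3)

/-- The traceless Ricci tensor as a tensor field of rank two. -/
def sTensor (g : Metric) : TensorField 2 := fun I => tracelessRicci g (I 0) (I 1)

/-! ### The action of six-derivative gravity -/

/-- The coupling constants of six-derivative gravity. -/
structure Couplings where
  γ : ℝ
  Λ : ℝ
  β : ℝ
  α : ℝ
  η₁ : ℝ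
  η₂ : ℝ
  η₃ : ℝ
  η₄ : ℝ
  η₅ : ℝ
  η₆ : ℝ
  η₇ : ℝ
  η₈ : ℝ

/-- `C_{abcd} C^{abcd}` -/
def invCC (g : Metric) (x : Coord) : ℝ :=
  ∑ I, weylTensor g I x * raise g (weylTensor g) I x

/-- `C_{abcd} □ C^{abcd}` -/
def invCBoxC (g : Metric) (x : Coord) : ℝ :=
  ∑ I, weylTensor g I x * raise g (box g (weylTensor g)) I x

/-- `R □ R` -/
def invRBoxR (g : Metric) (x : Coord) : ℝ :=
  ricciScalar g x * box g (k := 0) (fun _ => ricciScalar g) Fin.elim0 x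

/-- `S_{ab} S^{ab}` -/
def invSS (g : Metric) (x : Coord) : ℝ :=
  ∑ a, ∑ b, tracelessRicci g a b x * raise g (sTensor g) ![a, b] x

/-- `S_{ab} S^a{}_c S^{cb}`, where `S^a{}_c = g^{am} S_{mc}` -/
def invSSS (g : Metric) (x : Coord) : ℝ :=
  ∑ a, ∑ b, ∑ c, tracelessRicci g a b x * (∑ m, ginv g a m x * tracelessRicci g m c x) *
    raise g (sTensor g) ![c, b] x

/-- `S_{ab} S_{cd} C^{acbd}` -/
def invSSC (g : Metric) (x : Coord) : ℝ :=
  ∑ a, ∑ b, ∑ c, ∑ d, tracelessRicci g a b x * tracelessRicci g c d x *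
    raise g (weylTensor g) ![a, c, b, d] x

/-- `C_{abcd} C^{abef} C^{cd}{}_{ef}`, where `C^{cd}{}_{ef} = C^{cdmn} g_{me} g_{nf}` -/
def invCCC (g : Metric) (x : Coord) : ℝ :=
  ∑ a, ∑ b, ∑ c, ∑ d, ∑ e, ∑ f, weyl g a b c d x * raise g (weylTensor g) ![a, b, e, f] x *
    (∑ m, ∑ n, raise g (weylTensor g) ![c, d, m, n] x * g x m e * g x n f)

/-- The Lagrangian of six-derivative gravity. -/
def lagrangian (κ : Couplings) (g : Metric) (x : Coord) : ℝ :=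
  κ.γ * (ricciScalar g x - 2 * κ.Λ) + κ.β * ricciScalar g x ^ 2 - κ.α * invCC g x
    - κ.η₁ * invCBoxC g x
    + κ.η₂ * invRBoxR g x
    + κ.η₃ * ricciScalar g x ^ 3
    + κ.η₄ * (ricciScalar g x * invSS g x)
    + κ.η₅ * invSSS g x
    + κ.η₆ * invSSC g x
    + κ.η₇ * (ricciScalar g x * invCC g x)
    + κ.η₈ * invCCC g x

/-- The action `∫_K √(-det g) L d⁴x` of six-derivative gravity over a region `K` of the chart. -/
def action (κ : Couplings) (K : Set Coord) (g : Metric) : ℝ :=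
  ∫ x in K, Real.sqrt (-(g x).det) * lagrangian κ g x

/-- `g` is a smooth Lorentzian metric, of signature `(-,+,+,+)`, on `U`. -/
def IsLorentzianOn (U : Set Coord) (g : Metric) : Prop :=
  (∀ a b, ContDiffOn ℝ ∞ (fun x => g x a b) U) ∧
  ∀ x ∈ U, (g x).IsSymm ∧
    ∃ P : Matrix (Fin 4) (Fin 4) ℝ, P.transpose * g x * P = Matrix.diagonal ![-1, 1, 1, 1]

/-- `g` is a vacuum solution of six-derivative gravity on the open set `U`: it is a smooth
Lorentzian metric there, and a stationary point of the action with respect to all smooth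
variations `g_{ab} → g_{ab} + ε h_{ab}` of the metric with compact support in `U`. -/
def IsVacuumSolution (κ : Couplings) (U : Set Coord) (g : Metric) : Prop :=
  IsOpen U ∧ IsLorentzianOn U g ∧
  ∀ h : Coord → Matrix (Fin 4) (Fin 4) ℝ,
    (∀ a b, ContDiff ℝ ∞ (fun x => h x a b)) → (∀ x, (h x).IsSymm) →
    HasCompactSupport h → tsupport h ⊆ U →
    HasDerivAt (fun ε : ℝ => action κ (tsupport h) (fun x => g x + ε • h x)) 0 0

/-! ### Static spherically symmetric Kundt metrics -/

/-- The metric `-f(r) dt² + dr² / f(r) + R₀² (dθ² + sin² θ dφ²)`, in the coordinates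
`(t, r, θ, φ) = (x 0, x 1, x 2, x 3)`. -/
def kundtMetric (f : ℝ → ℝ) (R₀ : ℝ) : Metric := fun x =>
  Matrix.diagonal ![-f (x 1), (f (x 1))⁻¹, R₀ ^ 2, R₀ ^ 2 * Real.sin (x 2) ^ 2]

/-- The region of the coordinates `(t, r, θ, φ)` where `r ∈ I`, `f(r) ≠ 0` and `0 < θ < π`. -/
def kundtChart (f : ℝ → ℝ) (I : Set ℝ) : Set Coord :=
  {x | x 1 ∈ I ∧ f (x 1) ≠ 0 ∧ 0 < x 2 ∧ x 2 < Real.pi}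

/-- The static spherically symmetric Kundt metric with the function `f`, for `r ∈ I`, and with
the radius `R₀` is a vacuum solution. -/
def IsKundtVacuum (κ : Couplings) (f : ℝ → ℝ) (I : Set ℝ) (R₀ : ℝ) : Prop :=
  IsVacuumSolution κ (kundtChart f I) (kundtMetric f R₀)

/-- The set of all `r` where `r ^ p` is defined and smooth: `r > 0`, and also `r < 0` if `p` is
an integer (`r = 0` is left out also for `p ∈ ℕ`). -/
def powDomain (p : ℝ) : Set ℝ := {r | 0 < r ∨ (r ≠ 0 ∧ ∃ n : ℤ, p = n)}

/-- `c₁ = 2 (18 η₃ + 6 η₇ + η₈)` -/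
def Couplings.c₁ (κ : Couplings) : ℝ := 2 * (18 * κ.η₃ + 6 * κ.η₇ + κ.η₈)

/-- `c₂ = -3 (3 η₄ + η₆)` -/
def Couplings.c₂ (κ : Couplings) : ℝ := -3 * (3 * κ.η₄ + κ.η₆)

/-- `36 η₃ + 9 η₄ + 3 η₆ + 12 η₇ + 2 η₈` -/
def Couplings.c₃ (κ : Couplings) : ℝ :=
  36 * κ.η₃ + 9 * κ.η₄ + 3 * κ.η₆ + 12 * κ.η₇ + 2 * κ.η₈

end

end SixDerivativeGravity

open SixDerivativeGravity

namespace SixDerivativeGravity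

open MeasureTheory Filter Topology

noncomputable section

/-! ### Partial derivatives -/

/-! The metric is a direct product of a Lorentzian surface with coordinates `t, r` and Gaussian
curvature `-f''/2`, and a round sphere of curvature `k = 1/R₀²`. All of its curvature is encoded in
two functions of `r`: `w`, one sixth of the Ricci scalar, and `σ`, for which the traceless Ricci
tensor is `σ` on one block and `-σ` on the other. The Weyl tensor is `w` times `weylUnit`, a
covariantly constant tensor built from the metrics of the two factors, so `□` of the Weyl tensor is
the scalar `□ w` times `weylUnit`.

Stationarity is required under arbitrary variations `h`, without any symmetry, so the full first
variation of the action is computed. For the algebraic invariants it is a combination of three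
scalars: `scalarVar`, `splitVar` and `weylVar`. The cubic invariant of `S` contributes nothing,
since `S² = σ²` and `S` stays traceless; this is why `η₅` never matters. For `C □ C` and `R □ R` the
decisive statement is `variation_contractBox`: contraction with a parallel tensor commutes with `∇`,
and the trace property of `weylUnit` reduces the variation of the connection on the tensor slots to
its trace.

Integration by parts then removes all derivatives of `h`. Green's identity (`isDivergence_box`) and
`isDivergence_traceDiv` dispose of the terms with `□`; the Palatini identity
(`isDivergence_curvature`) turns curvature variations into connection variations; and
`isDivergence_gammaVar` turns these into the diagonal components `h^a_a`. What remains is three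
ordinary differential equations, `KundtEquations`. If they hold, the varied density is the
divergence of a field supported in `tsupport h` (`isDivergence_variation_density`) and its integral
vanishes.

Written in the derivatives of `f` up to order six, these are the polynomial equations
`JetEquations`. For quadratic `f` only two algebraic equations survive. A boost symmetry
(`JetEquations.scale`) makes it enough to test `A x² + C x^p` at `x = 1`. For arbitrary `f` the
equations have to hold identically in the derivatives. Every case of the theorem is thereby a
polynomial identity in the couplings and coefficients. -/

theorem contDiffOn_pd {U : Set Coord} (hU : IsOpen U) {F : Coord → ℝ} (hF : ContDiffOn ℝ ∞ F U)
    (i : Fin 4) : ContDiffOn ℝ ∞ (pd i F) U :=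
  (hF.fderiv_of_isOpen hU (m := ∞) (by simp)).clm_apply contDiffOn_const

theorem pd_congr_of_eventuallyEq {F G : Coord → ℝ} {x : Coord} (h : F =ᶠ[𝓝 x] G) (i : Fin 4) :
    pd i F x = pd i G x := by
  simp only [pd, h.fderiv_eq]

theorem pd_congr_of_isOpen {U : Set Coord} (hU : IsOpen U) {F G : Coord → ℝ}
    (h : ∀ x ∈ U, F x = G x) (i : Fin 4) {x : Coord} (hx : x ∈ U) : pd i F x = pd i G x :=
  pd_congr_of_eventuallyEq (Filter.eventuallyEq_of_mem (hU.mem_nhds hx) h) i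

section PdRules

variable {F G : Coord → ℝ} {x : Coord} (i : Fin 4)

theorem pd_add (hF : DifferentiableAt ℝ F x) (hG : DifferentiableAt ℝ G x) :
    pd i (fun y => F y + G y) x = pd i F x + pd i G x := by
  simp [pd, fderiv_fun_add hF hG]

theorem pd_sub (hF : DifferentiableAt ℝ F x) (hG : DifferentiableAt ℝ G x) :
    pd i (fun y => F y - G y) x = pd i F x - pd i G x := by
  simp [pd, fderiv_fun_sub hF hG]

theorem pd_mul (hF : DifferentiableAt ℝ F x) (hG : DifferentiableAt ℝ G x) :
    pd i (fun y => F y * G y) x = pd i F x * G x + F x * pd i G x := by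
  simp [pd, fderiv_fun_mul hF hG]; ring

theorem pd_const (c : ℝ) : pd i (fun _ => c) x = 0 := by
  simp [pd]

theorem pd_const_mul (hF : DifferentiableAt ℝ F x) (c : ℝ) :
    pd i (fun y => c * F y) x = c * pd i F x := by
  simp [pd, fderiv_const_mul hF]

theorem pd_sum {ι : Type*} (s : Finset ι) {F : ι → Coord → ℝ}
    (hF : ∀ j ∈ s, DifferentiableAt ℝ (F j) x) :
    pd i (fun y => ∑ j ∈ s, F j y) x = ∑ j ∈ s, pd i (F j) x := by
  simp [pd, fderiv_fun_sum hF]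

theorem pd_comp_apply {φ : ℝ → ℝ} {φ' : ℝ} {j : Fin 4} (h : HasDerivAt φ φ' (x j)) :
    pd i (fun y => φ (y j)) x = if i = j then φ' else 0 := by
  have hp : HasFDerivAt (fun y : Coord => y j) (ContinuousLinearMap.proj (R := ℝ) j) x :=
    (ContinuousLinearMap.proj (R := ℝ) (φ := fun _ : Fin 4 => ℝ) j).hasFDerivAt
  have := h.comp_hasFDerivAt x hp
  simp only [pd]
  rw [show (fun y : Coord => φ (y j)) = φ ∘ fun y => y j from rfl, this.fderiv]
  rcases eq_or_ne i j with rfl | hij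
  · simp
  · simp [hij, hij.symm]

end PdRules

/-! ### Divergences -/

/-- `D` is on `U` the divergence of a smooth vector field that vanishes outside of `K`. -/
def IsDivergence (U K : Set Coord) (D : Coord → ℝ) : Prop :=
  ∃ V : Fin 4 → Coord → ℝ, (∀ i, ContDiffOn ℝ ∞ (V i) U) ∧ (∀ i, ∀ x ∉ K, V i x = 0) ∧
    ∀ x ∈ U, D x = ∑ i, pd i (V i) x

theorem IsDivergence.add {U K : Set Coord} (hU : IsOpen U) {D E : Coord → ℝ}
    (hD : IsDivergence U K D) (hE : IsDivergence U K E) :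
    IsDivergence U K (fun x => D x + E x) := by
  obtain ⟨V, hV, hV0, hVD⟩ := hD
  obtain ⟨V', hV', hV0', hVD'⟩ := hE
  refine ⟨fun i x => V i x + V' i x, fun i => (hV i).add (hV' i), fun i x hx => ?_, fun x hx => ?_⟩
  · simp [hV0 i x hx, hV0' i x hx]
  · show D x + E x = ∑ i, pd i (fun y => V i y + V' i y) x
    rw [hVD x hx, hVD' x hx, ← Finset.sum_add_distrib]
    refine Finset.sum_congr rfl fun i _ => ?_
    rw [pd_add]
    · exact ((hV i).contDiffAt (hU.mem_nhds hx)).differentiableAt (by simp)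
    · exact ((hV' i).contDiffAt (hU.mem_nhds hx)).differentiableAt (by simp)

theorem IsDivergence.congr {U K : Set Coord} {D E : Coord → ℝ}
    (hD : IsDivergence U K D) (h : ∀ x ∈ U, E x = D x) : IsDivergence U K E := by
  obtain ⟨V, hV, hV0, hVD⟩ := hD
  exact ⟨V, hV, hV0, fun x hx => (h x hx).trans (hVD x hx)⟩

/-- Vanishing off the compact set `K` makes `V`, smooth only near `K`, a smooth compactly supported
function on the whole space, and the derivative of such a function has integral zero. No regularity
of the boundary of `K` is involved. -/
theorem integral_pd_eq_zero {U K : Set Coord} (hU : IsOpen U) (hK : IsCompact K) (hKU : K ⊆ U)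
    {V : Coord → ℝ} (hV : ContDiffOn ℝ ∞ V U) (hV0 : ∀ x ∉ K, V x = 0) (i : Fin 4) :
    IntegrableOn (pd i V) K ∧ ∫ x in K, pd i V x = 0 := by
  have hloc : ∀ x ∉ K, V =ᶠ[𝓝 x] fun _ => 0 := fun x hx =>
    Filter.eventuallyEq_of_mem (hK.isClosed.isOpen_compl.mem_nhds hx) fun y hy => hV0 y hy
  have hsm : ContDiff ℝ ∞ V := by
    rw [contDiff_iff_contDiffAt]
    intro x
    by_cases hx : x ∈ K
    · exact hV.contDiffAt (hU.mem_nhds (hKU hx))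
    · exact contDiffAt_const.congr_of_eventuallyEq (hloc x hx)
  have hpd0 : ∀ x ∉ K, pd i V x = 0 := fun x hx => by
    rw [pd_congr_of_eventuallyEq (hloc x hx), pd_const]
  have hVc : HasCompactSupport V := HasCompactSupport.intro hK fun x hx => hV0 x hx
  have hpdc : HasCompactSupport (pd i V) := HasCompactSupport.intro hK fun x hx => hpd0 x hx
  have hVi : Integrable V := hsm.continuous.integrable_of_hasCompactSupport hVc
  have hpdcont : Continuous (pd i V) :=
    (contDiffOn_univ.1 (contDiffOn_pd isOpen_univ (contDiffOn_univ.2 hsm) i)).continuous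
  have hpdi : Integrable (pd i V) := hpdcont.integrable_of_hasCompactSupport hpdc
  refine ⟨hpdi.integrableOn, ?_⟩
  rw [setIntegral_eq_integral_of_forall_compl_eq_zero hpd0]
  -- Integration by parts against the constant function `1`, whose derivative vanishes.
  have := integral_mul_fderiv_eq_neg_fderiv_mul_of_integrable (μ := (volume : Measure Coord))
    (f := fun _ => (1 : ℝ)) (g := V) (v := Pi.single i 1) (by simp) (by simpa using! hpdi)
    (by simpa using hVi) (by intro x _; fun_prop)
    (by intro x _; exact (hsm.differentiable (by simp)).differentiableAt)
  simpa [pd] using this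

theorem IsDivergence.integral_eq_zero {U K : Set Coord} (hU : IsOpen U) (hK : IsCompact K)
    (hKU : K ⊆ U) {D : Coord → ℝ} (hD : IsDivergence U K D) : ∫ x in K, D x = 0 := by
  obtain ⟨V, hV, hV0, hVD⟩ := hD
  rw [setIntegral_congr_fun hK.measurableSet fun x hx => hVD x (hKU hx), integral_finsetSum]
  · exact Finset.sum_eq_zero fun i _ => (integral_pd_eq_zero hU hK hKU (hV i) (hV0 i) i).2
  · exact fun i _ => (integral_pd_eq_zero hU hK hKU (hV i) (hV0 i) i).1

/-! ### One-parameter families -/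

/-- The first coordinate direction of `ℝ × Coord` is the parameter of a family of functions. -/
def SmoothFamily (W : Set (ℝ × Coord)) (F : ℝ → Coord → ℝ) : Prop :=
  ContDiffOn ℝ ∞ (fun p : ℝ × Coord => F p.1 p.2) W

section Family

variable {W : Set (ℝ × Coord)} {F : ℝ → Coord → ℝ}

theorem SmoothFamily.hasDerivAt (hW : IsOpen W) (hF : SmoothFamily W F) {ε : ℝ} {x : Coord}
    (hx : (ε, x) ∈ W) : HasDerivAt (fun t => F t x)
      (fderiv ℝ (fun p : ℝ × Coord => F p.1 p.2) (ε, x) (1, 0)) ε := by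
  have h1 : HasFDerivAt (fun p : ℝ × Coord => F p.1 p.2)
      (fderiv ℝ (fun p : ℝ × Coord => F p.1 p.2) (ε, x)) (ε, x) :=
    ((hF.contDiffAt (hW.mem_nhds hx)).differentiableAt (by simp)).hasFDerivAt
  have h2 : HasDerivAt (fun t : ℝ => (t, x)) ((1 : ℝ), (0 : Coord)) ε :=
    (hasDerivAt_id ε).prodMk (hasDerivAt_const ε x)
  exact h1.comp_hasDerivAt ε h2

theorem SmoothFamily.pd_eq (hW : IsOpen W) (hF : SmoothFamily W F) (i : Fin 4) {ε : ℝ} {x : Coord}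
    (hx : (ε, x) ∈ W) : pd i (F ε) x =
      fderiv ℝ (fun p : ℝ × Coord => F p.1 p.2) (ε, x) (0, Pi.single i 1) := by
  have h1 : HasFDerivAt (fun p : ℝ × Coord => F p.1 p.2)
      (fderiv ℝ (fun p : ℝ × Coord => F p.1 p.2) (ε, x)) (ε, x) :=
    ((hF.contDiffAt (hW.mem_nhds hx)).differentiableAt (by simp)).hasFDerivAt
  have h2 : HasFDerivAt (fun y : Coord => (ε, y)) (ContinuousLinearMap.inr ℝ ℝ Coord) x :=
    hasFDerivAt_prodMk_right ε x
  have h3 : HasFDerivAt (F ε) _ x := h1.comp x h2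
  rw [pd, h3.fderiv]
  simp

theorem SmoothFamily.pd (hW : IsOpen W) (hF : SmoothFamily W F) (i : Fin 4) :
    SmoothFamily W (fun ε => pd i (F ε)) := by
  have h : ContDiffOn ℝ ∞ (fun p : ℝ × Coord =>
      fderiv ℝ (fun p : ℝ × Coord => F p.1 p.2) p (0, Pi.single i 1)) W :=
    (hF.fderiv_of_isOpen hW (m := ∞) (by simp)).clm_apply contDiffOn_const
  exact h.congr fun p hp => hF.pd_eq hW i hp

theorem SmoothFamily.contDiffOn_deriv (hW : IsOpen W) (hF : SmoothFamily W F) :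
    ContDiffOn ℝ ∞ (fun p : ℝ × Coord => deriv (fun t => F t p.2) p.1) W := by
  have h : ContDiffOn ℝ ∞ (fun p : ℝ × Coord =>
      fderiv ℝ (fun p : ℝ × Coord => F p.1 p.2) p (1, 0)) W :=
    (hF.fderiv_of_isOpen hW (m := ∞) (by simp)).clm_apply contDiffOn_const
  exact h.congr fun p hp => (hF.hasDerivAt hW hp).deriv

/-- Both sides are the second derivative of the joint function of `(ε, x)` in the directions `(1,
0)` and `(0, e_i)`, which is symmetric. This allows the first variation to pass through every
partial derivative in the curvature. -/
theorem SmoothFamily.deriv_pd (hW : IsOpen W) (hF : SmoothFamily W F) (i : Fin 4) {ε : ℝ}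
    {x : Coord} (hx : (ε, x) ∈ W) :
    deriv (fun t => SixDerivativeGravity.pd i (F t) x) ε =
      SixDerivativeGravity.pd i (fun y => deriv (fun t => F t y) ε) x := by
  set Φ : ℝ × Coord → ℝ := fun p => F p.1 p.2 with hΦ
  have hd : DifferentiableAt ℝ (fderiv ℝ Φ) (ε, x) :=
    ((hF.fderiv_of_isOpen hW (m := ∞) (by simp)).contDiffAt
      (hW.mem_nhds hx)).differentiableAt (by simp)
  have hdW : ∀ᶠ p in 𝓝 (ε, x), p ∈ W := hW.mem_nhds hx
  have h1 : (fun t => SixDerivativeGravity.pd i (F t) x) =ᶠ[𝓝 ε]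
      fun t => fderiv ℝ Φ (t, x) (0, Pi.single i 1) := by
    have : Tendsto (fun t : ℝ => (t, x)) (𝓝 ε) (𝓝 (ε, x)) := by
      apply Continuous.tendsto; fun_prop
    filter_upwards [this.eventually hdW] with t ht using hF.pd_eq hW i ht
  have h2 : (fun y => deriv (fun t => F t y) ε) =ᶠ[𝓝 x] fun y => fderiv ℝ Φ (ε, y) (1, 0) := by
    have : Tendsto (fun y : Coord => (ε, y)) (𝓝 x) (𝓝 (ε, x)) := by
      apply Continuous.tendsto; fun_prop
    filter_upwards [this.eventually hdW] with t ht using (hF.hasDerivAt hW ht).deriv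
  have h3 : HasDerivAt (fun t : ℝ => fderiv ℝ Φ (t, x) (0, Pi.single i 1))
      (fderiv ℝ (fderiv ℝ Φ) (ε, x) (1, 0) (0, Pi.single i 1)) ε := by
    have h : HasDerivAt (fun t : ℝ => (t, x)) ((1 : ℝ), (0 : Coord)) ε :=
      (hasDerivAt_id ε).prodMk (hasDerivAt_const ε x)
    have h' : HasDerivAt (fun t : ℝ => fderiv ℝ Φ (t, x))
      (fderiv ℝ (fderiv ℝ Φ) (ε, x) (1, 0)) ε := hd.hasFDerivAt.comp_hasDerivAt ε h
    simpa using h'.clm_apply (hasDerivAt_const ε _)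
  have h4 : HasFDerivAt (fun y : Coord => fderiv ℝ Φ (ε, y))
      ((fderiv ℝ (fderiv ℝ Φ) (ε, x)).comp (ContinuousLinearMap.inr ℝ ℝ Coord)) x :=
    hd.hasFDerivAt.comp x (hasFDerivAt_prodMk_right ε x)
  have h5 := h4.clm_apply (hasFDerivAt_const ((1 : ℝ), (0 : Coord)) x)
  rw [h1.deriv_eq, h3.deriv, pd_congr_of_eventuallyEq h2, SixDerivativeGravity.pd, h5.fderiv]
  have hs := ((hF.contDiffAt (hW.mem_nhds hx)).isSymmSndFDerivAt (by
    simpa using! (WithTop.coe_le_coe.2 (le_top : (2 : ℕ∞) ≤ ⊤)))).eq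
    (1, 0) (0, Pi.single i 1)
  simpa using hs

theorem SmoothFamily.add {F G : ℝ → Coord → ℝ} (hF : SmoothFamily W F) (hG : SmoothFamily W G) :
    SmoothFamily W (fun ε x => F ε x + G ε x) := ContDiffOn.add hF hG

theorem SmoothFamily.sub {F G : ℝ → Coord → ℝ} (hF : SmoothFamily W F) (hG : SmoothFamily W G) :
    SmoothFamily W (fun ε x => F ε x - G ε x) := ContDiffOn.sub hF hG

theorem SmoothFamily.mul {F G : ℝ → Coord → ℝ} (hF : SmoothFamily W F) (hG : SmoothFamily W G) :
    SmoothFamily W (fun ε x => F ε x * G ε x) := ContDiffOn.mul hF hG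

theorem SmoothFamily.const (c : ℝ) : SmoothFamily W (fun _ _ => c) := contDiffOn_const

theorem SmoothFamily.pow {F : ℝ → Coord → ℝ} (hF : SmoothFamily W F) (n : ℕ) :
    SmoothFamily W (fun ε x => F ε x ^ n) := ContDiffOn.pow hF n

theorem SmoothFamily.sum {ι : Type*} {s : Finset ι} {F : ι → ℝ → Coord → ℝ}
    (hF : ∀ j, SmoothFamily W (F j)) :
    SmoothFamily W (fun ε x => ∑ j ∈ s, F j ε x) := ContDiffOn.sum fun j _ => hF j

theorem SmoothFamily.prod {ι : Type*} {s : Finset ι} {F : ι → ℝ → Coord → ℝ}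
    (hF : ∀ j, SmoothFamily W (F j)) :
    SmoothFamily W (fun ε x => ∏ j ∈ s, F j ε x) := contDiffOn_prod fun j _ => hF j

/-- Differentiation under the integral over a compact set. -/
theorem SmoothFamily.hasDerivAt_integral (hW : IsOpen W) (hF : SmoothFamily W F) {K : Set Coord}
    (hK : IsCompact K) (h0 : ∀ x ∈ K, ((0 : ℝ), x) ∈ W) :
    HasDerivAt (fun ε => ∫ x in K, F ε x) (∫ x in K, deriv (fun t => F t x) 0) 0 := by
  -- By the tube lemma `W` contains the product of an interval around the parameter `0` with `K`,
  -- not just the slice at `0`.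
  obtain ⟨u, v, hu, -, h0u, hKv, huv⟩ := generalized_tube_lemma (s := {(0 : ℝ)}) isCompact_singleton
    hK hW (by rintro ⟨a, b⟩ ⟨ha, hb⟩; obtain rfl : a = 0 := ha; exact h0 b hb)
  obtain ⟨δ, hδ, hδu⟩ := Metric.isOpen_iff.1 hu 0 (h0u rfl)
  have hsub : ∀ ε ∈ Metric.closedBall (0 : ℝ) (δ / 2), ∀ x ∈ K, (ε, x) ∈ W := fun ε hε x hx =>
    huv ⟨hδu (Metric.closedBall_subset_ball (by linarith) hε), hKv hx⟩
  have hcomp : IsCompact (Metric.closedBall (0 : ℝ) (δ / 2) ×ˢ K) :=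
    (isCompact_closedBall 0 (δ / 2)).prod hK
  have hcont := (hF.contDiffOn_deriv hW).continuousOn
  -- The parameter derivative is continuous on a compact product, hence bounded; the constant bound
  -- is integrable over `K` and serves as the dominating function.
  obtain ⟨C, hC⟩ := hcomp.exists_bound_of_continuousOn
    (hcont.mono fun p hp => hsub p.1 hp.1 p.2 hp.2)
  have hslice : ∀ {G : ℝ × Coord → ℝ}, ContinuousOn G W → ∀ ε ∈ Metric.closedBall (0 : ℝ) (δ / 2),
      ContinuousOn (fun x => G (ε, x)) K := fun hG ε hε =>
    hG.comp (by fun_prop) fun x hx => hsub ε hε x hx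
  have hmem : Metric.closedBall (0 : ℝ) (δ / 2) ∈ 𝓝 (0 : ℝ) :=
    Metric.closedBall_mem_nhds 0 (by linarith)
  have h0mem : (0 : ℝ) ∈ Metric.closedBall (0 : ℝ) (δ / 2) := mem_of_mem_nhds hmem
  refine (hasDerivAt_integral_of_dominated_loc_of_deriv_le (bound := fun _ => C)
    (F' := fun ε x => deriv (fun t => F t x) ε) hmem ?_ ?_ ?_ ?_ ?_ ?_).2
  · filter_upwards [hmem] with ε hε
    exact (hslice hF.continuousOn ε hε).aestronglyMeasurable hK.measurableSet
  · exact (hslice hF.continuousOn 0 h0mem).integrableOn_compact hK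
  · exact (hslice hcont 0 h0mem).aestronglyMeasurable hK.measurableSet
  · filter_upwards [ae_restrict_mem hK.measurableSet] with x hx ε hε
    exact hC (ε, x) ⟨hε, hx⟩
  · exact continuousOn_const.integrableOn_compact hK
  · filter_upwards [ae_restrict_mem hK.measurableSet] with x hx ε hε
    exact ((hF.hasDerivAt hW (hsub ε hε x hx)).differentiableAt).hasDerivAt

end Family

end

end SixDerivativeGravity


namespace SixDerivativeGravity

open MeasureTheory Filter Topology

noncomputable section

/-! ### Variations of the metric -/

/-- The metric `g + ε h`. -/
def perturb (g : Metric) (h : Coord → Matrix (Fin 4) (Fin 4) ℝ) (ε : ℝ) : Metric :=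
  fun x => g x + ε • h x

@[simp]
theorem perturb_zero (g : Metric) (h : Coord → Matrix (Fin 4) (Fin 4) ℝ) : perturb g h 0 = g := by
  funext x; simp [perturb]

/-- The first variation of the quantity `F` at the metric `g` in the direction `h`. -/
def variation (g : Metric) (h : Coord → Matrix (Fin 4) (Fin 4) ℝ) (F : Metric → Coord → ℝ)
    (x : Coord) : ℝ :=
  deriv (fun ε : ℝ => F (perturb g h ε) x) 0

/-- `g` is a smooth metric of negative determinant on the open set `U` and `h` is a smooth
variation of it with compact support in `U`. -/
structure IsVariation (U : Set Coord) (g : Metric) (h : Coord → Matrix (Fin 4) (Fin 4) ℝ) :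
    Prop where
  isOpen : IsOpen U
  smooth : ∀ a b, ContDiffOn ℝ ∞ (fun x => g x a b) U
  symm : ∀ x ∈ U, ∀ a b, g x a b = g x b a
  det_neg : ∀ x ∈ U, (g x).det < 0
  smooth_h : ∀ a b, ContDiff ℝ ∞ (fun x => h x a b)
  symm_h : ∀ x a b, h x a b = h x b a
  compact : HasCompactSupport h
  subset : tsupport h ⊆ U

/-- The parameters and points where the metric `g + ε h` has negative determinant. -/
def regularSet (U : Set Coord) (g : Metric) (h : Coord → Matrix (Fin 4) (Fin 4) ℝ) :
    Set (ℝ × Coord) :=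
  {p | p.2 ∈ U ∧ (perturb g h p.1 p.2).det < 0}

/-- `F` depends smoothly on the parameter and the point along the family `g + ε h`. -/
def SmoothFunctional (U : Set Coord) (g : Metric) (h : Coord → Matrix (Fin 4) (Fin 4) ℝ)
    (F : Metric → Coord → ℝ) : Prop :=
  SmoothFamily (regularSet U g h) (fun ε => F (perturb g h ε))

/-- The value `F g x` depends only on the germ of `g` at `x`. -/
def IsLocal (F : Metric → Coord → ℝ) : Prop :=
  ∀ (g g' : Metric) (x : Coord), g =ᶠ[𝓝 x] g' → F g x = F g' x

theorem contDiffOn_det {E : Type*} [NormedAddCommGroup E] [NormedSpace ℝ E] {n : ℕ} {S : Set E}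
    {M : E → Matrix (Fin n) (Fin n) ℝ} (hM : ∀ a b, ContDiffOn ℝ ∞ (fun p => M p a b) S) :
    ContDiffOn ℝ ∞ (fun p => (M p).det) S := by
  simp only [Matrix.det_apply']
  exact ContDiffOn.sum fun σ _ => contDiffOn_const.mul (contDiffOn_prod fun i _ => hM _ _)

/-- Cramer's rule: an entry of the inverse is a determinant in the entries of `M` divided by `det
M`. -/
theorem contDiffOn_inv_apply {E : Type*} [NormedAddCommGroup E] [NormedSpace ℝ E] {n : ℕ}
    {S : Set E} {M : E → Matrix (Fin n) (Fin n) ℝ}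
    (hM : ∀ a b, ContDiffOn ℝ ∞ (fun p => M p a b) S) (hdet : ∀ p ∈ S, (M p).det ≠ 0)
    (a b : Fin n) : ContDiffOn ℝ ∞ (fun p => (M p)⁻¹ a b) S := by
  simp only [Matrix.inv_def, Matrix.smul_apply, smul_eq_mul, Ring.inverse_eq_inv',
    Matrix.adjugate_apply]
  refine ((contDiffOn_det hM).inv hdet).mul (contDiffOn_det fun c d => ?_)
  simp only [Matrix.updateRow_apply]
  split_ifs
  · exact contDiffOn_const
  · exact hM _ _

section Variation

variable {U : Set Coord} {g : Metric} {h : Coord → Matrix (Fin 4) (Fin 4) ℝ}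

theorem IsVariation.contDiffOn_perturb (H : IsVariation U g h) (a b : Fin 4) :
    ContDiffOn ℝ ∞ (fun p : ℝ × Coord => perturb g h p.1 p.2 a b) (Set.univ ×ˢ U) := by
  simp only [perturb, Matrix.add_apply, Matrix.smul_apply, smul_eq_mul]
  refine ((H.smooth a b).comp contDiffOn_snd fun p hp => hp.2).add (contDiffOn_fst.mul ?_)
  exact (H.smooth_h a b).comp_contDiffOn contDiffOn_snd

theorem IsVariation.isOpen_regularSet (H : IsVariation U g h) : IsOpen (regularSet U g h) := by
  have := (contDiffOn_det H.contDiffOn_perturb).continuousOn.isOpen_inter_preimage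
    (isOpen_univ.prod H.isOpen) (isOpen_Iio (a := (0 : ℝ)))
  rwa [show regularSet U g h = Set.univ ×ˢ U ∩
    (fun p => (perturb g h p.1 p.2).det) ⁻¹' Set.Iio 0 by ext p; simp [regularSet]]

theorem IsVariation.mem_regularSet (H : IsVariation U g h) {x : Coord} (hx : x ∈ U) :
    ((0 : ℝ), x) ∈ regularSet U g h := ⟨hx, by simpa using H.det_neg x hx⟩

theorem SmoothFunctional.hasDerivAt {F : Metric → Coord → ℝ} (hF : SmoothFunctional U g h F)
    (H : IsVariation U g h) {x : Coord} (hx : x ∈ U) :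
    HasDerivAt (fun ε : ℝ => F (perturb g h ε) x) (variation g h F x) 0 :=
  (SmoothFamily.hasDerivAt H.isOpen_regularSet hF
    (H.mem_regularSet hx)).differentiableAt.hasDerivAt

theorem SmoothFunctional.contDiffOn_variation {F : Metric → Coord → ℝ}
    (hF : SmoothFunctional U g h F) (H : IsVariation U g h) :
    ContDiffOn ℝ ∞ (variation g h F) U :=
  ContDiffOn.comp (SmoothFamily.contDiffOn_deriv H.isOpen_regularSet hF)
    (f := fun x : Coord => ((0 : ℝ), x)) (by fun_prop) fun x hx => H.mem_regularSet hx

theorem SmoothFunctional.differentiableAt_variation {F : Metric → Coord → ℝ}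
    (hF : SmoothFunctional U g h F) (H : IsVariation U g h) {x : Coord} (hx : x ∈ U) :
    DifferentiableAt ℝ (variation g h F) x :=
  ((hF.contDiffOn_variation H).contDiffAt (H.isOpen.mem_nhds hx)).differentiableAt (by simp)

theorem SmoothFunctional.variation_pd {F : Metric → Coord → ℝ} (hF : SmoothFunctional U g h F)
    (H : IsVariation U g h) (i : Fin 4) {x : Coord} (hx : x ∈ U) :
    variation g h (fun g => pd i (F g)) x = pd i (variation g h F) x :=
  SmoothFamily.deriv_pd H.isOpen_regularSet hF i (H.mem_regularSet hx)

theorem IsVariation.eventually_regular (H : IsVariation U g h) {x : Coord} (hx : x ∈ U) :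
    ∀ᶠ ε in 𝓝 (0 : ℝ), (perturb g h ε x).det < 0 := by
  have : Tendsto (fun t : ℝ => (t, x)) (𝓝 0) (𝓝 (0, x)) := by
    apply Continuous.tendsto; fun_prop
  filter_upwards [this.eventually (H.isOpen_regularSet.mem_nhds (H.mem_regularSet hx))] with t ht
    using ht.2

/-- Off the support of `h` the family `g + ε h` is constant near the point. This confines the vector
fields of the integrations by parts to `tsupport h`, whatever their explicit form. -/
theorem variation_eq_zero_of_notMem {F : Metric → Coord → ℝ} (hF : IsLocal F) {x : Coord}
    (hx : x ∉ tsupport h) : variation g h F x = 0 := by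
  have h0 : h =ᶠ[𝓝 x] fun _ => 0 := Filter.eventuallyEq_of_mem
    ((isClosed_tsupport h).isOpen_compl.mem_nhds hx) fun y hy => image_eq_zero_of_notMem_tsupport hy
  have : ∀ ε : ℝ, F (perturb g h ε) x = F g x := fun ε => hF _ _ x <| by
    filter_upwards [h0] with y hy
    simp [perturb, hy]
  simp [variation, this]

/-! ### Smoothness of the curvature along the family -/

/-- The base of a tower: every curvature quantity arises from the metric, its inverse and its
determinant by sums, products and partial derivatives, all of which preserve joint smoothness in
`(ε, x)`. -/
theorem smoothFunctional_metric (H : IsVariation U g h) (a b : Fin 4) :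
    SmoothFunctional U g h (fun g x => g x a b) :=
  (H.contDiffOn_perturb a b).mono fun _ hp => ⟨Set.mem_univ _, hp.1⟩

theorem smoothFunctional_ginv (H : IsVariation U g h) (a b : Fin 4) :
    SmoothFunctional U g h (fun g => ginv g a b) :=
  contDiffOn_inv_apply (fun a b => smoothFunctional_metric H a b) (fun _ hp => hp.2.ne) a b

theorem smoothFunctional_sqrt_det (H : IsVariation U g h) :
    SmoothFunctional U g h (fun g x => Real.sqrt (-(g x).det)) :=
  (contDiffOn_det fun a b => smoothFunctional_metric H a b).neg.sqrt
    fun _ hp => (neg_pos.2 hp.2).ne'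

theorem SmoothFunctional.pd (H : IsVariation U g h) {F : Metric → Coord → ℝ}
    (hF : SmoothFunctional U g h F) (i : Fin 4) :
    SmoothFunctional U g h (fun g => SixDerivativeGravity.pd i (F g)) :=
  SmoothFamily.pd H.isOpen_regularSet hF i

theorem smoothFunctional_christoffel (H : IsVariation U g h) (a b c : Fin 4) :
    SmoothFunctional U g h (fun g => christoffel g a b c) := by
  refine (SmoothFamily.const (1 / 2)).mul (SmoothFamily.sum fun d => ?_)
  exact (smoothFunctional_ginv H a d).mul ((((smoothFunctional_metric H d c).pd H b).add
    ((smoothFunctional_metric H d b).pd H c)).sub ((smoothFunctional_metric H b c).pd H d))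

theorem smoothFunctional_covDeriv (H : IsVariation U g h) {k : ℕ} {T : Metric → TensorField k}
    (hT : ∀ I, SmoothFunctional U g h (fun g => T g I)) (I : Fin (k + 1) → Fin 4) :
    SmoothFunctional U g h (fun g => covDeriv g (T g) I) :=
  ((hT _).pd H _).sub (SmoothFamily.sum fun _ => SmoothFamily.sum fun _ =>
    (smoothFunctional_christoffel H _ _ _).mul (hT _))

theorem smoothFunctional_box (H : IsVariation U g h) {k : ℕ} {T : Metric → TensorField k}
    (hT : ∀ I, SmoothFunctional U g h (fun g => T g I)) (I : Fin k → Fin 4) :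
    SmoothFunctional U g h (fun g => box g (T g) I) :=
  SmoothFamily.sum fun e => SmoothFamily.sum fun f => (smoothFunctional_ginv H e f).mul
    (smoothFunctional_covDeriv H (smoothFunctional_covDeriv H hT) _)

theorem smoothFunctional_raise (H : IsVariation U g h) {k : ℕ} {T : Metric → TensorField k}
    (hT : ∀ I, SmoothFunctional U g h (fun g => T g I)) (I : Fin k → Fin 4) :
    SmoothFunctional U g h (fun g => raise g (T g) I) :=
  SmoothFamily.sum fun J => (SmoothFamily.prod fun _ => smoothFunctional_ginv H _ _).mul (hT J)

theorem smoothFunctional_riemannUp (H : IsVariation U g h) (a b c d : Fin 4) :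
    SmoothFunctional U g h (fun g => riemannUp g a b c d) := by
  have hΓ := smoothFunctional_christoffel H
  exact (((hΓ _ _ _).pd H c).sub ((hΓ _ _ _).pd H d)).add (SmoothFamily.sum fun e =>
    ((hΓ _ _ _).mul (hΓ _ _ _)).sub ((hΓ _ _ _).mul (hΓ _ _ _)))

theorem smoothFunctional_riemann (H : IsVariation U g h) (a b c d : Fin 4) :
    SmoothFunctional U g h (fun g => riemann g a b c d) :=
  SmoothFamily.sum fun e => (smoothFunctional_metric H a e).mul (smoothFunctional_riemannUp H _ _ _ _)

theorem smoothFunctional_ricci (H : IsVariation U g h) (b d : Fin 4) :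
    SmoothFunctional U g h (fun g => ricci g b d) :=
  SmoothFamily.sum fun _ => smoothFunctional_riemannUp H _ _ _ _

theorem smoothFunctional_ricciScalar (H : IsVariation U g h) :
    SmoothFunctional U g h ricciScalar :=
  SmoothFamily.sum fun a => SmoothFamily.sum fun b =>
    (smoothFunctional_ginv H a b).mul (smoothFunctional_ricci H a b)

theorem smoothFunctional_tracelessRicci (H : IsVariation U g h) (a b : Fin 4) :
    SmoothFunctional U g h (fun g => tracelessRicci g a b) :=
  (smoothFunctional_ricci H a b).sub (((SmoothFamily.const _).mul
    (smoothFunctional_ricciScalar H)).mul (smoothFunctional_metric H a b))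

theorem smoothFunctional_weyl (H : IsVariation U g h) (a b c d : Fin 4) :
    SmoothFunctional U g h (fun g => weyl g a b c d) := by
  have hg := smoothFunctional_metric H
  have hR := smoothFunctional_ricci H
  refine ((smoothFunctional_riemann H a b c d).sub ((SmoothFamily.const _).mul
    (((((hg _ _).mul (hR _ _)).sub ((hg _ _).mul (hR _ _))).sub ((hg _ _).mul (hR _ _))).add
      ((hg _ _).mul (hR _ _))))).add (SmoothFamily.mul ?_
    (((hg _ _).mul (hg _ _)).sub ((hg _ _).mul (hg _ _))))
  exact ContDiffOn.div_const (smoothFunctional_ricciScalar H) 6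

theorem smoothFunctional_weylTensor (H : IsVariation U g h) (I : Fin 4 → Fin 4) :
    SmoothFunctional U g h (fun g => weylTensor g I) := smoothFunctional_weyl H _ _ _ _

theorem smoothFunctional_sTensor (H : IsVariation U g h) (I : Fin 2 → Fin 4) :
    SmoothFunctional U g h (fun g => sTensor g I) := smoothFunctional_tracelessRicci H _ _

theorem smoothFunctional_invCC (H : IsVariation U g h) : SmoothFunctional U g h invCC :=
  SmoothFamily.sum fun I => (smoothFunctional_weylTensor H I).mul
    (smoothFunctional_raise H (smoothFunctional_weylTensor H) I)

theorem smoothFunctional_invCBoxC (H : IsVariation U g h) : SmoothFunctional U g h invCBoxC :=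
  SmoothFamily.sum fun I => (smoothFunctional_weylTensor H I).mul
    (smoothFunctional_raise H (smoothFunctional_box H (smoothFunctional_weylTensor H)) I)

theorem smoothFunctional_invRBoxR (H : IsVariation U g h) : SmoothFunctional U g h invRBoxR :=
  (smoothFunctional_ricciScalar H).mul
    (smoothFunctional_box H (T := fun g _ => ricciScalar g)
      (fun _ => smoothFunctional_ricciScalar H) Fin.elim0)

theorem smoothFunctional_invSS (H : IsVariation U g h) : SmoothFunctional U g h invSS :=
  SmoothFamily.sum fun a => SmoothFamily.sum fun b => (smoothFunctional_tracelessRicci H a b).mul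
    (smoothFunctional_raise H (smoothFunctional_sTensor H) _)

theorem smoothFunctional_invSSS (H : IsVariation U g h) : SmoothFunctional U g h invSSS :=
  SmoothFamily.sum fun a => SmoothFamily.sum fun b => SmoothFamily.sum fun c =>
    ((smoothFunctional_tracelessRicci H a b).mul (SmoothFamily.sum fun m =>
      (smoothFunctional_ginv H a m).mul (smoothFunctional_tracelessRicci H m c))).mul
    (smoothFunctional_raise H (smoothFunctional_sTensor H) _)

theorem smoothFunctional_invSSC (H : IsVariation U g h) : SmoothFunctional U g h invSSC :=
  SmoothFamily.sum fun a => SmoothFamily.sum fun b => SmoothFamily.sum fun c =>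
    SmoothFamily.sum fun d => ((smoothFunctional_tracelessRicci H a b).mul
      (smoothFunctional_tracelessRicci H c d)).mul
    (smoothFunctional_raise H (smoothFunctional_weylTensor H) _)

theorem smoothFunctional_invCCC (H : IsVariation U g h) : SmoothFunctional U g h invCCC :=
  SmoothFamily.sum fun a => SmoothFamily.sum fun b => SmoothFamily.sum fun c =>
    SmoothFamily.sum fun d => SmoothFamily.sum fun e => SmoothFamily.sum fun f =>
    ((smoothFunctional_weyl H a b c d).mul
      (smoothFunctional_raise H (smoothFunctional_weylTensor H) _)).mul
    (SmoothFamily.sum fun m => SmoothFamily.sum fun n =>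
      ((smoothFunctional_raise H (smoothFunctional_weylTensor H) _).mul
        (smoothFunctional_metric H m e)).mul (smoothFunctional_metric H n f))

theorem smoothFunctional_lagrangian (H : IsVariation U g h) (κ : Couplings) :
    SmoothFunctional U g h (lagrangian κ) := by
  have hR := smoothFunctional_ricciScalar H
  have hc : ∀ c : ℝ, SmoothFamily (regularSet U g h) (fun _ _ => c) := SmoothFamily.const
  exact (((((((((((hc _).mul (hR.sub (hc _))).add ((hc _).mul (hR.pow 2))).sub
    ((hc _).mul (smoothFunctional_invCC H))).sub
    ((hc _).mul (smoothFunctional_invCBoxC H))).add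
    ((hc _).mul (smoothFunctional_invRBoxR H))).add
    ((hc _).mul (hR.pow 3))).add
    ((hc _).mul (hR.mul (smoothFunctional_invSS H)))).add
    ((hc _).mul (smoothFunctional_invSSS H))).add
    ((hc _).mul (smoothFunctional_invSSC H))).add
    ((hc _).mul (hR.mul (smoothFunctional_invCC H)))).add
    ((hc _).mul (smoothFunctional_invCCC H))

/-- The derivative of the action is the integral of the first variation of its density. -/
theorem IsVariation.hasDerivAt_action (H : IsVariation U g h) (κ : Couplings) :
    HasDerivAt (fun ε : ℝ => action κ (tsupport h) (fun x => g x + ε • h x))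
      (∫ x in tsupport h,
        variation g h (fun g x => Real.sqrt (-(g x).det) * lagrangian κ g x) x) 0 :=
  SmoothFamily.hasDerivAt_integral H.isOpen_regularSet
    ((smoothFunctional_sqrt_det H).mul (smoothFunctional_lagrangian H κ)) H.compact
    fun _ hx => H.mem_regularSet (H.subset hx)

/-! ### Locality -/

/-- Two metrics with the same germ at a point also have the same germ at all nearby points, so
locality survives differentiation. -/
theorem IsLocal.pd {F : Metric → Coord → ℝ} (hF : IsLocal F) (i : Fin 4) :
    IsLocal (fun g => SixDerivativeGravity.pd i (F g)) := fun g g' _ hx =>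
  pd_congr_of_eventuallyEq ((eventually_eventually_nhds.2 hx).mono fun y hy => hF g g' y hy) i

theorem isLocal_metric (a b : Fin 4) : IsLocal (fun g x => g x a b) := fun _ _ _ hx => by
  simp only [hx.eq_of_nhds]

theorem isLocal_ginv (a b : Fin 4) : IsLocal (fun g => ginv g a b) := fun _ _ _ hx => by
  simp only [ginv, hx.eq_of_nhds]

theorem isLocal_christoffel (a b c : Fin 4) : IsLocal (fun g => christoffel g a b c) :=
  fun g g' x hx => by
    simp only [christoffel]
    simp only [fun a b => isLocal_ginv a b g g' x hx,
      fun a b i => (isLocal_metric a b).pd i g g' x hx]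

theorem isLocal_riemannUp (a b c d : Fin 4) : IsLocal (fun g => riemannUp g a b c d) :=
  fun g g' x hx => by
    simp only [riemannUp]
    simp only [fun a b c => isLocal_christoffel a b c g g' x hx,
      fun a b c i => (isLocal_christoffel a b c).pd i g g' x hx]

theorem isLocal_ricci (a b : Fin 4) : IsLocal (fun g => ricci g a b) := fun g g' x hx => by
  simp only [ricci]
  simp only [fun a b c d => isLocal_riemannUp a b c d g g' x hx]

theorem isLocal_ricciScalar : IsLocal ricciScalar := fun g g' x hx => by
  simp only [ricciScalar]
  simp only [fun a b => isLocal_ginv a b g g' x hx, fun a b => isLocal_ricci a b g g' x hx]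

theorem isLocal_weylTensor (I : Fin 4 → Fin 4) : IsLocal (fun g => weylTensor g I) :=
  fun g g' x hx => by
    simp only [weylTensor, weyl, riemann]
    simp only [fun a b => isLocal_metric a b g g' x hx, fun a b => isLocal_ricci a b g g' x hx,
      fun a b c d => isLocal_riemannUp a b c d g g' x hx, isLocal_ricciScalar g g' x hx]

/-! ### First variations for a general metric -/

theorem variation_metric (a b : Fin 4) (x : Coord) :
    variation g h (fun g x => g x a b) x = h x a b := by
  simp [variation, perturb]

/-- Differentiation of `g g⁻¹ = 1`, followed by multiplication by `g⁻¹` from the left. -/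
theorem variation_ginv (H : IsVariation U g h) (a b : Fin 4) {x : Coord} (hx : x ∈ U) :
    variation g h (fun g => ginv g a b) x = -∑ c, ∑ d, ginv g a c x * h x c d * ginv g d b x := by
  set A : Matrix (Fin 4) (Fin 4) ℝ :=
    Matrix.of fun a b => variation g h (fun g => ginv g a b) x with hA
  have hdet : IsUnit (g x).det := (H.det_neg x hx).ne.isUnit
  have key : h x * (g x)⁻¹ + g x * A = 0 := by
    ext i j
    have h1 : HasDerivAt (fun ε : ℝ => ∑ m, perturb g h ε x i m * ginv (perturb g h ε) m j x)
        (∑ m, (variation g h (fun g x => g x i m) x * ginv (perturb g h 0) m j x +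
          perturb g h 0 x i m * variation g h (fun g => ginv g m j) x)) 0 :=
      HasDerivAt.fun_sum fun m _ => ((smoothFunctional_metric H i m).hasDerivAt H hx).mul
        ((smoothFunctional_ginv H m j).hasDerivAt H hx)
    -- The product is the identity as long as the determinant stays negative, hence for all `ε` near
    -- `0`.
    have h2 : (fun ε : ℝ => ∑ m, perturb g h ε x i m * ginv (perturb g h ε) m j x) =ᶠ[𝓝 0]
        fun _ => (1 : Matrix (Fin 4) (Fin 4) ℝ) i j := by
      filter_upwards [H.eventually_regular hx] with ε hε
      rw [← Matrix.mul_nonsing_inv _ hε.ne.isUnit, Matrix.mul_apply]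
      rfl
    have h3 := h1.unique ((hasDerivAt_const (0 : ℝ) _).congr_of_eventuallyEq h2)
    simp only [variation_metric, perturb_zero, Finset.sum_add_distrib] at h3
    simpa [Matrix.mul_apply, hA, ginv] using h3
  have hA' : A = -((g x)⁻¹ * h x * (g x)⁻¹) := by
    have := congrArg (fun M => (g x)⁻¹ * M) key
    simp only [Matrix.mul_add, Matrix.mul_zero, ← Matrix.mul_assoc,
      Matrix.nonsing_inv_mul _ hdet, Matrix.one_mul] at this
    exact eq_neg_of_add_eq_zero_right this
  have := congrFun (congrFun hA' a) b
  simp only [hA, Matrix.of_apply, Matrix.neg_apply, Matrix.mul_apply] at this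
  rw [this, neg_inj]
  simp only [Finset.sum_mul, ginv]
  exact Finset.sum_comm

/-- The variation commutes with `∂`, so only the Leibniz rule for the products `Γ T` is at stake:
the terms with `δT` complete the covariant derivative of `δT`, and the terms with `δΓ` are left
over. -/
theorem variation_covDeriv (H : IsVariation U g h) {k : ℕ} {T : Metric → TensorField k}
    (hT : ∀ I, SmoothFunctional U g h (fun g => T g I)) (I : Fin (k + 1) → Fin 4) {x : Coord}
    (hx : x ∈ U) :
    variation g h (fun g => covDeriv g (T g) I) x =
      covDeriv g (fun I => variation g h (fun g => T g I)) I x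
        - ∑ j : Fin k, ∑ m, variation g h (fun g => christoffel g m (I 0) (I j.succ)) x *
          T g (Function.update (fun i => I i.succ) j m) x := by
  have h1 := ((hT (fun j => I j.succ)).pd H (I 0)).hasDerivAt H hx
  rw [(hT _).variation_pd H _ hx] at h1
  have h2 : HasDerivAt (fun ε : ℝ => covDeriv (perturb g h ε) (T (perturb g h ε)) I x) _ 0 :=
    h1.sub (HasDerivAt.fun_sum fun (j : Fin k) (_ : j ∈ Finset.univ) =>
    HasDerivAt.fun_sum fun (m : Fin 4) (_ : m ∈ Finset.univ) =>
      ((smoothFunctional_christoffel H m (I 0) (I j.succ)).hasDerivAt H hx).mul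
        ((hT (Function.update (fun i => I i.succ) j m)).hasDerivAt H hx))
  rw [variation, h2.deriv]
  simp only [perturb_zero, covDeriv, Finset.sum_add_distrib]
  ring

theorem variation_riemannUp (H : IsVariation U g h) (a b c d : Fin 4) {x : Coord} (hx : x ∈ U) :
    variation g h (fun g => riemannUp g a b c d) x =
      pd c (variation g h fun g => christoffel g a d b) x
        - pd d (variation g h fun g => christoffel g a c b) x
        + ∑ e, (variation g h (fun g => christoffel g a c e) x * christoffel g e d b x
          + christoffel g a c e x * variation g h (fun g => christoffel g e d b) x
          - (variation g h (fun g => christoffel g a d e) x * christoffel g e c b x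
            + christoffel g a d e x * variation g h (fun g => christoffel g e c b) x)) := by
  have hΓ := smoothFunctional_christoffel H
  have h1 := ((hΓ a d b).pd H c).hasDerivAt H hx
  have h2 := ((hΓ a c b).pd H d).hasDerivAt H hx
  rw [(hΓ _ _ _).variation_pd H _ hx] at h1 h2
  have h3 : HasDerivAt (fun ε : ℝ => riemannUp (perturb g h ε) a b c d x) _ 0 :=
    (h1.sub h2).add (HasDerivAt.fun_sum fun (e : Fin 4) (_ : e ∈ Finset.univ) =>
      (((hΓ a c e).hasDerivAt H hx).mul ((hΓ e d b).hasDerivAt H hx)).sub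
        (((hΓ a d e).hasDerivAt H hx).mul ((hΓ e c b).hasDerivAt H hx)))
  rw [variation, h3.deriv]
  simp only [perturb_zero]

end Variation

end

end SixDerivativeGravity


namespace SixDerivativeGravity

open MeasureTheory Filter Topology

noncomputable section

/-! ### Contractions of tensor fields -/

/-- Exchanging the value in slot `j` with the extra index is an involution of the pairs `(I, m)`.
This is the relabelling of dummy indices in contractions. -/
theorem sum_update_swap {k : ℕ} (j : Fin k) (F : (Fin k → Fin 4) → Fin 4 → ℝ) :
    ∑ I, ∑ m, F (Function.update I j m) (I j) = ∑ I, ∑ m, F I m := by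
  have hinv : Function.Involutive
      (fun p : (Fin k → Fin 4) × Fin 4 => (Function.update p.1 j p.2, p.1 j)) := fun p => by
    simp
  simp only [← Fintype.sum_prod_type']
  exact Fintype.sum_equiv hinv.toPerm _ _ fun p => rfl

/-- Collapses a sum over multi-indices in which all slots but one are tied to `I`, as happens when
one of several diagonal inverse metrics is varied. -/
theorem sum_eq_sum_update {k : ℕ} (I : Fin k → Fin 4) (j : Fin k) (F : (Fin k → Fin 4) → ℝ)
    (hF : ∀ J, (∃ l, l ≠ j ∧ I l ≠ J l) → F J = 0) :
    ∑ J, F J = ∑ m, F (Function.update I j m) := by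
  refine (Fintype.sum_of_injective (fun m => Function.update I j m)
    (Function.update_injective I j) _ _ (fun J hJ => hF J ?_) fun m => rfl).symm
  by_contra! hc
  refine hJ ⟨J j, ?_⟩
  funext l
  rcases eq_or_ne l j with rfl | hl
  · simp
  · simp [hl, hc l hl]

/-- The diagonal of the inverse metric in diagonal coordinates. -/
def IsDiagonalInverse (U : Set Coord) (g : Metric) (q : Fin 4 → Coord → ℝ) : Prop :=
  ∀ x ∈ U, ∀ a b, ginv g a b x = if a = b then q a x else 0

theorem raise_of_diagonal {U : Set Coord} {g : Metric} {q : Fin 4 → Coord → ℝ}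
    (hq : IsDiagonalInverse U g q) {k : ℕ} (T : TensorField k) (I : Fin k → Fin 4) {x : Coord}
    (hx : x ∈ U) : raise g T I x = (∏ j, q (I j) x) * T I x := by
  rw [raise, Finset.sum_eq_single I]
  · simp [hq x hx]
  · intro J _ hJ
    obtain ⟨j, hj⟩ := Function.ne_iff.1 hJ
    rw [Finset.prod_eq_zero (Finset.mem_univ j), zero_mul]
    rw [hq x hx, if_neg hj.symm]
  · simp

section

variable {U : Set Coord} {g : Metric} {h : Coord → Matrix (Fin 4) (Fin 4) ℝ}
  {q : Fin 4 → Coord → ℝ}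

theorem variation_ginv_of_diagonal (H : IsVariation U g h) (hq : IsDiagonalInverse U g q)
    (a b : Fin 4) {x : Coord} (hx : x ∈ U) :
    variation g h (fun g => ginv g a b) x = -(q a x * h x a b * q b x) := by
  rw [variation_ginv H a b hx]
  simp [hq x hx]

/-- Each raised index carries one inverse metric. Varying it inserts `-h` into that slot, while the
other inverse metrics stay diagonal. -/
theorem variation_raise_of_diagonal (H : IsVariation U g h) (hq : IsDiagonalInverse U g q)
    {k : ℕ} {T : Metric → TensorField k} (hT : ∀ I, SmoothFunctional U g h (fun g => T g I))
    (I : Fin k → Fin 4) {x : Coord} (hx : x ∈ U) :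
    variation g h (fun g => raise g (T g) I) x = (∏ j, q (I j) x) *
      (variation g h (fun g => T g I) x -
        ∑ j, ∑ m, h x (I j) m * q m x * T g (Function.update I j m) x) := by
  have h1 : HasDerivAt (fun ε : ℝ => raise (perturb g h ε) (T (perturb g h ε)) I x) _ 0 :=
    HasDerivAt.fun_sum fun (J : Fin k → Fin 4) (_ : J ∈ Finset.univ) =>
      (HasDerivAt.fun_finsetProd fun (j : Fin k) (_ : j ∈ Finset.univ) =>
        (smoothFunctional_ginv H (I j) (J j)).hasDerivAt H hx).mul ((hT J).hasDerivAt H hx)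
  rw [variation, h1.deriv]
  simp only [perturb_zero, Finset.sum_add_distrib]
  have h2 : ∑ J, (∏ j, ginv g (I j) (J j) x) * variation g h (fun g => T g J) x =
      (∏ j, q (I j) x) * variation g h (fun g => T g I) x :=
    raise_of_diagonal hq (fun I => variation g h (fun g => T g I)) I hx
  rw [h2, mul_sub, add_comm, sub_eq_add_neg]
  congr 1
  simp only [smul_eq_mul, Finset.sum_mul]
  rw [Finset.sum_comm, Finset.mul_sum, ← Finset.sum_neg_distrib]
  refine Finset.sum_congr rfl fun j _ => ?_
  rw [sum_eq_sum_update I j, Finset.mul_sum, ← Finset.sum_neg_distrib]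
  · refine Finset.sum_congr rfl fun m _ => ?_
    rw [variation_ginv_of_diagonal H hq _ _ hx, Function.update_self]
    have : ∏ l ∈ Finset.univ.erase j, ginv g (I l) (Function.update I j m l) x =
        ∏ l ∈ Finset.univ.erase j, q (I l) x := by
      refine Finset.prod_congr rfl fun l hl => ?_
      rw [Function.update_of_ne (Finset.ne_of_mem_erase hl), hq x hx, if_pos rfl]
    rw [this, ← Finset.prod_erase_mul _ _ (Finset.mem_univ j)]
    ring
  · rintro J ⟨l, hl, hIJ⟩
    rw [Finset.prod_eq_zero (Finset.mem_erase.2 ⟨hl, Finset.mem_univ l⟩)]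
    · simp
    · rw [hq x hx, if_neg hIJ]

/-! ### Parallel tensors -/

/-- The covariant tensor field `K` is covariantly constant. -/
def IsParallel (U : Set Coord) (g : Metric) {k : ℕ} (K : TensorField k) : Prop :=
  ∀ x ∈ U, ∀ e I, pd e (K I) x =
    ∑ j, ∑ m, christoffel g m e (I j) x * K (Function.update I j m) x

/-- The contravariant tensor field `K` is covariantly constant. -/
def IsParallelUp (U : Set Coord) (g : Metric) {k : ℕ} (K : TensorField k) : Prop :=
  ∀ x ∈ U, ∀ e I, pd e (K I) x =
    -∑ j, ∑ m, christoffel g (I j) e m x * K (Function.update I j m) x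

/-- The compatibility of the connection with a diagonal inverse metric. -/
def IsCompatible (U : Set Coord) (g : Metric) (q : Fin 4 → Coord → ℝ) : Prop :=
  ∀ x ∈ U, ∀ e a b, christoffel g a e b x * q b x =
    -(christoffel g b e a x * q a x) - if a = b then pd e (q a) x else 0

/-- The components of `K` with all indices raised by a diagonal inverse metric. -/
def raiseDiag (q : Fin 4 → Coord → ℝ) {k : ℕ} (K : TensorField k) : TensorField k :=
  fun I x => (∏ j, q (I j) x) * K I x

/-- `IsCompatible` says that the inverse metric is itself covariantly constant. In each slot it
converts the connection term of a lower index, together with the derivative of `q`, into the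
connection term of an upper index. -/
theorem IsParallel.isParallelUp (hU : IsOpen U) {k : ℕ} {K : TensorField k}
    (hqs : ∀ a, ContDiffOn ℝ ∞ (q a) U)
    (hK : IsParallel U g K) (hKs : ∀ I, ContDiffOn ℝ ∞ (K I) U) (hc : IsCompatible U g q) :
    IsParallelUp U g (raiseDiag q K) := by
  intro x hx e I
  have hd : ∀ {F : Coord → ℝ}, ContDiffOn ℝ ∞ F U → DifferentiableAt ℝ F x := fun hF =>
    (hF.contDiffAt (hU.mem_nhds hx)).differentiableAt (by simp)
  have hprod : pd e (fun y => ∏ j, q (I j) y) x =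
      ∑ j, (∏ l ∈ Finset.univ.erase j, q (I l) x) * pd e (q (I j)) x := by
    simp only [pd]
    rw [(HasFDerivAt.finsetProd fun (j : Fin k) (_ : j ∈ Finset.univ) =>
      (hd (hqs (I j))).hasFDerivAt).fderiv]
    simp
  have h1 : pd e (raiseDiag q K I) x = _ :=
    pd_mul e (hd (contDiffOn_prod fun j _ => hqs (I j))) (hd (hKs I))
  rw [h1, hprod, hK x hx, Finset.sum_mul, Finset.mul_sum, ← Finset.sum_add_distrib,
    ← Finset.sum_neg_distrib]
  refine Finset.sum_congr rfl fun j _ => ?_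
  have hp : ∀ m, ∏ l, q (Function.update I j m l) x =
      (∏ l ∈ Finset.univ.erase j, q (I l) x) * q m x := fun m => by
    rw [← Finset.prod_erase_mul _ _ (Finset.mem_univ j), Function.update_self]
    congr 1
    exact Finset.prod_congr rfl fun l hl => by
      rw [Function.update_of_ne (Finset.ne_of_mem_erase hl)]
  have h2 : ∀ m, christoffel g (I j) e m x * raiseDiag q K (Function.update I j m) x =
      (∏ l ∈ Finset.univ.erase j, q (I l) x) *
      ((-(christoffel g m e (I j) x * q (I j) x) - if I j = m then pd e (q (I j)) x else 0) *
        K (Function.update I j m) x) := fun m => by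
    rw [← hc x hx, raiseDiag, hp]
    ring
  simp only [h2]
  rw [← Finset.mul_sum, ← Finset.prod_erase_mul _ _ (Finset.mem_univ j)]
  simp only [sub_mul, ite_mul, zero_mul, Finset.sum_sub_distrib, Finset.sum_ite_eq,
    Finset.mem_univ, if_true, Function.update_eq_self, Finset.mul_sum, neg_mul,
    Finset.sum_neg_distrib, mul_sub, mul_neg, neg_sub, sub_neg_eq_add]
  rw [add_comm, mul_assoc, add_comm]
  congr 1
  exact Finset.sum_congr rfl fun m _ => by ring

theorem covDeriv_cons {k : ℕ} (T : TensorField k) (e : Fin 4) (I : Fin k → Fin 4) (x : Coord) :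
    covDeriv g T (Fin.cons e I) x = pd e (T I) x
      - ∑ j, ∑ m, christoffel g m e (I j) x * T (Function.update I j m) x := by
  simp only [covDeriv, Fin.cons_zero, Fin.cons_succ]

theorem update_cons_succ {k : ℕ} (f : Fin 4) (I : Fin k → Fin 4) (j : Fin k) (m : Fin 4) :
    Function.update (Fin.cons f I : Fin (k + 1) → Fin 4) j.succ m =
      Fin.cons f (Function.update I j m) := (Fin.cons_update _ _ _ _).symm

theorem update_cons_zero {k : ℕ} (f : Fin 4) (I : Fin k → Fin 4) (m : Fin 4) :
    Function.update (Fin.cons f I : Fin (k + 1) → Fin 4) 0 m = Fin.cons m I :=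
  Fin.update_cons_zero _ _ _

theorem covDeriv_cons_cons {k : ℕ} (T : TensorField (k + 1)) (e f : Fin 4) (I : Fin k → Fin 4)
    (x : Coord) :
    covDeriv g T (Fin.cons e (Fin.cons f I)) x = pd e (T (Fin.cons f I)) x
      - (∑ m, christoffel g m e f x * T (Fin.cons m I) x
        + ∑ j, ∑ m, christoffel g m e (I j) x * T (Fin.cons f (Function.update I j m)) x) := by
  rw [covDeriv_cons]
  simp only [Fin.sum_univ_succ (n := k), Fin.cons_zero, Fin.cons_succ, update_cons_zero,
    update_cons_succ]

/-- Relabelling moves the connection coefficients from the upper indices of `κ` to the lower indices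
of `T`. This is why contraction with a parallel tensor commutes with `∇`. -/
theorem sum_pd_parallelUp_mul {k : ℕ} {κ : TensorField k} (hκ : IsParallelUp U g κ)
    (T : (Fin k → Fin 4) → ℝ) (e : Fin 4) {x : Coord} (hx : x ∈ U) :
    ∑ I, pd e (κ I) x * T I = -∑ I, κ I x * ∑ j, ∑ m, christoffel g m e (I j) x *
      T (Function.update I j m) := by
  simp only [hκ x hx, neg_mul, Finset.sum_neg_distrib, neg_inj, Finset.sum_mul, Finset.mul_sum]
  rw [Finset.sum_comm, Finset.sum_comm (s := (Finset.univ : Finset (Fin k → Fin 4)))]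
  refine Finset.sum_congr rfl fun j _ => ?_
  rw [← sum_update_swap j]
  refine Finset.sum_congr rfl fun I _ => Finset.sum_congr rfl fun m _ => ?_
  simp only [Function.update_self, Function.update_idem, Function.update_eq_self]
  ring

theorem sum_mul_covDeriv {k : ℕ} {κ : TensorField k} (hκ : IsParallelUp U g κ)
    (T : TensorField k) {x : Coord} (hκd : ∀ I, DifferentiableAt ℝ (κ I) x)
    (hTd : ∀ I, DifferentiableAt ℝ (T I) x) (e : Fin 4) (hx : x ∈ U) :
    ∑ I, κ I x * covDeriv g T (Fin.cons e I) x = pd e (fun y => ∑ I, κ I y * T I y) x := by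
  rw [pd_sum e Finset.univ (F := fun I y => κ I y * T I y) fun I _ => (hκd I).mul (hTd I)]
  simp only [fun I => pd_mul e (hκd I) (hTd I), Finset.sum_add_distrib,
    sum_pd_parallelUp_mul hκ _ e hx, covDeriv_cons, mul_sub, Finset.sum_sub_distrib]
  ring

/-- The first index of `T` is not contracted, so the result is a covector in it and keeps one
connection term. -/
theorem sum_mul_covDeriv_cons {k : ℕ} {κ : TensorField k} (hκ : IsParallelUp U g κ)
    (T : TensorField (k + 1)) {x : Coord} (hκd : ∀ I, DifferentiableAt ℝ (κ I) x)
    (hTd : ∀ I, DifferentiableAt ℝ (T I) x) (e f : Fin 4) (hx : x ∈ U) :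
    ∑ I, κ I x * covDeriv g T (Fin.cons e (Fin.cons f I)) x =
      pd e (fun y => ∑ I, κ I y * T (Fin.cons f I) y) x
        - ∑ m, christoffel g m e f x * ∑ I, κ I x * T (Fin.cons m I) x := by
  rw [pd_sum e Finset.univ (F := fun I y => κ I y * T (Fin.cons f I) y)
    fun I _ => (hκd I).mul (hTd _)]
  simp only [fun I => pd_mul e (hκd I) (hTd (Fin.cons f I)), Finset.sum_add_distrib,
    sum_pd_parallelUp_mul hκ _ e hx, covDeriv_cons_cons, mul_sub, mul_add,
    Finset.sum_sub_distrib]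
  have : ∑ I, κ I x * ∑ m, christoffel g m e f x * T (Fin.cons m I) x =
      ∑ m, christoffel g m e f x * ∑ I, κ I x * T (Fin.cons m I) x := by
    simp only [Finset.mul_sum]
    rw [Finset.sum_comm]
    exact Finset.sum_congr rfl fun m _ => Finset.sum_congr rfl fun I _ => by ring
  rw [this]
  ring

end

end

end SixDerivativeGravity


namespace SixDerivativeGravity

open MeasureTheory Filter Topology

noncomputable section

/-! ### The variation of `T □ T` for a multiple `T` of a covariantly constant tensor field -/

/-- The second covariant derivative of a function. -/
def hessian (g : Metric) (e f : Fin 4) (w : Coord → ℝ) (x : Coord) : ℝ :=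
  pd e (pd f w) x - ∑ m, christoffel g m e f x * pd m w x

/-- The d'Alembertian of a function in diagonal coordinates. -/
def laplacian (g : Metric) (q : Fin 4 → Coord → ℝ) (w : Coord → ℝ) (x : Coord) : ℝ :=
  ∑ e, q e x * hessian g e e w x

/-- `T_I (□ T)^I` -/
def contractBox {k : ℕ} (T : Metric → TensorField k) (g : Metric) (x : Coord) : ℝ :=
  ∑ I, T g I x * raise g (box g (T g)) I x

/-- The variation of `Γ^a_{ea}`. -/
def traceGamma (g : Metric) (h : Coord → Matrix (Fin 4) (Fin 4) ℝ) (e : Fin 4) (x : Coord) : ℝ :=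
  ∑ a, variation g h (fun g => christoffel g a e a) x

section

variable {U : Set Coord} {g : Metric} {h : Coord → Matrix (Fin 4) (Fin 4) ℝ}
  {q : Fin 4 → Coord → ℝ} {k : ℕ} {K : TensorField k} {w : Coord → ℝ}

/-- The connection terms cancel against the derivative of `K`, and only the scalar factor gets
differentiated. -/
theorem covDeriv_mul_parallel (hU : IsOpen U) (hK : IsParallel U g K)
    (hKs : ∀ I, ContDiffOn ℝ ∞ (K I) U) (hw : ContDiffOn ℝ ∞ w U) {T : TensorField k}
    (hT : ∀ x ∈ U, ∀ I, T I x = w x * K I x) (e : Fin 4) (I : Fin k → Fin 4) {x : Coord}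
    (hx : x ∈ U) : covDeriv g T (Fin.cons e I) x = pd e w x * K I x := by
  have hd : ∀ {F : Coord → ℝ}, ContDiffOn ℝ ∞ F U → DifferentiableAt ℝ F x := fun hF =>
    (hF.contDiffAt (hU.mem_nhds hx)).differentiableAt (by simp)
  rw [covDeriv_cons, pd_congr_of_isOpen hU (fun y hy => hT y hy I) e hx,
    pd_mul e (hd hw) (hd (hKs I)), hK x hx]
  simp only [hT x hx, Finset.mul_sum]
  rw [add_sub_assoc, add_eq_left, sub_eq_zero]
  exact Finset.sum_congr rfl fun j _ => Finset.sum_congr rfl fun m _ => by ring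

/-- For fixed `f` the components of the first derivative are again a scalar times `K`, so the
previous lemma applies twice; the connection term of the index `f` completes the Hessian. -/
theorem covDeriv_covDeriv_mul_parallel (hU : IsOpen U) (hK : IsParallel U g K)
    (hKs : ∀ I, ContDiffOn ℝ ∞ (K I) U) (hw : ContDiffOn ℝ ∞ w U) {T : TensorField k}
    (hT : ∀ x ∈ U, ∀ I, T I x = w x * K I x) (e f : Fin 4) (I : Fin k → Fin 4) {x : Coord}
    (hx : x ∈ U) :
    covDeriv g (covDeriv g T) (Fin.cons e (Fin.cons f I)) x = hessian g e f w x * K I x := by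
  have h1 : covDeriv g (fun I => covDeriv g T (Fin.cons f I)) (Fin.cons e I) x =
      pd e (pd f w) x * K I x := covDeriv_mul_parallel hU hK hKs (contDiffOn_pd hU hw f)
    (fun y hy I => covDeriv_mul_parallel hU hK hKs hw hT f I hy) e I hx
  rw [covDeriv_cons] at h1
  rw [covDeriv_cons_cons, hessian, sub_mul, ← h1, Finset.sum_mul]
  simp only [covDeriv_mul_parallel hU hK hKs hw hT _ _ hx, mul_assoc]
  ring

theorem box_mul_parallel (hU : IsOpen U) (hq : IsDiagonalInverse U g q) (hK : IsParallel U g K)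
    (hKs : ∀ I, ContDiffOn ℝ ∞ (K I) U) (hw : ContDiffOn ℝ ∞ w U) {T : TensorField k}
    (hT : ∀ x ∈ U, ∀ I, T I x = w x * K I x) (I : Fin k → Fin 4) {x : Coord}
    (hx : x ∈ U) : box g T I x = laplacian g q w x * K I x := by
  simp only [box, hq x hx, covDeriv_covDeriv_mul_parallel hU hK hKs hw hT _ _ _ hx, ite_mul,
    zero_mul, Finset.sum_ite_eq, Finset.mem_univ, if_true, laplacian, Finset.sum_mul, mul_assoc]

variable {T : Metric → TensorField k} {c : ℝ}

/-- Contractions of `K` with itself with one index moved by an endomorphism are `c` times the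
trace of this endomorphism. -/
def HasTraceProperty (U : Set Coord) (q : Fin 4 → Coord → ℝ) {k : ℕ} (K : TensorField k)
    (c : ℝ) : Prop :=
  ∀ x ∈ U, ∀ A : Fin 4 → Fin 4 → ℝ, ∑ I, raiseDiag q K I x *
    ∑ j, ∑ m, A (I j) m * K (Function.update I j m) x = c * ∑ a, A a a

/-- The part `∇ δT` contracts to an ordinary derivative because `K` is parallel. In the rest, `w
δΓ_f` acts as an endomorphism on each slot of `K`, and the trace property retains only its trace. -/
theorem sum_raise_variation_covDeriv (H : IsVariation U g h) (hqs : ∀ a, ContDiffOn ℝ ∞ (q a) U)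
    (hcomp : IsCompatible U g q) (hK : IsParallel U g K)
    (hKs : ∀ I, ContDiffOn ℝ ∞ (K I) U) (hTs : ∀ I, SmoothFunctional U g h (fun g => T g I))
    (hT : ∀ x ∈ U, ∀ I, T g I x = w x * K I x) (hc : HasTraceProperty U q K c)
    (f : Fin 4) {x : Coord} (hx : x ∈ U) :
    ∑ I, raiseDiag q K I x * variation g h (fun g => covDeriv g (T g) (Fin.cons f I)) x =
      pd f (fun y => ∑ I, raiseDiag q K I y * variation g h (fun g => T g I) y) x
        - c * (w x * traceGamma g h f x) := by
  have hκs : ∀ I, ContDiffOn ℝ ∞ (raiseDiag q K I) U := fun I =>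
    (contDiffOn_prod fun j _ => hqs (I j)).mul (hKs I)
  have hd : ∀ {F : Coord → ℝ}, ContDiffOn ℝ ∞ F U → DifferentiableAt ℝ F x := fun hF =>
    (hF.contDiffAt (H.isOpen.mem_nhds hx)).differentiableAt (by simp)
  simp only [variation_covDeriv H hTs _ hx, mul_sub, Finset.sum_sub_distrib]
  rw [sum_mul_covDeriv (hK.isParallelUp H.isOpen hqs hKs hcomp) (fun I => variation g h fun g => T g I)
    (fun I => hd (hκs I)) (fun I => (hTs I).differentiableAt_variation H hx) f hx]
  congr 1
  simp only [Fin.cons_zero, Fin.cons_succ, hT x hx]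
  have := hc x hx (fun a m => w x * variation g h (fun g => christoffel g m f a) x)
  rw [← Finset.mul_sum] at this
  rw [traceGamma, ← this]
  refine Finset.sum_congr rfl fun I _ => ?_
  congr 1
  exact Finset.sum_congr rfl fun j _ => Finset.sum_congr rfl fun m _ => by ring

/-- The first-order formula handles the inner derivative. The outer derivative brings a second `δΓ`:
on the derivative index it yields the term with the square of `K`, on the slots of the tensor
another trace. -/
theorem sum_raise_variation_covDeriv_covDeriv (H : IsVariation U g h)
    (hqs : ∀ a, ContDiffOn ℝ ∞ (q a) U)
    (hcomp : IsCompatible U g q) (hK : IsParallel U g K)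
    (hKs : ∀ I, ContDiffOn ℝ ∞ (K I) U) (hTs : ∀ I, SmoothFunctional U g h (fun g => T g I))
    (hw : ContDiffOn ℝ ∞ w U)
    (hT : ∀ x ∈ U, ∀ I, T g I x = w x * K I x) (hc : HasTraceProperty U q K c)
    (e f : Fin 4) {x : Coord} (hx : x ∈ U) :
    ∑ I, raiseDiag q K I x *
        variation g h (fun g => covDeriv g (covDeriv g (T g)) (Fin.cons e (Fin.cons f I))) x =
      hessian g e f (fun y => ∑ I, raiseDiag q K I y * variation g h (fun g => T g I) y) x
        - c * (pd e (fun y => w y * traceGamma g h f y) x -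
            ∑ m, christoffel g m e f x * (w x * traceGamma g h m x))
        - ∑ m, variation g h (fun g => christoffel g m e f) x * pd m w x *
            ∑ I, raiseDiag q K I x * K I x
        - c * (pd f w x * traceGamma g h e x) := by
  have hκs : ∀ I, ContDiffOn ℝ ∞ (raiseDiag q K I) U := fun I =>
    (contDiffOn_prod fun j _ => hqs (I j)).mul (hKs I)
  have hd : ∀ {F : Coord → ℝ}, ContDiffOn ℝ ∞ F U → DifferentiableAt ℝ F x := fun hF =>
    (hF.contDiffAt (H.isOpen.mem_nhds hx)).differentiableAt (by simp)
  have hG : ∀ f, ContDiffOn ℝ ∞ (traceGamma g h f) U := fun f =>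
    ContDiffOn.sum fun a _ => (smoothFunctional_christoffel H a f a).contDiffOn_variation H
  have hs : ContDiffOn ℝ ∞
      (fun y => ∑ I, raiseDiag q K I y * variation g h (fun g => T g I) y) U :=
    ContDiffOn.sum fun I _ => (hκs I).mul ((hTs I).contDiffOn_variation H)
  have hT1 := smoothFunctional_covDeriv H hTs
  simp only [variation_covDeriv H hT1 _ hx, mul_sub, Finset.sum_sub_distrib]
  rw [sum_mul_covDeriv_cons (hK.isParallelUp H.isOpen hqs hKs hcomp)
    (fun J => variation g h fun g => covDeriv g (T g) J)
    (fun I => hd (hκs I)) (fun I => (hT1 I).differentiableAt_variation H hx) e f hx,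
    pd_congr_of_isOpen H.isOpen (fun y hy =>
      sum_raise_variation_covDeriv H hqs hcomp hK hKs hTs hT hc f hy) e hx,
    pd_sub e (hd (contDiffOn_pd H.isOpen hs f)) (hd (contDiffOn_const.mul (hw.mul (hG f)))),
    pd_const_mul e (hd (hw.mul (hG f)))]
  simp only [sum_raise_variation_covDeriv H hqs hcomp hK hKs hTs hT hc _ hx, hessian]
  -- Splitting off the first slot separates the derivative index `f` from the slots of `K`, to which
  -- the trace property applies with the endomorphism `∂_f w δΓ_e`.
  have h1 : ∑ I, raiseDiag q K I x * ∑ j, ∑ m, variation g h (fun g => christoffel g m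
        ((Fin.cons e (Fin.cons f I) : Fin (k + 2) → Fin 4) 0)
        ((Fin.cons e (Fin.cons f I) : Fin (k + 2) → Fin 4) (Fin.succ j))) x *
        covDeriv g (T g) (Function.update
          (fun i => (Fin.cons e (Fin.cons f I) : Fin (k + 2) → Fin 4) i.succ) j m) x =
      ∑ m, variation g h (fun g => christoffel g m e f) x * pd m w x *
            ∑ I, raiseDiag q K I x * K I x
        + c * (pd f w x * traceGamma g h e x) := by
    have h2 := hc x hx (fun a m => pd f w x * variation g h (fun g => christoffel g m e a) x)
    rw [← Finset.mul_sum] at h2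
    rw [traceGamma, ← h2]
    simp only [Fin.sum_univ_succ (n := k), Fin.cons_zero, Fin.cons_succ, update_cons_zero,
      update_cons_succ, covDeriv_mul_parallel H.isOpen hK hKs hw hT _ _ hx, mul_add,
      Finset.sum_add_distrib]
    congr 1
    · simp only [Finset.mul_sum]
      rw [Finset.sum_comm]
      exact Finset.sum_congr rfl fun m _ => Finset.sum_congr rfl fun I _ => by ring
    · refine Finset.sum_congr rfl fun I _ => ?_
      congr 1
      exact Finset.sum_congr rfl fun j _ => Finset.sum_congr rfl fun m _ => by ring
  rw [h1]
  simp only [mul_sub, Finset.sum_sub_distrib, Finset.mul_sum]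
  have h3 : ∑ m, christoffel g m e f x * (c * (w x * traceGamma g h m x)) =
      ∑ m, c * (christoffel g m e f x * (w x * traceGamma g h m x)) :=
    Finset.sum_congr rfl fun m _ => by ring
  rw [h3]
  ring

/-- All background factors are multiples of `K`, so everything becomes a contraction with `K`. In
order, the terms come from `δT`, from `□ δT`, from `δΓ` on the slots of `T`, from `δΓ` on the
derivative index, from the inverse metric inside `□`, and from the inverse metrics that raise the
indices of `□ T`. -/
theorem variation_contractBox (H : IsVariation U g h) (hq : IsDiagonalInverse U g q)
    (hqs : ∀ a, ContDiffOn ℝ ∞ (q a) U)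
    (hcomp : IsCompatible U g q) (hK : IsParallel U g K)
    (hKs : ∀ I, ContDiffOn ℝ ∞ (K I) U) (hTs : ∀ I, SmoothFunctional U g h (fun g => T g I))
    (hw : ContDiffOn ℝ ∞ w U)
    (hT : ∀ x ∈ U, ∀ I, T g I x = w x * K I x) (hc : HasTraceProperty U q K c)
    {N : ℝ} (hN : ∀ x ∈ U, ∑ I, raiseDiag q K I x * K I x = N) {x : Coord} (hx : x ∈ U) :
    variation g h (contractBox T) x =
      laplacian g q w x * (∑ I, raiseDiag q K I x * variation g h (fun g => T g I) x)
      + w x * (laplacian g q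
            (fun y => ∑ I, raiseDiag q K I y * variation g h (fun g => T g I) y) x
          - c * ∑ e, q e x * (pd e (fun y => w y * traceGamma g h e y) x -
            ∑ m, christoffel g m e e x * (w x * traceGamma g h m x) +
              pd e w x * traceGamma g h e x)
          - N * ∑ e, q e x * ∑ m, variation g h (fun g => christoffel g m e e) x * pd m w x
          - N * ∑ e, ∑ f, q e x * h x e f * q f x * hessian g e f w x)
      - c * (w x * laplacian g q w x * ∑ a, h x a a * q a x) := by
  have hbox := smoothFunctional_box H hTs
  have hcc := smoothFunctional_covDeriv H (smoothFunctional_covDeriv H hTs)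
  have hboxT : ∀ I, box g (T g) I x = laplacian g q w x * K I x := fun I =>
    box_mul_parallel H.isOpen hq hK hKs hw hT I hx
  have h1 : HasDerivAt (fun ε : ℝ => contractBox T (perturb g h ε) x) _ 0 :=
    HasDerivAt.fun_sum fun (I : Fin k → Fin 4) (_ : I ∈ Finset.univ) =>
      ((hTs I).hasDerivAt H hx).mul ((smoothFunctional_raise H hbox I).hasDerivAt H hx)
  have h2 : ∀ I, variation g h (fun g => box g (T g) I) x = ∑ e, ∑ f,
      (-(q e x * h x e f * q f x) * (hessian g e f w x * K I x) + (if e = f then q e x else 0) *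
        variation g h (fun g => covDeriv g (covDeriv g (T g)) (Fin.cons e (Fin.cons f I))) x) := by
    intro I
    have : HasDerivAt (fun ε : ℝ => box (perturb g h ε) (T (perturb g h ε)) I x) _ 0 :=
      HasDerivAt.fun_sum fun (e : Fin 4) (_ : e ∈ Finset.univ) =>
      HasDerivAt.fun_sum fun (f : Fin 4) (_ : f ∈ Finset.univ) =>
        ((smoothFunctional_ginv H e f).hasDerivAt H hx).mul
          ((hcc (Fin.cons e (Fin.cons f I))).hasDerivAt H hx)
    rw [variation, this.deriv]
    simp only [perturb_zero, variation_ginv_of_diagonal H hq _ _ hx, hq x hx,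
      covDeriv_covDeriv_mul_parallel H.isOpen hK hKs hw hT _ _ _ hx]
  have h3 : ∑ I, raiseDiag q K I x * variation g h (fun g => box g (T g) I) x =
      -(N * ∑ e, ∑ f, q e x * h x e f * q f x * hessian g e f w x)
      + ∑ e, q e x * ∑ I, raiseDiag q K I x *
        variation g h (fun g => covDeriv g (covDeriv g (T g)) (Fin.cons e (Fin.cons e I))) x := by
    simp only [h2, Finset.sum_add_distrib, ite_mul, zero_mul, Finset.sum_ite_eq, Finset.mem_univ,
      if_true, mul_add]
    congr 1
    · rw [← hN x hx, Finset.sum_mul, ← Finset.sum_neg_distrib]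
      refine Finset.sum_congr rfl fun I _ => ?_
      simp only [Finset.mul_sum, ← Finset.sum_neg_distrib]
      exact Finset.sum_congr rfl fun e _ => Finset.sum_congr rfl fun f _ => by ring
    · simp only [Finset.mul_sum]
      rw [Finset.sum_comm]
      exact Finset.sum_congr rfl fun m _ => Finset.sum_congr rfl fun I _ => by ring
  -- Raising the indices makes `h` act on each slot of `K` as an endomorphism, so the trace property
  -- produces the trace of `h`.
  have h4 : ∑ I, w x * raiseDiag q K I x * ∑ j, ∑ m, h x (I j) m * q m x *
      (laplacian g q w x * K (Function.update I j m) x) =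
      c * (w x * laplacian g q w x * ∑ a, h x a a * q a x) := by
    have := hc x hx (fun a m => w x * laplacian g q w x * (h x a m * q m x))
    rw [← Finset.mul_sum] at this
    rw [← this]
    simp only [Finset.mul_sum]
    exact Finset.sum_congr rfl fun I _ => Finset.sum_congr rfl fun j _ =>
      Finset.sum_congr rfl fun m _ => by ring
  rw [variation, h1.deriv]
  simp only [perturb_zero, raise_of_diagonal hq _ _ hx, variation_raise_of_diagonal H hq hbox _ hx,
    hboxT, hT x hx]
  have h5 : ∀ I, variation g h (fun g => T g I) x *
        ((∏ j, q (I j) x) * (laplacian g q w x * K I x)) +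
      w x * K I x * ((∏ j, q (I j) x) * (variation g h (fun g => box g (T g) I) x -
        ∑ j, ∑ m, h x (I j) m * q m x * (laplacian g q w x * K (Function.update I j m) x))) =
      laplacian g q w x * (raiseDiag q K I x * variation g h (fun g => T g I) x) +
      w x * (raiseDiag q K I x * variation g h (fun g => box g (T g) I) x) -
      w x * raiseDiag q K I x * ∑ j, ∑ m, h x (I j) m * q m x *
        (laplacian g q w x * K (Function.update I j m) x) := fun I => by
    simp only [raiseDiag]; ring
  simp only [h5, Finset.sum_add_distrib, Finset.sum_sub_distrib, h4]
  rw [← Finset.mul_sum, ← Finset.mul_sum, h3]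
  simp only [sum_raise_variation_covDeriv_covDeriv H hqs hcomp hK hKs hTs hw hT hc _ _ hx,
    hN x hx, ← Finset.sum_mul]
  simp only [mul_sub, mul_add, Finset.sum_sub_distrib, Finset.sum_add_distrib, laplacian]
  simp only [mul_left_comm _ c, ← mul_assoc _ _ N, ← Finset.mul_sum, ← Finset.sum_mul]
  ring

end

end

end SixDerivativeGravity


namespace SixDerivativeGravity

open MeasureTheory Filter Topology

noncomputable section

/-! ### The geometry of static spherically symmetric Kundt metrics -/

/-- The Kronecker delta. -/
def kron (a b : Fin 4) : ℝ := if a = b then 1 else 0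

/-- A function of two indices that depends only on whether they belong to the block `{t, r}` or
to the block `{θ, φ}`. -/
def blockwise (p₁₁ p₁₂ p₂₁ p₂₂ : ℝ) : Fin 4 → Fin 4 → ℝ :=
  ![![p₁₁, p₁₁, p₁₂, p₁₂], ![p₁₁, p₁₁, p₁₂, p₁₂], ![p₂₁, p₂₁, p₂₂, p₂₂], ![p₂₁, p₂₁, p₂₂, p₂₂]]

/-- The tensor `κ_{ab} g_{aa} g_{bb} (δ_{ac} δ_{be} - δ_{ae} δ_{bc})`. -/
def diagRiem (κ : Fin 4 → Fin 4 → ℝ) (d : Fin 4 → ℝ) (a b c e : Fin 4) : ℝ :=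
  κ a b * d a * d b * (kron a c * kron b e - kron a e * kron b c)

/-- The diagonal of the metric. -/
def kundtDiag (f : ℝ → ℝ) (R₀ : ℝ) (a : Fin 4) (x : Coord) : ℝ :=
  (![-f (x 1), (f (x 1))⁻¹, R₀ ^ 2, R₀ ^ 2 * Real.sin (x 2) ^ 2] : Fin 4 → ℝ) a

/-- The diagonal of the inverse metric. -/
def kundtInv (f : ℝ → ℝ) (R₀ : ℝ) (a : Fin 4) (x : Coord) : ℝ :=
  (![-(f (x 1))⁻¹, f (x 1), (R₀ ^ 2)⁻¹, (R₀ ^ 2 * Real.sin (x 2) ^ 2)⁻¹] : Fin 4 → ℝ) a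

/-- The Christoffel symbols. -/
def kundtGamma (f : ℝ → ℝ) (a b c : Fin 4) (x : Coord) : ℝ :=
  (![![![0, deriv f (x 1) / (2 * f (x 1)), 0, 0], ![deriv f (x 1) / (2 * f (x 1)), 0, 0, 0],
      ![0, 0, 0, 0], ![0, 0, 0, 0]],
    ![![f (x 1) * deriv f (x 1) / 2, 0, 0, 0], ![0, -(deriv f (x 1) / (2 * f (x 1))), 0, 0],
      ![0, 0, 0, 0], ![0, 0, 0, 0]],
    ![![0, 0, 0, 0], ![0, 0, 0, 0], ![0, 0, 0, 0],
      ![0, 0, 0, -(Real.sin (x 2) * Real.cos (x 2))]],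
    ![![0, 0, 0, 0], ![0, 0, 0, 0], ![0, 0, 0, Real.cos (x 2) / Real.sin (x 2)],
      ![0, 0, Real.cos (x 2) / Real.sin (x 2), 0]]] : Fin 4 → Fin 4 → Fin 4 → ℝ) a b c

/-- The Gaussian curvature of the `(t, r)` part. -/
def curvU (f : ℝ → ℝ) (r : ℝ) : ℝ := -deriv (deriv f) r / 2

/-- The data of a static spherically symmetric Kundt metric. -/
structure KundtData (f : ℝ → ℝ) (I : Set ℝ) (R₀ : ℝ) : Prop where
  isOpen : IsOpen I
  smooth : ContDiffOn ℝ ∞ f I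
  pos : 0 < R₀

section

variable {f : ℝ → ℝ} {I : Set ℝ} {R₀ : ℝ}

theorem KundtData.smooth_deriv (D : KundtData f I R₀) : ContDiffOn ℝ ∞ (deriv f) I :=
  D.smooth.deriv_of_isOpen D.isOpen (by simp)

theorem KundtData.smooth_deriv_deriv (D : KundtData f I R₀) :
    ContDiffOn ℝ ∞ (deriv (deriv f)) I :=
  D.smooth_deriv.deriv_of_isOpen D.isOpen (by simp)

theorem KundtData.hasDerivAt (D : KundtData f I R₀) {φ : ℝ → ℝ} (hφ : ContDiffOn ℝ ∞ φ I) {r : ℝ}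
    (hr : r ∈ I) : HasDerivAt φ (deriv φ r) r :=
  ((hφ.contDiffAt (D.isOpen.mem_nhds hr)).differentiableAt (by simp)).hasDerivAt

theorem KundtData.isOpen_chart (D : KundtData f I R₀) : IsOpen (kundtChart f I) := by
  have h1 : IsOpen (I ∩ f ⁻¹' {0}ᶜ) :=
    D.smooth.continuousOn.isOpen_inter_preimage D.isOpen isOpen_compl_singleton
  have h2 : IsOpen ((fun x : Coord => x 1) ⁻¹' (I ∩ f ⁻¹' {0}ᶜ)) :=
    h1.preimage (continuous_apply 1)
  have h3 : IsOpen ((fun x : Coord => x 2) ⁻¹' Set.Ioo 0 Real.pi) :=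
    isOpen_Ioo.preimage (continuous_apply 2)
  convert h2.inter h3 using 1
  ext x
  simp [kundtChart, and_assoc]

theorem contDiffOn_comp_radius {φ : ℝ → ℝ} (hφ : ContDiffOn ℝ ∞ φ I) :
    ContDiffOn ℝ ∞ (fun x : Coord => φ (x 1)) (kundtChart f I) :=
  hφ.comp (f := fun x : Coord => x 1) (contDiff_apply ℝ ℝ (1 : Fin 4)).contDiffOn fun _ hx => hx.1

theorem contDiffOn_comp_angle {φ : ℝ → ℝ} (hφ : ContDiff ℝ ∞ φ) :
    ContDiffOn ℝ ∞ (fun x : Coord => φ (x 2)) (kundtChart f I) :=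
  (hφ.comp (contDiff_apply ℝ ℝ (2 : Fin 4))).contDiffOn

theorem sin_pos_of_mem_kundtChart {x : Coord} (hx : x ∈ kundtChart f I) : 0 < Real.sin (x 2) :=
  Real.sin_pos_of_pos_of_lt_pi hx.2.2.1 hx.2.2.2

theorem kundtMetric_apply (x : Coord) (a b : Fin 4) :
    kundtMetric f R₀ x a b = kron a b * kundtDiag f R₀ a x := by
  rw [kundtMetric, Matrix.diagonal_apply, kron, kundtDiag]
  simp

theorem kundtDiag_mul_kundtInv (D : KundtData f I R₀) {x : Coord} (hx : x ∈ kundtChart f I)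
    (a : Fin 4) : kundtDiag f R₀ a x * kundtInv f R₀ a x = 1 := by
  have h1 := hx.2.1
  have h2 := D.pos.ne'
  have h3 := (sin_pos_of_mem_kundtChart hx).ne'
  fin_cases a <;> simp [kundtDiag, kundtInv] <;> field_simp

theorem isDiagonalInverse_kundt (D : KundtData f I R₀) :
    IsDiagonalInverse (kundtChart f I) (kundtMetric f R₀) (kundtInv f R₀) := by
  intro x hx a b
  have : (kundtMetric f R₀ x)⁻¹ = Matrix.diagonal fun a => kundtInv f R₀ a x := by
    apply Matrix.inv_eq_right_inv
    rw [kundtMetric, Matrix.diagonal_mul_diagonal, ← Matrix.diagonal_one]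
    congr 1
    funext a
    exact kundtDiag_mul_kundtInv D hx a
  rw [ginv, this, Matrix.diagonal_apply]

theorem contDiffOn_kundtDiag (D : KundtData f I R₀) (a : Fin 4) :
    ContDiffOn ℝ ∞ (kundtDiag f R₀ a) (kundtChart f I) := by
  have hf := contDiffOn_comp_radius (f := f) D.smooth
  fin_cases a
  · exact hf.neg
  · exact hf.inv fun x hx => hx.2.1
  · exact contDiffOn_const
  · exact contDiffOn_const.mul ((contDiffOn_comp_angle Real.contDiff_sin).pow 2)

theorem contDiffOn_kundtInv (D : KundtData f I R₀) (a : Fin 4) :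
    ContDiffOn ℝ ∞ (kundtInv f R₀ a) (kundtChart f I) := by
  have hf := contDiffOn_comp_radius (f := f) D.smooth
  fin_cases a
  · exact (hf.inv fun x hx => hx.2.1).neg
  · exact hf
  · exact contDiffOn_const
  · refine ((contDiffOn_kundtDiag D 3).inv fun x hx => ?_)
    have := kundtDiag_mul_kundtInv D hx 3
    exact left_ne_zero_of_mul_eq_one this

theorem pd_comp_radius {φ : ℝ → ℝ} {φ' : ℝ} {x : Coord} (h : HasDerivAt φ φ' (x 1)) (i : Fin 4) :
    pd i (fun y => φ (y 1)) x = if i = 1 then φ' else 0 := pd_comp_apply i h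

theorem pd_comp_angle {φ : ℝ → ℝ} {φ' : ℝ} {x : Coord} (h : HasDerivAt φ φ' (x 2)) (i : Fin 4) :
    pd i (fun y => φ (y 2)) x = if i = 2 then φ' else 0 := pd_comp_apply i h

theorem pd_kundtMetric (D : KundtData f I R₀) {x : Coord} (hx : x ∈ kundtChart f I)
    (i a b : Fin 4) : pd i (fun y => kundtMetric f R₀ y a b) x = if a = b then
      (if i = 1 then (![-deriv f (x 1), -deriv f (x 1) / f (x 1) ^ 2, 0, 0] : Fin 4 → ℝ) a else 0)
      + (if i = 2 then (![0, 0, 0, R₀ ^ 2 * (2 * Real.sin (x 2) * Real.cos (x 2))] :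
          Fin 4 → ℝ) a else 0) else 0 := by
  have h1 := D.hasDerivAt D.smooth hx.1
  have e : (fun y => kundtMetric f R₀ y a b) = fun y => kron a b * kundtDiag f R₀ a y := by
    funext y; rw [kundtMetric_apply]
  rw [e]
  rcases eq_or_ne a b with rfl | hab
  · simp only [kron, if_true, one_mul]
    have hs : HasDerivAt (fun r => R₀ ^ 2 * Real.sin r ^ 2)
        (R₀ ^ 2 * (2 * Real.sin (x 2) * Real.cos (x 2))) (x 2) := by
      simpa using ((Real.hasDerivAt_sin (x 2)).pow 2).const_mul (R₀ ^ 2)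
    fin_cases a
    · simpa using! pd_comp_radius h1.neg i
    · simpa using! pd_comp_radius (h1.inv hx.2.1) i
    · simpa using! pd_const i (R₀ ^ 2)
    · simpa using! pd_comp_angle hs i
  · simp only [kron, if_neg hab, zero_mul, pd_const]

theorem christoffel_kundt (D : KundtData f I R₀) {x : Coord} (hx : x ∈ kundtChart f I)
    (a b c : Fin 4) : christoffel (kundtMetric f R₀) a b c x = kundtGamma f a b c x := by
  have h1 := hx.2.1
  have h2 := D.pos.ne'
  have h3 := (sin_pos_of_mem_kundtChart hx).ne'
  simp only [christoffel, isDiagonalInverse_kundt D x hx, ite_mul, zero_mul, Finset.sum_ite_eq,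
    Finset.mem_univ, if_true, pd_kundtMetric D hx]
  fin_cases a <;> fin_cases b <;> fin_cases c <;> simp [kundtGamma, kundtInv] <;> field_simp

theorem pd_kundtGamma (D : KundtData f I R₀) {x : Coord} (hx : x ∈ kundtChart f I)
    (i a b c : Fin 4) : pd i (kundtGamma f a b c) x =
      (if i = 1 then (![![![0, 1, 0, 0], ![1, 0, 0, 0], 0, 0], ![0, ![0, -1, 0, 0], 0, 0], 0, 0] :
        Fin 4 → Fin 4 → Fin 4 → ℝ) a b c *
          ((deriv (deriv f) (x 1) * f (x 1) - deriv f (x 1) ^ 2) / (2 * f (x 1) ^ 2)) +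
        (if a = 1 ∧ b = 0 ∧ c = 0 then
          (deriv f (x 1) ^ 2 + f (x 1) * deriv (deriv f) (x 1)) / 2 else 0) else 0)
      + (if i = 2 then (if a = 2 ∧ b = 3 ∧ c = 3 then Real.sin (x 2) ^ 2 - Real.cos (x 2) ^ 2 else 0)
        + (![0, 0, 0, ![0, 0, ![0, 0, 0, 1], ![0, 0, 1, 0]]] :
        Fin 4 → Fin 4 → Fin 4 → ℝ) a b c * (-1 / Real.sin (x 2) ^ 2) else 0) := by
  have h1 := hx.2.1
  have h2 := D.pos.ne'
  have h3 := (sin_pos_of_mem_kundtChart hx).ne'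
  have hf := D.hasDerivAt D.smooth hx.1
  have hf' := D.hasDerivAt D.smooth_deriv hx.1
  have e1 : HasDerivAt (fun r => deriv f r / (2 * f r))
      ((deriv (deriv f) (x 1) * f (x 1) - deriv f (x 1) ^ 2) / (2 * f (x 1) ^ 2)) (x 1) := 
    (hf'.fun_div (hf.const_mul 2) (by simpa using h1)).congr_deriv (by field_simp)
  have e2 : HasDerivAt (fun r => f r * deriv f r / 2)
      ((deriv f (x 1) ^ 2 + f (x 1) * deriv (deriv f) (x 1)) / 2) (x 1) := 
    ((hf.fun_mul hf').div_const 2).congr_deriv (by ring)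
  have e3 : HasDerivAt (fun r => -(Real.sin r * Real.cos r))
      (Real.sin (x 2) ^ 2 - Real.cos (x 2) ^ 2) (x 2) := 
    ((Real.hasDerivAt_sin (x 2)).fun_mul (Real.hasDerivAt_cos (x 2))).fun_neg.congr_deriv
      (by ring)
  have e4 : HasDerivAt (fun r => Real.cos r / Real.sin r) (-1 / Real.sin (x 2) ^ 2) (x 2) := 
    ((Real.hasDerivAt_cos (x 2)).fun_div (Real.hasDerivAt_sin (x 2)) h3).congr_deriv (by
      congr 1
      linear_combination -Real.sin_sq_add_cos_sq (x 2))
  have p0 := pd_const (x := x) i 0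
  have p1 := pd_comp_radius e1 i
  have p1' := pd_comp_radius e1.fun_neg i
  have p2 := pd_comp_radius e2 i
  have p3 := pd_comp_angle e3 i
  have p4 := pd_comp_angle e4 i
  fin_cases a <;> fin_cases b <;> fin_cases c <;>
    first
    | simpa using! p0
    | simpa using! p1
    | simpa using! p1'
    | simpa using! p2
    | simpa using! p3
    | simpa using! p4

end

end

end SixDerivativeGravity


/-! ### Curvature of the product metric: Riemann, Ricci and Weyl tensors -/

namespace SixDerivativeGravity

open MeasureTheory Filter Topology

noncomputable section

section

variable {f : ℝ → ℝ} {I : Set ℝ} {R₀ : ℝ}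

/-- Antisymmetry in the last pair is visible in the definition; it reduces the computation of
components to `c < e`. -/
theorem riemannUp_swap (g : Metric) (a b c d : Fin 4) (x : Coord) :
    riemannUp g a b d c x = -riemannUp g a b c d x := by
  simp only [riemannUp, Finset.sum_sub_distrib]
  ring

/-- The sectional curvatures. -/
def sectional (f : ℝ → ℝ) (R₀ : ℝ) (x : Coord) : Fin 4 → Fin 4 → ℝ :=
  blockwise (curvU f (x 1)) 0 0 (R₀ ^ 2)⁻¹

theorem riemannUp_kundt_of_lt (D : KundtData f I R₀) {x : Coord} (hx : x ∈ kundtChart f I)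
    (a b c e : Fin 4) (hce : c < e) : riemannUp (kundtMetric f R₀) a b c e x =
      sectional f R₀ x a b * kundtDiag f R₀ b x *
        (kron a c * kron b e - kron a e * kron b c) := by
  have h1 := hx.2.1
  have h2 := D.pos.ne'
  have h3 := (sin_pos_of_mem_kundtChart hx).ne'
  have h4 := Real.sin_sq_add_cos_sq (x 2)
  rw [riemannUp, pd_congr_of_isOpen D.isOpen_chart (fun y hy => christoffel_kundt D hy a e b) c hx,
    pd_congr_of_isOpen D.isOpen_chart (fun y hy => christoffel_kundt D hy a c b) e hx]
  simp only [christoffel_kundt D hx, pd_kundtGamma D hx]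
  -- Beyond algebra the only relation needed is `sin² + cos² = 1`, for the curvature of the sphere.
  fin_cases c <;> fin_cases e <;> simp at hce <;> fin_cases a <;> fin_cases b <;>
    simp [kundtGamma, sectional, blockwise, kundtDiag, kron, curvU, Fin.sum_univ_four] <;>
    field_simp <;> first | ring1 | linear_combination h4

theorem kron_comm (a b : Fin 4) : kron a b = kron b a := by
  simp [kron, eq_comm]

theorem riemannUp_kundt (D : KundtData f I R₀) {x : Coord} (hx : x ∈ kundtChart f I)
    (a b c e : Fin 4) : riemannUp (kundtMetric f R₀) a b c e x =
      sectional f R₀ x a b * kundtDiag f R₀ b x *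
        (kron a c * kron b e - kron a e * kron b c) := by
  rcases lt_trichotomy c e with hce | rfl | hce
  · exact riemannUp_kundt_of_lt D hx a b c e hce
  · have := riemannUp_swap (kundtMetric f R₀) a b c c x
    have h0 : riemannUp (kundtMetric f R₀) a b c c x = 0 := by linarith
    rw [h0]
    ring
  · rw [riemannUp_swap, riemannUp_kundt_of_lt D hx a b e c hce]
    ring

theorem riemann_kundt (D : KundtData f I R₀) {x : Coord} (hx : x ∈ kundtChart f I)
    (a b c e : Fin 4) : riemann (kundtMetric f R₀) a b c e x =
      diagRiem (sectional f R₀ x) (fun a => kundtDiag f R₀ a x) a b c e := by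
  simp only [riemann, kundtMetric_apply, riemannUp_kundt D hx, kron, diagRiem, ite_mul, one_mul,
    zero_mul, Finset.sum_ite_eq, Finset.mem_univ, if_true]
  ring

/-- The eigenvalues of the Ricci tensor. -/
def ricciEigen (f : ℝ → ℝ) (R₀ : ℝ) (x : Coord) : Fin 4 → ℝ :=
  ![curvU f (x 1), curvU f (x 1), (R₀ ^ 2)⁻¹, (R₀ ^ 2)⁻¹]

/-- The factor `w` of the Weyl tensor, one sixth of the Ricci scalar. -/
def weylFactor (f : ℝ → ℝ) (R₀ : ℝ) (r : ℝ) : ℝ := (curvU f r + (R₀ ^ 2)⁻¹) / 3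

/-- The eigenvalue of the traceless Ricci tensor on the `(t, r)` block. -/
def ricciSplit (f : ℝ → ℝ) (R₀ : ℝ) (r : ℝ) : ℝ := (curvU f r - (R₀ ^ 2)⁻¹) / 2

/-- The sign `+1` on the block `{t, r}` and `-1` on the block `{θ, φ}`. -/
def blockSign : Fin 4 → ℝ := ![1, 1, -1, -1]

/-- The relative sectional components of the Weyl tensor. -/
def weylPattern : Fin 4 → Fin 4 → ℝ := blockwise 1 (-1 / 2) (-1 / 2) 1

theorem ricci_kundt (D : KundtData f I R₀) {x : Coord} (hx : x ∈ kundtChart f I)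
    (b e : Fin 4) : ricci (kundtMetric f R₀) b e x =
      kron b e * kundtDiag f R₀ b x * ricciEigen f R₀ x b := by
  simp only [ricci, riemannUp_kundt D hx, Fin.sum_univ_four]
  rcases eq_or_ne b e with rfl | h
  · fin_cases b <;> simp [kron, sectional, blockwise, ricciEigen] <;> ring
  · fin_cases b <;> fin_cases e <;> simp at h <;> simp [kron]

theorem ricciScalar_kundt (D : KundtData f I R₀) {x : Coord} (hx : x ∈ kundtChart f I) :
    ricciScalar (kundtMetric f R₀) x = 6 * weylFactor f R₀ (x 1) := by
  have h := kundtDiag_mul_kundtInv D hx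
  have h' : ∀ a, kundtInv f R₀ a x * (kron a a * kundtDiag f R₀ a x * ricciEigen f R₀ x a) =
      ricciEigen f R₀ x a := fun a => by
    rw [kron, if_pos rfl]
    linear_combination ricciEigen f R₀ x a * h a
  simp only [ricciScalar, isDiagonalInverse_kundt D x hx, ricci_kundt D hx, ite_mul, zero_mul,
    Finset.sum_ite_eq, Finset.mem_univ, if_true, h', Fin.sum_univ_four]
  simp [ricciEigen, weylFactor]
  ring

theorem tracelessRicci_kundt (D : KundtData f I R₀) {x : Coord} (hx : x ∈ kundtChart f I)
    (a b : Fin 4) : tracelessRicci (kundtMetric f R₀) a b x =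
      kron a b * kundtDiag f R₀ a x * (ricciSplit f R₀ (x 1) * blockSign a) := by
  rw [tracelessRicci, ricci_kundt D hx, ricciScalar_kundt D hx, kundtMetric_apply]
  fin_cases a <;> simp [ricciEigen, ricciSplit, weylFactor, blockSign] <;> ring

theorem weyl_kundt (D : KundtData f I R₀) {x : Coord} (hx : x ∈ kundtChart f I)
    (a b c e : Fin 4) : weyl (kundtMetric f R₀) a b c e x = weylFactor f R₀ (x 1) *
      diagRiem weylPattern (fun a => kundtDiag f R₀ a x) a b c e := by
  -- The sectional curvature, minus the mean of the two Ricci eigenvalues, plus one sixth of the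
  -- scalar curvature: `w` inside a block and `-w/2` across the blocks.
  have hK : sectional f R₀ x a b - (ricciEigen f R₀ x a + ricciEigen f R₀ x b) / 2 +
      weylFactor f R₀ (x 1) = weylFactor f R₀ (x 1) * weylPattern a b := by
    fin_cases a <;> fin_cases b <;>
      simp [sectional, ricciEigen, weylPattern, blockwise, weylFactor] <;> ring
  simp only [weyl, riemann_kundt D hx, ricci_kundt D hx, ricciScalar_kundt D hx, kundtMetric_apply,
    diagRiem]
  linear_combination kundtDiag f R₀ a x * kundtDiag f R₀ b x *
    (kron a c * kron b e - kron a e * kron b c) * hK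

end

end

end SixDerivativeGravity


/-! ### The covariantly constant unit Weyl tensor -/

namespace SixDerivativeGravity

open MeasureTheory Filter Topology

noncomputable section

section

variable {f : ℝ → ℝ} {I : Set ℝ} {R₀ : ℝ}

theorem pd_kundtDiag (D : KundtData f I R₀) {x : Coord} (hx : x ∈ kundtChart f I) (i a : Fin 4) :
    pd i (kundtDiag f R₀ a) x =
      (if i = 1 then (![-deriv f (x 1), -deriv f (x 1) / f (x 1) ^ 2, 0, 0] : Fin 4 → ℝ) a else 0)
      + (if i = 2 then (![0, 0, 0, R₀ ^ 2 * (2 * Real.sin (x 2) * Real.cos (x 2))] :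
          Fin 4 → ℝ) a else 0) := by
  have := pd_kundtMetric D hx i a a
  simp only [kundtMetric_apply, kron, if_true, one_mul] at this
  exact this

theorem pd_kundtInv (D : KundtData f I R₀) {x : Coord} (hx : x ∈ kundtChart f I) (i a : Fin 4) :
    pd i (kundtInv f R₀ a) x = -kundtInv f R₀ a x ^ 2 * pd i (kundtDiag f R₀ a) x := by
  have hd : ∀ {F : Coord → ℝ}, ContDiffOn ℝ ∞ F (kundtChart f I) → DifferentiableAt ℝ F x :=
    fun hF => (hF.contDiffAt (D.isOpen_chart.mem_nhds hx)).differentiableAt (by simp)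
  have h1 := pd_mul i (hd (contDiffOn_kundtDiag D a)) (hd (contDiffOn_kundtInv D a))
  rw [pd_congr_of_isOpen D.isOpen_chart (fun y hy => kundtDiag_mul_kundtInv D hy a) i hx,
    pd_const] at h1
  have h2 := kundtDiag_mul_kundtInv D hx a
  linear_combination (-kundtInv f R₀ a x) * h1 - pd i (kundtInv f R₀ a) x * h2

/-- The compatibility of the connection with the diagonal metric. -/
theorem kron_mul_pd_kundtDiag (D : KundtData f I R₀) {x : Coord} (hx : x ∈ kundtChart f I)
    (e a c : Fin 4) : kron a c * pd e (kundtDiag f R₀ a) x =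
      kundtGamma f c e a x * kundtDiag f R₀ c x + kundtGamma f a e c x * kundtDiag f R₀ a x := by
  have h1 := hx.2.1
  have h2 := D.pos.ne'
  have h3 := (sin_pos_of_mem_kundtChart hx).ne'
  rw [pd_kundtDiag D hx]
  fin_cases e <;> fin_cases a <;> fin_cases c <;> simp [kron, kundtGamma, kundtDiag] <;>
    field_simp <;> ring

/-- `∇ g = 0` in diagonal form, multiplied by the inverse metric in both indices. -/
theorem isCompatible_kundt (D : KundtData f I R₀) :
    IsCompatible (kundtChart f I) (kundtMetric f R₀) (kundtInv f R₀) := by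
  intro x hx e a b
  have h := kron_mul_pd_kundtDiag D hx e a b
  have ha := kundtDiag_mul_kundtInv D hx a
  have hb := kundtDiag_mul_kundtInv D hx b
  rw [christoffel_kundt D hx, christoffel_kundt D hx, pd_kundtInv D hx]
  rcases eq_or_ne a b with rfl | hab
  · simp only [kron, if_true, one_mul] at h ⊢
    linear_combination (-kundtInv f R₀ a x ^ 2) * h
      - 2 * kundtGamma f a e a x * kundtInv f R₀ a x * ha
  · simp only [kron, if_neg hab, zero_mul] at h ⊢
    linear_combination (-kundtInv f R₀ a x * kundtInv f R₀ b x) * h -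
      kundtGamma f a e b x * kundtInv f R₀ b x * ha - kundtGamma f b e a x * kundtInv f R₀ a x * hb

/-- The connection preserves the two blocks. -/
theorem kundtGamma_mul_blockwise (p₁₁ p₁₂ p₂₁ p₂₂ : ℝ) (x : Coord) (e a b c : Fin 4) :
    kundtGamma f a e b x * blockwise p₁₁ p₁₂ p₂₁ p₂₂ a c =
      kundtGamma f a e b x * blockwise p₁₁ p₁₂ p₂₁ p₂₂ b c := by
  fin_cases a <;> fin_cases b <;> fin_cases e <;> simp [kundtGamma, blockwise]

theorem kundtGamma_mul_blockwise' (p₁₁ p₁₂ p₂₁ p₂₂ : ℝ) (x : Coord) (e a b c : Fin 4) :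
    kundtGamma f a e b x * blockwise p₁₁ p₁₂ p₂₁ p₂₂ c a =
      kundtGamma f a e b x * blockwise p₁₁ p₁₂ p₂₁ p₂₂ c b := by
  fin_cases a <;> fin_cases b <;> fin_cases e <;> fin_cases c <;> simp [kundtGamma, blockwise]

/-- The covariantly constant tensor of which the Weyl tensor is a multiple. -/
def weylUnit (f : ℝ → ℝ) (R₀ : ℝ) : TensorField 4 := fun J x =>
  diagRiem weylPattern (fun a => kundtDiag f R₀ a x) (J 0) (J 1) (J 2) (J 3)

theorem contDiffOn_weylUnit (D : KundtData f I R₀) (J : Fin 4 → Fin 4) :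
    ContDiffOn ℝ ∞ (weylUnit f R₀ J) (kundtChart f I) :=
  ((contDiffOn_const.mul (contDiffOn_kundtDiag D _)).mul (contDiffOn_kundtDiag D _)).mul
    contDiffOn_const

theorem weylTensor_kundt (D : KundtData f I R₀) {x : Coord} (hx : x ∈ kundtChart f I)
    (J : Fin 4 → Fin 4) : weylTensor (kundtMetric f R₀) J x =
      weylFactor f R₀ (x 1) * weylUnit f R₀ J x := weyl_kundt D hx _ _ _ _

theorem sum_kron_mul (F : Fin 4 → ℝ) (a : Fin 4) : ∑ m, kron m a * F m = F a := by
  simp [kron]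

/-- The sum of all contractions of one index of the Weyl pattern with an endomorphism. -/
theorem sum_update_weylUnit (A : Fin 4 → Fin 4 → ℝ) (a b c k : Fin 4) (x : Coord)
    {J : Fin 4 → Fin 4} (h0 : J 0 = a) (h1 : J 1 = b) (h2 : J 2 = c) (h3 : J 3 = k) :
    ∑ j, ∑ m, A (J j) m * weylUnit f R₀ (Function.update J j m) x =
      A a c * weylPattern c b * kundtDiag f R₀ c x * kundtDiag f R₀ b x * kron b k
      - A a k * weylPattern k b * kundtDiag f R₀ k x * kundtDiag f R₀ b x * kron b c
      + (A b k * weylPattern a k * kundtDiag f R₀ a x * kundtDiag f R₀ k x * kron a c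
      - A b c * weylPattern a c * kundtDiag f R₀ a x * kundtDiag f R₀ c x * kron a k)
      + (A c a * weylPattern a b * kundtDiag f R₀ a x * kundtDiag f R₀ b x * kron b k
      - A c b * weylPattern a b * kundtDiag f R₀ a x * kundtDiag f R₀ b x * kron a k)
      + (A k b * weylPattern a b * kundtDiag f R₀ a x * kundtDiag f R₀ b x * kron a c
      - A k a * weylPattern a b * kundtDiag f R₀ a x * kundtDiag f R₀ b x * kron b c) := by
  have u : ∀ (j l m : Fin 4), Function.update J j m l = if l = j then m else J l := fun j l m => by
    rw [Function.update_apply]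
  rw [Fin.sum_univ_four (fun j => ∑ m, A (J j) m * weylUnit f R₀ (Function.update J j m) x)]
  simp only [weylUnit, u, diagRiem]
  simp only [Fin.isValue, if_true, show (1 : Fin 4) ≠ 0 by decide, show (2 : Fin 4) ≠ 0 by decide,
    show (3 : Fin 4) ≠ 0 by decide, show (0 : Fin 4) ≠ 1 by decide, show (2 : Fin 4) ≠ 1 by decide,
    show (3 : Fin 4) ≠ 1 by decide, show (0 : Fin 4) ≠ 2 by decide, show (1 : Fin 4) ≠ 2 by decide,
    show (3 : Fin 4) ≠ 2 by decide, show (0 : Fin 4) ≠ 3 by decide, show (1 : Fin 4) ≠ 3 by decide,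
    show (2 : Fin 4) ≠ 3 by decide, if_false, h0, h1, h2, h3]
  set d : Fin 4 → ℝ := fun a => kundtDiag f R₀ a x with hdd
  have s0 : ∑ m, A a m * (weylPattern m b * d m * d b *
      (kron m c * kron b k - kron m k * kron b c)) =
      A a c * weylPattern c b * d c * d b * kron b k -
      A a k * weylPattern k b * d k * d b * kron b c := by
    rw [← sum_kron_mul (fun m => A a m * weylPattern m b * d m * d b * kron b k) c,
      ← sum_kron_mul (fun m => A a m * weylPattern m b * d m * d b * kron b c) k,
      ← Finset.sum_sub_distrib]
    exact Finset.sum_congr rfl fun m _ => by ring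
  have s1 : ∑ m, A b m * (weylPattern a m * d a * d m *
      (kron a c * kron m k - kron a k * kron m c)) =
      A b k * weylPattern a k * d a * d k * kron a c -
      A b c * weylPattern a c * d a * d c * kron a k := by
    rw [← sum_kron_mul (fun m => A b m * weylPattern a m * d a * d m * kron a c) k,
      ← sum_kron_mul (fun m => A b m * weylPattern a m * d a * d m * kron a k) c,
      ← Finset.sum_sub_distrib]
    exact Finset.sum_congr rfl fun m _ => by ring
  have s2 : ∑ m, A c m * (weylPattern a b * d a * d b *
      (kron a m * kron b k - kron a k * kron b m)) =
      A c a * weylPattern a b * d a * d b * kron b k -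
      A c b * weylPattern a b * d a * d b * kron a k := by
    rw [← sum_kron_mul (fun m => A c m * weylPattern a b * d a * d b * kron b k) a,
      ← sum_kron_mul (fun m => A c m * weylPattern a b * d a * d b * kron a k) b,
      ← Finset.sum_sub_distrib]
    exact Finset.sum_congr rfl fun m _ => by rw [kron_comm a m, kron_comm b m]; ring
  have s3 : ∑ m, A k m * (weylPattern a b * d a * d b *
      (kron a c * kron b m - kron a m * kron b c)) =
      A k b * weylPattern a b * d a * d b * kron a c -
      A k a * weylPattern a b * d a * d b * kron b c := by
    rw [← sum_kron_mul (fun m => A k m * weylPattern a b * d a * d b * kron a c) b,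
      ← sum_kron_mul (fun m => A k m * weylPattern a b * d a * d b * kron b c) a,
      ← Finset.sum_sub_distrib]
    exact Finset.sum_congr rfl fun m _ => by rw [kron_comm a m, kron_comm b m]; ring
  exact congrArg₂ (· + ·) (congrArg₂ (· + ·) (congrArg₂ (· + ·) s0 s1) s2) s3

/-- The pattern is constant on pairs of blocks and the connection never mixes the blocks, so the
pattern behaves like a scalar constant. The metric factors are parallel because the connection is
metric. -/
theorem isParallel_weylUnit (D : KundtData f I R₀) :
    IsParallel (kundtChart f I) (kundtMetric f R₀) (weylUnit f R₀) := by
  intro x hx e J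
  have hd : ∀ a, DifferentiableAt ℝ (kundtDiag f R₀ a) x := fun a =>
    ((contDiffOn_kundtDiag D a).contDiffAt (D.isOpen_chart.mem_nhds hx)).differentiableAt (by simp)
  have hpd : pd e (weylUnit f R₀ J) x = weylPattern (J 0) (J 1) *
      (pd e (kundtDiag f R₀ (J 0)) x * kundtDiag f R₀ (J 1) x +
        kundtDiag f R₀ (J 0) x * pd e (kundtDiag f R₀ (J 1)) x) *
      (kron (J 0) (J 2) * kron (J 1) (J 3) - kron (J 0) (J 3) * kron (J 1) (J 2)) := by
    have e1 : weylUnit f R₀ J = fun y => (weylPattern (J 0) (J 1) *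
        (kron (J 0) (J 2) * kron (J 1) (J 3) - kron (J 0) (J 3) * kron (J 1) (J 2))) *
        (kundtDiag f R₀ (J 0) y * kundtDiag f R₀ (J 1) y) := by
      funext y
      simp only [weylUnit, diagRiem]
      ring
    rw [e1, pd_const_mul e ((hd _).fun_mul (hd _)), pd_mul e (hd _) (hd _)]
    ring
  rw [hpd, sum_update_weylUnit (fun a m => christoffel (kundtMetric f R₀) m e a x) (J 0) (J 1) (J 2)
    (J 3) x rfl rfl rfl rfl]
  simp only [christoffel_kundt D hx]
  generalize J 0 = a
  generalize J 1 = b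
  generalize J 2 = c
  generalize J 3 = k
  have hp : ∀ m n l, kundtGamma f m e n x * weylPattern m l =
    kundtGamma f m e n x * weylPattern n l := fun m n l => kundtGamma_mul_blockwise _ _ _ _ x e m n l
  have hp' : ∀ m n l, kundtGamma f m e n x * weylPattern l m =
    kundtGamma f m e n x * weylPattern l n := fun m n l => kundtGamma_mul_blockwise' _ _ _ _ x e m n l
  have hc := kron_mul_pd_kundtDiag D hx e
  -- Block preservation moves the pattern to the fixed pair `(a, b)`. What is left is metric
  -- compatibility, once for each Kronecker factor.
  simp only [hp c a b, hp k a b, hp' k b a, hp' c b a]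
  set d : Fin 4 → ℝ := fun a => kundtDiag f R₀ a x with hdd
  have hda : ∀ m, kundtDiag f R₀ m x = d m := fun m => rfl
  simp only [hda] at hc ⊢
  linear_combination weylPattern a b * d b * kron b k * hc a c
    - weylPattern a b * d b * kron b c * hc a k + weylPattern a b * d a * kron a c * hc b k
    - weylPattern a b * d a * kron a k * hc b c

/-! ### Contractions with tensors of diagonal type -/

theorem sum_fin_four {M : Type*} [AddCommMonoid M] (F : (Fin 4 → Fin 4) → M) :
    ∑ J, F J = ∑ a, ∑ b, ∑ c, ∑ e, F ![a, b, c, e] := by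
  let E : (Fin 4 → Fin 4) ≃ ((Fin 4 × Fin 4) × Fin 4) × Fin 4 :=
    { toFun := fun J => (((J 0, J 1), J 2), J 3)
      invFun := fun p => ![p.1.1.1, p.1.1.2, p.1.2, p.2]
      left_inv := fun J => by funext i; fin_cases i <;> rfl
      right_inv := fun p => by simp }
  rw [← E.symm.sum_comp F, Fintype.sum_prod_type, Fintype.sum_prod_type, Fintype.sum_prod_type]
  rfl

theorem sum_diagRiem_mul (κ : Fin 4 → Fin 4 → ℝ) (d : Fin 4 → ℝ)
    (Z : Fin 4 → Fin 4 → Fin 4 → Fin 4 → ℝ) :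
    ∑ a, ∑ b, ∑ c, ∑ e, diagRiem κ d a b c e * Z a b c e =
      ∑ a, ∑ b, κ a b * d a * d b * (Z a b a b - Z a b b a) := by
  refine Finset.sum_congr rfl fun a _ => Finset.sum_congr rfl fun b _ => ?_
  simp only [diagRiem, kron, mul_sub, sub_mul, mul_ite, mul_one, mul_zero, ite_mul, zero_mul,
    Finset.sum_sub_distrib, Finset.sum_ite_eq, Finset.mem_univ, if_true]
  congr 1
  rw [Finset.sum_comm]
  simp

/-- Two of the four inverse metrics cancel against the metric factors, since `q_c d_a δ_ac = δ_ac`;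
the other two remain. -/
theorem raiseDiag_weylUnit (D : KundtData f I R₀) {x : Coord} (hx : x ∈ kundtChart f I)
    (J : Fin 4 → Fin 4) : raiseDiag (kundtInv f R₀) (weylUnit f R₀) J x =
      diagRiem weylPattern (fun a => kundtInv f R₀ a x) (J 0) (J 1) (J 2) (J 3) := by
  have h := kundtDiag_mul_kundtInv D hx
  simp only [raiseDiag, weylUnit, Fin.prod_univ_four, diagRiem]
  generalize J 0 = a
  generalize J 1 = b
  generalize J 2 = c
  generalize J 3 = k
  have h1 : ∀ a c, kundtInv f R₀ c x * kundtDiag f R₀ a x * kron a c = kron a c := fun a c => by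
    rw [kron]
    split_ifs with hac
    · subst hac
      rw [mul_one, mul_comm, h]
    · simp
  linear_combination weylPattern a b * kundtInv f R₀ a x * kundtInv f R₀ b x *
    (kundtInv f R₀ k x * kundtDiag f R₀ b x * kron b k * h1 a c + kron a c * h1 b k
    - kundtInv f R₀ c x * kundtDiag f R₀ b x * kron b c * h1 a k - kron a k * h1 b c)

theorem sum_raiseDiag_weylUnit_mul (D : KundtData f I R₀) {x : Coord} (hx : x ∈ kundtChart f I)
    (Z : (Fin 4 → Fin 4) → ℝ) :
    ∑ J, raiseDiag (kundtInv f R₀) (weylUnit f R₀) J x * Z J =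
      ∑ a, ∑ b, weylPattern a b * kundtInv f R₀ a x * kundtInv f R₀ b x *
        (Z ![a, b, a, b] - Z ![a, b, b, a]) := by
  rw [sum_fin_four]
  simp only [raiseDiag_weylUnit D hx]
  exact sum_diagRiem_mul weylPattern (fun a => kundtInv f R₀ a x) fun a b c e => Z ![a, b, c, e]

/-- Every ordered pair `a ≠ b` contributes `2 p²`: the four pairs inside blocks give `8`, the eight
mixed pairs with `p = -1/2` give `4`. -/
theorem sum_raiseDiag_mul_weylUnit (D : KundtData f I R₀) {x : Coord} (hx : x ∈ kundtChart f I) :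
    ∑ J, raiseDiag (kundtInv f R₀) (weylUnit f R₀) J x * weylUnit f R₀ J x = 12 := by
  have h := kundtDiag_mul_kundtInv D hx
  rw [sum_raiseDiag_weylUnit_mul D hx (fun J => weylUnit f R₀ J x)]
  have h1 : ∀ a b, weylPattern a b * kundtInv f R₀ a x * kundtInv f R₀ b x *
      (weylUnit f R₀ ![a, b, a, b] x - weylUnit f R₀ ![a, b, b, a] x) =
      2 * weylPattern a b ^ 2 * (1 - kron a b) := fun a b => by
    have k1 : kron a a = 1 := if_pos rfl
    have k2 : kron b b = 1 := if_pos rfl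
    have k3 : kron a b ^ 2 = kron a b := by rw [kron]; split_ifs <;> norm_num
    simp only [weylUnit, diagRiem, Matrix.cons_val, k1, k2, kron_comm b a]
    linear_combination 2 * weylPattern a b ^ 2 * (1 - kron a b ^ 2) *
      (kundtDiag f R₀ b x * kundtInv f R₀ b x * h a + h b) - 2 * weylPattern a b ^ 2 * k3
  simp only [h1, Fin.sum_univ_four]
  simp [weylPattern, blockwise, kron]
  norm_num

/-- The sum of `p_ab²` over `b ≠ a` is `3/2` for every `a`, so the contraction of the tensor with
itself over three indices is a multiple of the metric. This instance of the four-dimensional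
identity `C_{acde} C_b^{cde} = g_ab C²/4` gives `3` for each of the four slots. -/
theorem hasTraceProperty_weylUnit (D : KundtData f I R₀) :
    HasTraceProperty (kundtChart f I) (kundtInv f R₀) (weylUnit f R₀) 12 := by
  intro x hx A
  have h := kundtDiag_mul_kundtInv D hx
  rw [sum_raiseDiag_weylUnit_mul D hx
    (fun J => ∑ j, ∑ m, A (J j) m * weylUnit f R₀ (Function.update J j m) x)]
  have h1 : ∀ a b, weylPattern a b * kundtInv f R₀ a x * kundtInv f R₀ b x *
      ((∑ j, ∑ m, A ((![a, b, a, b] : Fin 4 → Fin 4) j) m *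
          weylUnit f R₀ (Function.update ![a, b, a, b] j m) x) -
        ∑ j, ∑ m, A ((![a, b, b, a] : Fin 4 → Fin 4) j) m *
          weylUnit f R₀ (Function.update ![a, b, b, a] j m) x) =
      4 * weylPattern a b ^ 2 * (1 - kron a b) * (A a a + A b b) := fun a b => by
    have k1 : kron a a = 1 := if_pos rfl
    have k2 : kron b b = 1 := if_pos rfl
    have k3 : kron a b ^ 2 = kron a b := by rw [kron]; split_ifs <;> norm_num
    rw [sum_update_weylUnit A a b a b x rfl rfl rfl rfl,
      sum_update_weylUnit A a b b a x rfl rfl rfl rfl]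
    rcases eq_or_ne a b with rfl | hab
    · simp [k1]
    · have hk : kron a b = 0 := if_neg hab
      simp only [k1, k2, kron_comm b a, hk]
      linear_combination 4 * weylPattern a b ^ 2 * (A a a + A b b) *
        (kundtDiag f R₀ b x * kundtInv f R₀ b x * h a + h b)
  simp only [h1]
  simp only [Fin.sum_univ_four]
  simp [weylPattern, blockwise, kron]
  ring

end

end

end SixDerivativeGravity


namespace SixDerivativeGravity

open MeasureTheory Filter Topology

noncomputable section

/-! ### The first variation of the curvature at a Kundt metric -/

/-- The diagonal components `h^a_a` of the variation. -/
def hDiag (f : ℝ → ℝ) (R₀ : ℝ) (h : Coord → Matrix (Fin 4) (Fin 4) ℝ) (a : Fin 4)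
    (x : Coord) : ℝ := h x a a * kundtInv f R₀ a x

/-- The first variation of `R^{ab}_{ab}` (no summation). -/
def secVar (f : ℝ → ℝ) (R₀ : ℝ) (h : Coord → Matrix (Fin 4) (Fin 4) ℝ) (a b : Fin 4)
    (x : Coord) : ℝ :=
  kundtInv f R₀ b x * variation (kundtMetric f R₀) h (fun g => riemannUp g a b a b) x
    - (1 - kron a b) * (hDiag f R₀ h b x * sectional f R₀ x a b)

/-- The first variation of the Ricci scalar. -/
def scalarVar (f : ℝ → ℝ) (R₀ : ℝ) (h : Coord → Matrix (Fin 4) (Fin 4) ℝ) (x : Coord) : ℝ :=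
  ∑ b, ∑ a, secVar f R₀ h a b x

/-- The difference of the first variations of the traces of the Ricci tensor over the two
blocks. -/
def splitVar (f : ℝ → ℝ) (R₀ : ℝ) (h : Coord → Matrix (Fin 4) (Fin 4) ℝ) (x : Coord) : ℝ :=
  ∑ b, blockSign b * ∑ a, secVar f R₀ h a b x

/-- Six times the first variation of the Weyl eigenvalue. -/
def weylVar (f : ℝ → ℝ) (R₀ : ℝ) (h : Coord → Matrix (Fin 4) (Fin 4) ℝ) (x : Coord) : ℝ :=
  ∑ a, ∑ b, weylPattern a b * secVar f R₀ h a b x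

section

variable {f : ℝ → ℝ} {I : Set ℝ} {R₀ : ℝ} {h : Coord → Matrix (Fin 4) (Fin 4) ℝ}

theorem kron_self (a : Fin 4) : kron a a = 1 := if_pos rfl

theorem kron_of_ne {a b : Fin 4} (hab : a ≠ b) : kron a b = 0 := if_neg hab

theorem variation_neg (g : Metric) (F : Metric → Coord → ℝ) (x : Coord) :
    variation g h (fun g x => -F g x) x = -variation g h F x := by
  simp only [variation]
  exact deriv.fun_neg

theorem variation_riemannUp_self (g : Metric) (a b c : Fin 4) (x : Coord) :
    variation g h (fun g => riemannUp g a b c c) x = 0 := by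
  have : ∀ g : Metric, riemannUp g a b c c x = 0 := fun g => by
    have := riemannUp_swap g a b c c x
    linarith
  simp [variation, this]

theorem secVar_self (a : Fin 4) (x : Coord) : secVar f R₀ h a a x = 0 := by
  simp [secVar, variation_riemannUp_self, kron_self]

theorem variation_ricci (H : IsVariation (kundtChart f I) (kundtMetric f R₀) h) (b e : Fin 4)
    {x : Coord} (hx : x ∈ kundtChart f I) :
    variation (kundtMetric f R₀) h (fun g => ricci g b e) x =
      ∑ a, variation (kundtMetric f R₀) h (fun g => riemannUp g a b a e) x := by
  have h1 : HasDerivAt (fun ε : ℝ => ricci (perturb (kundtMetric f R₀) h ε) b e x) _ 0 :=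
    HasDerivAt.fun_sum fun (a : Fin 4) (_ : a ∈ Finset.univ) =>
      (smoothFunctional_riemannUp H a b a e).hasDerivAt H hx
  rw [variation, h1.deriv]

theorem sum_sectional (x : Coord) (b : Fin 4) :
    ∑ a, (1 - kron a b) * sectional f R₀ x a b = ricciEigen f R₀ x b := by
  simp only [Fin.sum_univ_four]
  fin_cases b <;> simp [kron, sectional, blockwise, ricciEigen]

/-- The first variation of the mixed diagonal components of the Ricci tensor. -/
theorem kundtInv_mul_variation_ricci (H : IsVariation (kundtChart f I) (kundtMetric f R₀) h)
    (b : Fin 4) {x : Coord} (hx : x ∈ kundtChart f I) :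
    kundtInv f R₀ b x * variation (kundtMetric f R₀) h (fun g => ricci g b b) x =
      ∑ a, secVar f R₀ h a b x + hDiag f R₀ h b x * ricciEigen f R₀ x b := by
  rw [variation_ricci H b b hx, ← sum_sectional]
  simp only [secVar, Finset.sum_sub_distrib, Finset.mul_sum]
  have : ∀ a, (1 - kron a b) * (hDiag f R₀ h b x * sectional f R₀ x a b) =
      hDiag f R₀ h b x * ((1 - kron a b) * sectional f R₀ x a b) := fun a => by ring
  simp only [this, sub_add_cancel]

/-- The variation of the inverse metric subtracts `h^a_a` times the Ricci eigenvalue, exactly the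
term by which the varied Ricci tensor exceeds the sum of the `secVar`. -/
theorem variation_ricciScalar (D : KundtData f I R₀)
    (H : IsVariation (kundtChart f I) (kundtMetric f R₀) h)
    {x : Coord} (hx : x ∈ kundtChart f I) :
    variation (kundtMetric f R₀) h ricciScalar x = scalarVar f R₀ h x := by
  have hq := isDiagonalInverse_kundt D
  have h1 : HasDerivAt (fun ε : ℝ => ricciScalar (perturb (kundtMetric f R₀) h ε) x) _ 0 :=
    HasDerivAt.fun_sum fun (a : Fin 4) (_ : a ∈ Finset.univ) =>
    HasDerivAt.fun_sum fun (b : Fin 4) (_ : b ∈ Finset.univ) =>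
      ((smoothFunctional_ginv H a b).hasDerivAt H hx).mul
        ((smoothFunctional_ricci H a b).hasDerivAt H hx)
  rw [variation, h1.deriv]
  simp only [perturb_zero, variation_ginv_of_diagonal H hq _ _ hx, ricci_kundt D hx, hq x hx,
    Finset.sum_add_distrib, ite_mul, zero_mul, kundtInv_mul_variation_ricci H _ hx,
    Finset.sum_ite_eq, Finset.mem_univ, if_true, kron, one_mul, mul_ite, mul_zero]
  simp only [scalarVar, ← Finset.sum_add_distrib]
  refine Finset.sum_congr rfl fun a _ => ?_
  rw [hDiag]
  linear_combination -kundtInv f R₀ a x * h x a a * ricciEigen f R₀ x a *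
    kundtDiag_mul_kundtInv D hx a

theorem variation_tracelessRicci (D : KundtData f I R₀)
    (H : IsVariation (kundtChart f I) (kundtMetric f R₀) h) (a b : Fin 4)
    {x : Coord} (hx : x ∈ kundtChart f I) :
    variation (kundtMetric f R₀) h (fun g => tracelessRicci g a b) x =
      variation (kundtMetric f R₀) h (fun g => ricci g a b) x
        - (1 / 4) * scalarVar f R₀ h x * (kron a b * kundtDiag f R₀ a x)
        - (3 / 2) * weylFactor f R₀ (x 1) * h x a b := by
  have h1 := (smoothFunctional_ricciScalar H).hasDerivAt H hx
  rw [variation_ricciScalar D H hx] at h1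
  have h2 := (smoothFunctional_metric H a b).hasDerivAt H hx
  rw [variation_metric] at h2
  have h3 : HasDerivAt (fun ε : ℝ => tracelessRicci (perturb (kundtMetric f R₀) h ε) a b x) _ 0 :=
    ((smoothFunctional_ricci H a b).hasDerivAt H hx).sub ((h1.const_mul (1 / 4)).mul h2)
  rw [variation, h3.deriv]
  simp only [perturb_zero, ricciScalar_kundt D hx, kundtMetric_apply]
  ring

/-- The first variation of the mixed diagonal components of the traceless Ricci tensor. -/
theorem kundtInv_mul_variation_tracelessRicci (D : KundtData f I R₀)
    (H : IsVariation (kundtChart f I) (kundtMetric f R₀) h)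
    (b : Fin 4) {x : Coord} (hx : x ∈ kundtChart f I) :
    kundtInv f R₀ b x * variation (kundtMetric f R₀) h (fun g => tracelessRicci g b b) x =
      ∑ a, secVar f R₀ h a b x - scalarVar f R₀ h x / 4
        + hDiag f R₀ h b x * (ricciSplit f R₀ (x 1) * blockSign b) := by
  rw [variation_tracelessRicci D H b b hx, mul_sub, mul_sub, kundtInv_mul_variation_ricci H b hx]
  have e : ricciEigen f R₀ x b - 3 / 2 * weylFactor f R₀ (x 1) =
      ricciSplit f R₀ (x 1) * blockSign b := by
    fin_cases b <;> simp [ricciEigen, weylFactor, ricciSplit, blockSign] <;> ring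
  rw [← e, kron_self, hDiag]
  linear_combination (-scalarVar f R₀ h x / 4) * kundtDiag_mul_kundtInv D hx b

theorem weyl_swap (g : Metric) (a b c e : Fin 4) (x : Coord) :
    weyl g a b e c x = -weyl g a b c e x := by
  simp only [weyl, riemann, riemannUp_swap g _ b c e x, mul_neg, Finset.sum_neg_distrib]
  ring

theorem variation_weyl_swap (g : Metric) (a b c e : Fin 4) (x : Coord) :
    variation g h (fun g => weyl g a b e c) x = -variation g h (fun g => weyl g a b c e) x := by
  rw [← variation_neg]
  simp only [variation, weyl_swap _ a b c e]

/-- The first variation of `C^{ab}_{ab}` (no summation). -/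
def weylSecVar (f : ℝ → ℝ) (R₀ : ℝ) (h : Coord → Matrix (Fin 4) (Fin 4) ℝ) (a b : Fin 4)
    (x : Coord) : ℝ :=
  (1 - kron a b) * (secVar f R₀ h a b x - (∑ c, secVar f R₀ h c a x + ∑ c, secVar f R₀ h c b x) / 2
    + scalarVar f R₀ h x / 6)

/-- While `secVar` belongs to mixed components, here all indices are lowered; each of the two
additional lowered indices adds its `h^i_i` times the curvature. -/
theorem kundtInv_mul_variation_riemann (D : KundtData f I R₀)
    (H : IsVariation (kundtChart f I) (kundtMetric f R₀) h)
    {a b : Fin 4} (hab : a ≠ b) {x : Coord} (hx : x ∈ kundtChart f I) :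
    kundtInv f R₀ a x * kundtInv f R₀ b x *
        variation (kundtMetric f R₀) h (fun g => riemann g a b a b) x =
      secVar f R₀ h a b x + (hDiag f R₀ h a x + hDiag f R₀ h b x) * sectional f R₀ x a b := by
  have h1 : HasDerivAt (fun ε : ℝ => riemann (perturb (kundtMetric f R₀) h ε) a b a b x) _ 0 :=
    HasDerivAt.fun_sum fun (e : Fin 4) (_ : e ∈ Finset.univ) =>
      ((smoothFunctional_metric H a e).hasDerivAt H hx).mul
        ((smoothFunctional_riemannUp H e b a b).hasDerivAt H hx)
  rw [variation, h1.deriv]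
  have hk : kron b a = 0 := kron_of_ne hab.symm
  simp only [perturb_zero, variation_metric, kundtMetric_apply, riemannUp_kundt D hx, hk,
    Finset.sum_add_distrib, mul_zero, sub_zero, secVar, hDiag, kron_of_ne hab, kron_self, mul_one]
  have s1 : ∑ e, h x a e * (sectional f R₀ x e b * kundtDiag f R₀ b x * kron e a) =
      h x a a * (sectional f R₀ x a b * kundtDiag f R₀ b x) := by
    rw [← sum_kron_mul (fun e => h x a e * (sectional f R₀ x e b * kundtDiag f R₀ b x))]
    exact Finset.sum_congr rfl fun e _ => by ring
  have s2 : ∑ e, kron a e * kundtDiag f R₀ a x *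
        variation (kundtMetric f R₀) h (fun g => riemannUp g e b a b) x =
      kundtDiag f R₀ a x * variation (kundtMetric f R₀) h (fun g => riemannUp g a b a b) x := by
    rw [← sum_kron_mul (fun e => kundtDiag f R₀ a x *
        variation (kundtMetric f R₀) h (fun g => riemannUp g e b a b) x)]
    exact Finset.sum_congr rfl fun e _ => by rw [kron_comm a e]; ring
  rw [s1, s2]
  linear_combination kundtInv f R₀ b x *
    variation (kundtMetric f R₀) h (fun g => riemannUp g a b a b) x * kundtDiag_mul_kundtInv D hx a
    + kundtInv f R₀ a x * h x a a * sectional f R₀ x a b * kundtDiag_mul_kundtInv D hx b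

/-- The decomposition of the Weyl tensor is varied term by term. The off-diagonal components of `h`
multiply off-diagonal background components, which vanish; the lowered indices add the terms with
`hDiag`. For `a = b` antisymmetry makes both sides zero. -/
theorem kundtInv_mul_variation_weyl (D : KundtData f I R₀)
    (H : IsVariation (kundtChart f I) (kundtMetric f R₀) h)
    (a b : Fin 4) {x : Coord} (hx : x ∈ kundtChart f I) :
    kundtInv f R₀ a x * kundtInv f R₀ b x *
        variation (kundtMetric f R₀) h (fun g => weyl g a b a b) x =
      weylSecVar f R₀ h a b x + (1 - kron a b) * ((hDiag f R₀ h a x + hDiag f R₀ h b x) *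
        (weylFactor f R₀ (x 1) * weylPattern a b)) := by
  rcases eq_or_ne a b with rfl | hab
  · have h1 := variation_weyl_swap (h := h) (kundtMetric f R₀) a a a a x
    have h2 : variation (kundtMetric f R₀) h (fun g => weyl g a a a a) x = 0 := by linarith
    simp [h2, weylSecVar, kron_self]
  have hm : ∀ i j, HasDerivAt (fun ε : ℝ => perturb (kundtMetric f R₀) h ε x i j) (h x i j) 0 :=
    fun i j => by
      have := (smoothFunctional_metric H i j).hasDerivAt H hx
      rwa [variation_metric] at this
  have hR := fun i j => (smoothFunctional_ricci H i j).hasDerivAt H hx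
  have hS := (smoothFunctional_ricciScalar H).hasDerivAt H hx
  rw [variation_ricciScalar D H hx] at hS
  have h3 : HasDerivAt (fun ε : ℝ => weyl (perturb (kundtMetric f R₀) h ε) a b a b x) _ 0 :=
    (((smoothFunctional_riemann H a b a b).hasDerivAt H hx).sub
      ((((((hm a a).mul (hR b b)).sub ((hm a b).mul (hR b a))).sub ((hm b a).mul (hR a b))).add
        ((hm b b).mul (hR a a))).const_mul (1 / 2))).add
      ((hS.div_const 6).mul (((hm a a).mul (hm b b)).sub ((hm a b).mul (hm b a))))
  rw [variation, h3.deriv]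
  have hK : sectional f R₀ x a b - (ricciEigen f R₀ x a + ricciEigen f R₀ x b) / 2 +
      weylFactor f R₀ (x 1) = weylFactor f R₀ (x 1) * weylPattern a b := by
    fin_cases a <;> fin_cases b <;>
      simp [sectional, ricciEigen, weylPattern, blockwise, weylFactor] <;> ring
  have k1 := kron_of_ne hab
  have k2 := kron_of_ne hab.symm
  simp only [perturb_zero, kundtMetric_apply, ricci_kundt D hx, ricciScalar_kundt D hx, k1, k2,
    kron_self, weylSecVar, ← hK]
  have e1 := kundtInv_mul_variation_riemann D H hab hx
  have e2 := kundtInv_mul_variation_ricci H a hx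
  have e3 := kundtInv_mul_variation_ricci H b hx
  have e4 := kundtDiag_mul_kundtInv D hx a
  have e5 := kundtDiag_mul_kundtInv D hx b
  simp only [hDiag] at e1 e2 e3 ⊢
  linear_combination e1 - (1 / 2) * e2 - (1 / 2) * e3
    - (1 / 2) * kundtInv f R₀ b x * variation (kundtMetric f R₀) h (fun g => ricci g b b) x * e4
    - (1 / 2) * kundtInv f R₀ a x * variation (kundtMetric f R₀) h (fun g => ricci g a a) x * e5
    - (1 / 2) * h x a a * kundtInv f R₀ a x * ricciEigen f R₀ x b * e5
    - (1 / 2) * h x b b * kundtInv f R₀ b x * ricciEigen f R₀ x a * e4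
    + (scalarVar f R₀ h x / 6) * (kundtDiag f R₀ b x * kundtInv f R₀ b x * e4 + e5)
    + weylFactor f R₀ (x 1) * (h x a a * kundtInv f R₀ a x * e5 + h x b b * kundtInv f R₀ b x * e4)

/-- The contraction of the covariantly constant tensor `weylUnit` with the first variation of the
Weyl tensor. -/
theorem sum_weylUnit_mul_variation (D : KundtData f I R₀)
    (H : IsVariation (kundtChart f I) (kundtMetric f R₀) h)
    {x : Coord} (hx : x ∈ kundtChart f I) :
    ∑ J, raiseDiag (kundtInv f R₀) (weylUnit f R₀) J x *
        variation (kundtMetric f R₀) h (fun g => weylTensor g J) x =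
      2 * weylVar f R₀ h x + 6 * weylFactor f R₀ (x 1) * ∑ a, hDiag f R₀ h a x := by
  rw [sum_raiseDiag_weylUnit_mul D hx
    (fun J => variation (kundtMetric f R₀) h (fun g => weylTensor g J) x)]
  have h1 : ∀ a b, weylPattern a b * kundtInv f R₀ a x * kundtInv f R₀ b x *
      (variation (kundtMetric f R₀) h (fun g => weylTensor g ![a, b, a, b]) x -
        variation (kundtMetric f R₀) h (fun g => weylTensor g ![a, b, b, a]) x) =
      2 * weylPattern a b * (weylSecVar f R₀ h a b x + (1 - kron a b) *
        ((hDiag f R₀ h a x + hDiag f R₀ h b x) *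
        (weylFactor f R₀ (x 1) * weylPattern a b))) := fun a b => by
    rw [← kundtInv_mul_variation_weyl D H a b hx]
    have h2 := variation_weyl_swap (h := h) (kundtMetric f R₀) a b a b x
    have h3 : variation (kundtMetric f R₀) h (fun g => weylTensor g ![a, b, b, a]) x =
      variation (kundtMetric f R₀) h (fun g => weyl g a b b a) x := rfl
    have h4 : variation (kundtMetric f R₀) h (fun g => weylTensor g ![a, b, a, b]) x =
      variation (kundtMetric f R₀) h (fun g => weyl g a b a b) x := rfl
    rw [h3, h4, h2]
    ring
  simp only [h1, weylVar, weylSecVar, scalarVar, Fin.sum_univ_four, secVar_self]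
  simp [weylPattern, blockwise, kron]
  ring

end

end

end SixDerivativeGravity


namespace SixDerivativeGravity

open MeasureTheory Filter Topology

noncomputable section

/-! ### Sums with Kronecker deltas -/

theorem sum_kron_mul' (F : Fin 4 → ℝ) (a : Fin 4) : ∑ m, kron a m * F m = F a := by
  simp [kron]

theorem sum_diagRiem_mul_pair (κ : Fin 4 → Fin 4 → ℝ) (d : Fin 4 → ℝ) (F : Fin 4 → Fin 4 → ℝ)
    (a b : Fin 4) :
    ∑ c, ∑ e, diagRiem κ d a b c e * F c e = κ a b * d a * d b * (F a b - F b a) := by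
  simp only [diagRiem, kron, mul_sub, sub_mul, mul_ite, mul_one, mul_zero, ite_mul, zero_mul,
    Finset.sum_sub_distrib, Finset.sum_ite_eq, Finset.mem_univ, if_true]
  congr 1
  rw [Finset.sum_comm]
  simp

theorem weylPattern_comm (a b : Fin 4) : weylPattern a b = weylPattern b a := by
  fin_cases a <;> fin_cases b <;> simp [weylPattern, blockwise]

theorem diagRiem_pair_comm {κ : Fin 4 → Fin 4 → ℝ} (hκ : ∀ a b, κ a b = κ b a) (d : Fin 4 → ℝ)
    (a b c e : Fin 4) : diagRiem κ d a b c e = diagRiem κ d c e a b := by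
  simp only [diagRiem, kron]
  by_cases h1 : a = c <;> by_cases h2 : b = e <;> by_cases h3 : a = e <;> by_cases h4 : b = c <;>
    subst_vars <;> (simp_all [eq_comm]; try ring)

theorem diagRiem_swap (κ : Fin 4 → Fin 4 → ℝ) (d : Fin 4 → ℝ) (a b c e : Fin 4) :
    diagRiem κ d a b e c = -diagRiem κ d a b c e := by
  simp only [diagRiem]
  ring

theorem mul_diagRiem_one {κ : Fin 4 → Fin 4 → ℝ} (hκ : ∀ a b, κ a b = κ b a) (d : Fin 4 → ℝ)
    (a b c e : Fin 4) : κ a b * d a * d b * diagRiem κ (fun _ => 1) c e a b =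
      diagRiem (fun a b => κ a b ^ 2) d a b c e := by
  rw [diagRiem_pair_comm hκ]
  simp only [diagRiem]
  ring

section

variable {f : ℝ → ℝ} {I : Set ℝ} {R₀ : ℝ} {h : Coord → Matrix (Fin 4) (Fin 4) ℝ}

/-! ### The first variation of the algebraic invariants -/

/-- The correction to be subtracted is `h_ab σ_b + h_ba σ_a`, with `σ_a` the eigenvalue in direction
`a`. It is written as a product of symmetric factors and a product of antisymmetric ones, of which
the latter vanishes on the diagonal. -/
theorem variation_raise_sTensor (D : KundtData f I R₀)
    (H : IsVariation (kundtChart f I) (kundtMetric f R₀) h) (a b : Fin 4) {x : Coord}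
    (hx : x ∈ kundtChart f I) :
    variation (kundtMetric f R₀) h (fun g => raise g (sTensor g) ![a, b]) x =
      kundtInv f R₀ a x * kundtInv f R₀ b x *
        (variation (kundtMetric f R₀) h (fun g => tracelessRicci g a b) x -
          (h x a b + h x b a) * (ricciSplit f R₀ (x 1) * (blockSign b + blockSign a) / 2)
          + (h x b a - h x a b) * (ricciSplit f R₀ (x 1) * (blockSign b - blockSign a) / 2)) := by
  rw [variation_raise_of_diagonal H (isDiagonalInverse_kundt D) (smoothFunctional_sTensor H) _ hx,
    Fin.prod_univ_two,
    Fin.sum_univ_two (fun j => ∑ m, h x ((![a, b] : Fin 2 → Fin 4) j) m * kundtInv f R₀ m x *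
      sTensor (kundtMetric f R₀) (Function.update ![a, b] j m) x)]
  have u0 : ∀ m, sTensor (kundtMetric f R₀) (Function.update ![a, b] 0 m) x =
      tracelessRicci (kundtMetric f R₀) m b x := fun m => rfl
  have u1 : ∀ m, sTensor (kundtMetric f R₀) (Function.update ![a, b] 1 m) x =
      tracelessRicci (kundtMetric f R₀) a m x := fun m => rfl
  simp only [u0, u1, tracelessRicci_kundt D hx, Matrix.cons_val_zero, Matrix.cons_val_one]
  have s0 : ∑ m, h x a m * kundtInv f R₀ m x *
      (kron m b * kundtDiag f R₀ m x * (ricciSplit f R₀ (x 1) * blockSign m)) =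
      h x a b * (ricciSplit f R₀ (x 1) * blockSign b) := by
    rw [← sum_kron_mul (fun m => h x a m * (ricciSplit f R₀ (x 1) * blockSign m)) b]
    exact Finset.sum_congr rfl fun m _ => by
      linear_combination h x a m * kron m b * ricciSplit f R₀ (x 1) * blockSign m *
        kundtDiag_mul_kundtInv D hx m
  have s1 : ∑ m, h x b m * kundtInv f R₀ m x *
      (kron a m * kundtDiag f R₀ a x * (ricciSplit f R₀ (x 1) * blockSign a)) =
      h x b a * (ricciSplit f R₀ (x 1) * blockSign a) := by
    rw [← kundtDiag_mul_kundtInv D hx a |> fun e => show h x b a * kundtInv f R₀ a x *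
      (kundtDiag f R₀ a x * (ricciSplit f R₀ (x 1) * blockSign a)) =
      h x b a * (ricciSplit f R₀ (x 1) * blockSign a) by
        linear_combination h x b a * ricciSplit f R₀ (x 1) * blockSign a * e,
      ← sum_kron_mul' (fun m => h x b m * kundtInv f R₀ m x *
      (kundtDiag f R₀ a x * (ricciSplit f R₀ (x 1) * blockSign a))) a]
    exact Finset.sum_congr rfl fun m _ => by ring
  rw [s0, s1]
  have e : variation (kundtMetric f R₀) h (fun g => sTensor g ![a, b]) x =
    variation (kundtMetric f R₀) h (fun g => tracelessRicci g a b) x := rfl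
  rw [e]
  ring

theorem raise_sTensor_kundt (D : KundtData f I R₀) (a b : Fin 4) {x : Coord}
    (hx : x ∈ kundtChart f I) : raise (kundtMetric f R₀) (sTensor (kundtMetric f R₀)) ![a, b] x =
      kron a b * (kundtInv f R₀ a x * (ricciSplit f R₀ (x 1) * blockSign a)) := by
  rw [raise_of_diagonal (isDiagonalInverse_kundt D) _ _ hx, Fin.prod_univ_two]
  have e : sTensor (kundtMetric f R₀) ![a, b] x = tracelessRicci (kundtMetric f R₀) a b x := rfl
  rw [e, tracelessRicci_kundt D hx]
  rcases eq_or_ne a b with rfl | hab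
  · simp only [Matrix.cons_val_zero, Matrix.cons_val_one, kron_self]
    linear_combination kundtInv f R₀ a x * ricciSplit f R₀ (x 1) * blockSign a *
      kundtDiag_mul_kundtInv D hx a
  · simp [kron_of_ne hab]

/-- In mixed components `S` is diagonal with entries `±σ`, and `tr S²` varies by `2 tr (S δS)`. The
trace part of `δS` drops out because the signs add up to zero. -/
theorem variation_invSS (D : KundtData f I R₀)
    (H : IsVariation (kundtChart f I) (kundtMetric f R₀) h) {x : Coord}
    (hx : x ∈ kundtChart f I) :
    variation (kundtMetric f R₀) h invSS x = 2 * ricciSplit f R₀ (x 1) * splitVar f R₀ h x := by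
  have h1 : HasDerivAt (fun ε : ℝ => invSS (perturb (kundtMetric f R₀) h ε) x) _ 0 :=
    HasDerivAt.fun_sum fun (a : Fin 4) (_ : a ∈ Finset.univ) =>
    HasDerivAt.fun_sum fun (b : Fin 4) (_ : b ∈ Finset.univ) =>
      ((smoothFunctional_tracelessRicci H a b).hasDerivAt H hx).mul
        ((smoothFunctional_raise H (smoothFunctional_sTensor H) ![a, b]).hasDerivAt H hx)
  rw [variation, h1.deriv]
  simp only [perturb_zero, variation_raise_sTensor D H _ _ hx, raise_sTensor_kundt D _ _ hx,
    tracelessRicci_kundt D hx]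
  have h2 : ∀ a, ∑ b, (variation (kundtMetric f R₀) h (fun g => tracelessRicci g a b) x *
      (kron a b * (kundtInv f R₀ a x * (ricciSplit f R₀ (x 1) * blockSign a))) +
      kron a b * kundtDiag f R₀ a x * (ricciSplit f R₀ (x 1) * blockSign a) *
      (kundtInv f R₀ a x * kundtInv f R₀ b x *
        (variation (kundtMetric f R₀) h (fun g => tracelessRicci g a b) x -
          (h x a b + h x b a) * (ricciSplit f R₀ (x 1) * (blockSign b + blockSign a) / 2)
          + (h x b a - h x a b) * (ricciSplit f R₀ (x 1) * (blockSign b - blockSign a) / 2)))) =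
      2 * (ricciSplit f R₀ (x 1) * blockSign a) *
        (∑ c, secVar f R₀ h c a x - scalarVar f R₀ h x / 4) := fun a => by
    rw [show 2 * (ricciSplit f R₀ (x 1) * blockSign a) *
        (∑ c, secVar f R₀ h c a x - scalarVar f R₀ h x / 4) =
        2 * (ricciSplit f R₀ (x 1) * blockSign a) *
        (kundtInv f R₀ a x * variation (kundtMetric f R₀) h (fun g => tracelessRicci g a a) x -
          hDiag f R₀ h a x * (ricciSplit f R₀ (x 1) * blockSign a)) by
      rw [kundtInv_mul_variation_tracelessRicci D H a hx]; ring]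
    rw [Finset.sum_eq_single a (fun b _ hb => by simp [kron_of_ne hb.symm]) (by simp)]
    simp only [kron_self, hDiag]
    linear_combination (ricciSplit f R₀ (x 1) * blockSign a) * kundtInv f R₀ a x *
      (variation (kundtMetric f R₀) h (fun g => tracelessRicci g a a) x -
        2 * h x a a * (ricciSplit f R₀ (x 1) * blockSign a)) * kundtDiag_mul_kundtInv D hx a
  simp only [h2, splitVar, scalarVar]
  simp [Fin.sum_univ_four, blockSign]
  ring

/-- `tr S³` varies by `3 tr (S² δS)`, and `S² = σ²` times the identity; so the result is a multiple
of the trace of the mixed tensor `δS`, which vanishes. -/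
theorem variation_invSSS (D : KundtData f I R₀)
    (H : IsVariation (kundtChart f I) (kundtMetric f R₀) h) {x : Coord}
    (hx : x ∈ kundtChart f I) : variation (kundtMetric f R₀) h invSSS x = 0 := by
  have h1 : HasDerivAt (fun ε : ℝ => invSSS (perturb (kundtMetric f R₀) h ε) x) _ 0 :=
    HasDerivAt.fun_sum fun (a : Fin 4) (_ : a ∈ Finset.univ) =>
    HasDerivAt.fun_sum fun (b : Fin 4) (_ : b ∈ Finset.univ) =>
    HasDerivAt.fun_sum fun (c : Fin 4) (_ : c ∈ Finset.univ) =>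
      (((smoothFunctional_tracelessRicci H a b).hasDerivAt H hx).mul
        (HasDerivAt.fun_sum fun (m : Fin 4) (_ : m ∈ Finset.univ) =>
          ((smoothFunctional_ginv H a m).hasDerivAt H hx).mul
            ((smoothFunctional_tracelessRicci H m c).hasDerivAt H hx))).mul
        ((smoothFunctional_raise H (smoothFunctional_sTensor H) ![c, b]).hasDerivAt H hx)
  have hq := isDiagonalInverse_kundt D
  rw [variation, h1.deriv]
  simp only [Pi.mul_apply, perturb_zero, variation_raise_sTensor D H _ _ hx,
    raise_sTensor_kundt D _ _ hx, tracelessRicci_kundt D hx, variation_ginv_of_diagonal H hq _ _ hx, hq x hx]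
  have hd := kundtDiag_mul_kundtInv D hx
  set σ : Fin 4 → ℝ := fun a => ricciSplit f R₀ (x 1) * blockSign a with hσ
  set d : Fin 4 → ℝ := fun a => kundtDiag f R₀ a x with hdd
  set q : Fin 4 → ℝ := fun a => kundtInv f R₀ a x with hqq
  set V : Fin 4 → Fin 4 → ℝ := fun a b =>
    variation (kundtMetric f R₀) h (fun g => tracelessRicci g a b) x with hV
  have hs : ∀ a, ricciSplit f R₀ (x 1) * blockSign a = σ a := fun a => rfl
  have hda : ∀ a, kundtDiag f R₀ a x = d a := fun a => rfl
  have hqa : ∀ a, kundtInv f R₀ a x = q a := fun a => rfl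
  have hVa : ∀ a b, variation (kundtMetric f R₀) h (fun g => tracelessRicci g a b) x = V a b :=
    fun a b => rfl
  simp only [hs, hda, hqa, hVa] at hd ⊢
  have m1 : ∀ a c, ∑ m, (if a = m then q a else 0) * (kron m c * d m * σ m) =
      kron a c * σ a := fun a c => by
    simp only [ite_mul, zero_mul, Finset.sum_ite_eq, Finset.mem_univ, if_true]
    linear_combination kron a c * σ a * hd a
  have m2 : ∀ a c, ∑ m, (-(q a * h x a m * q m) * (kron m c * d m * σ m) +
      (if a = m then q a else 0) * V m c) = q a * V a c - q a * h x a c * σ c := fun a c => by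
    rw [Finset.sum_add_distrib]
    simp only [ite_mul, zero_mul, Finset.sum_ite_eq, Finset.mem_univ, if_true]
    rw [← sum_kron_mul (fun m => q a * h x a m * σ m) c, add_comm, sub_eq_add_neg,
      ← Finset.sum_neg_distrib]
    congr 1
    exact Finset.sum_congr rfl fun m _ => by
      linear_combination -(q a * h x a m * kron m c * σ m) * hd m
  simp only [m1, m2]
  have h2 : ∀ a, ∑ b, ∑ c, ((V a b * (kron a c * σ a) + kron a b * d a * σ a *
        (q a * V a c - q a * h x a c * σ c)) * (kron c b * (q c * σ c)) +
      kron a b * d a * σ a * (kron a c * σ a) * (q c * q b * (V c b -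
          (h x c b + h x b c) * (ricciSplit f R₀ (x 1) * (blockSign b + blockSign c) / 2)
          + (h x b c - h x c b) * (ricciSplit f R₀ (x 1) * (blockSign b - blockSign c) / 2)))) =
      3 * ricciSplit f R₀ (x 1) ^ 2 *
        (∑ c, secVar f R₀ h c a x - scalarVar f R₀ h x / 4) := fun a => by
    have e1 : ∑ c, secVar f R₀ h c a x - scalarVar f R₀ h x / 4 =
        q a * V a a - h x a a * q a * σ a := by
      have := kundtInv_mul_variation_tracelessRicci D H a hx
      simp only [hDiag, hs, hqa, hVa] at this
      linear_combination -this
    -- The square of `S` does not see the block sign. This turns the sum over `a` into a trace.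
    have e2 : ricciSplit f R₀ (x 1) ^ 2 = σ a ^ 2 := by
      simp only [hσ]
      fin_cases a <;> simp [blockSign]
    rw [e1, e2, Finset.sum_eq_single a _ (by simp), Finset.sum_eq_single a _ (by simp)]
    · simp only [kron_self]
      have e3 : ricciSplit f R₀ (x 1) * (blockSign a + blockSign a) / 2 = σ a := by
        simp only [hσ]; ring
      rw [e3]
      linear_combination (q a * σ a ^ 2 * (2 * V a a - 3 * h x a a * σ a)) * hd a
    · intro c _ hc
      simp [kron_of_ne hc.symm, kron_of_ne hc]
    · intro b _ hb
      refine Finset.sum_eq_zero fun c _ => ?_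
      rw [kron_of_ne hb.symm]
      rcases eq_or_ne a c with rfl | hc
      · simp [kron_of_ne hb.symm]
      · simp [kron_of_ne hc]
  simp only [h2, scalarVar]
  simp only [Fin.sum_univ_four]
  ring

end

end

end SixDerivativeGravity


/-! ### First variation of the invariants `C C` and `S S C` -/

namespace SixDerivativeGravity

open MeasureTheory Filter Topology

noncomputable section

/-- Together with `sum_four_kron_right` and `sum_four_kron_kron` this evaluates the variation of `S
S C`, according to whether the first `S`, the second `S` or `C` is varied while the other factors
are diagonal. -/
theorem sum_four_kron_left (A : Fin 4 → Fin 4 → ℝ) (X : Fin 4 → ℝ) (κ : Fin 4 → Fin 4 → ℝ)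
    (d : Fin 4 → ℝ) :
    ∑ a, ∑ b, ∑ c, ∑ e, A a b * (kron c e * X c) * diagRiem κ d a c b e =
      ∑ a, ∑ c, (1 - kron a c) * κ a c * d a * d c * A a a * X c := by
  refine Finset.sum_congr rfl fun a _ => ?_
  rw [Finset.sum_comm]
  refine Finset.sum_congr rfl fun c _ => ?_
  have h1 : ∀ b, ∑ e, A a b * (kron c e * X c) * diagRiem κ d a c b e =
      kron a b * ((1 - kron a c) * κ a c * d a * d c * A a b * X c) := fun b => by
    rw [show ∑ e, A a b * (kron c e * X c) * diagRiem κ d a c b e =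
        ∑ e, kron c e * (A a b * X c * diagRiem κ d a c b e) from
      Finset.sum_congr rfl fun e _ => by ring, sum_kron_mul']
    simp only [diagRiem, kron_self]
    rcases eq_or_ne a c with rfl | hac
    · simp [kron_self]
    · rw [kron_of_ne hac]; ring
  simp only [h1, sum_kron_mul' (fun b => (1 - kron a c) * κ a c * d a * d c * A a b * X c) a]

theorem sum_swap_pairs (F : Fin 4 → Fin 4 → Fin 4 → Fin 4 → ℝ) :
    ∑ a, ∑ b, ∑ c, ∑ e, F a b c e = ∑ c, ∑ e, ∑ a, ∑ b, F a b c e :=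
  calc _ = ∑ a, ∑ c, ∑ e, ∑ b, F a b c e := Finset.sum_congr rfl fun a _ => by
        rw [Finset.sum_comm]
        exact Finset.sum_congr rfl fun c _ => Finset.sum_comm
    _ = _ := by
        rw [Finset.sum_comm]
        exact Finset.sum_congr rfl fun c _ => Finset.sum_comm

theorem sum_four_kron_right {κ : Fin 4 → Fin 4 → ℝ} (hκ : ∀ a b, κ a b = κ b a)
    (A : Fin 4 → Fin 4 → ℝ) (X : Fin 4 → ℝ) (d : Fin 4 → ℝ) :
    ∑ a, ∑ b, ∑ c, ∑ e, (kron a b * X a) * A c e * diagRiem κ d a c b e =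
      ∑ a, ∑ c, (1 - kron a c) * κ a c * d a * d c * A a a * X c := by
  rw [← sum_four_kron_left A X κ d]
  rw [sum_swap_pairs]
  refine Finset.sum_congr rfl fun c _ => Finset.sum_congr rfl fun e _ =>
    Finset.sum_congr rfl fun a _ => Finset.sum_congr rfl fun b _ => ?_
  have : diagRiem κ d a c b e = diagRiem κ d c a e b := by
    simp only [diagRiem, hκ a c]
    ring
  rw [this]
  ring

theorem sum_four_kron_kron (X Y : Fin 4 → ℝ) (Z : Fin 4 → Fin 4 → Fin 4 → Fin 4 → ℝ) :
    ∑ a, ∑ b, ∑ c, ∑ e, (kron a b * X a) * (kron c e * Y c) * Z a c b e =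
      ∑ a, ∑ c, X a * Y c * Z a c a c := by
  refine Finset.sum_congr rfl fun a _ => ?_
  rw [Finset.sum_comm]
  refine Finset.sum_congr rfl fun c _ => ?_
  have h1 : ∀ b, ∑ e, (kron a b * X a) * (kron c e * Y c) * Z a c b e =
      kron a b * (X a * Y c * Z a c b c) := fun b => by
    rw [show ∑ e, (kron a b * X a) * (kron c e * Y c) * Z a c b e =
        ∑ e, kron c e * (kron a b * X a * Y c * Z a c b e) from
      Finset.sum_congr rfl fun e _ => by ring, sum_kron_mul']
    ring
  simp only [h1, sum_kron_mul' (fun b => X a * Y c * Z a c b c) a]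

section

variable {f : ℝ → ℝ} {I : Set ℝ} {R₀ : ℝ} {h : Coord → Matrix (Fin 4) (Fin 4) ℝ}

theorem raise_weylTensor_kundt (D : KundtData f I R₀) (J : Fin 4 → Fin 4) {x : Coord}
    (hx : x ∈ kundtChart f I) : raise (kundtMetric f R₀) (weylTensor (kundtMetric f R₀)) J x =
      weylFactor f R₀ (x 1) * raiseDiag (kundtInv f R₀) (weylUnit f R₀) J x := by
  rw [raise_of_diagonal (isDiagonalInverse_kundt D) _ _ hx, weylTensor_kundt D hx, raiseDiag]
  ring

theorem raise_weylTensor_kundt' (D : KundtData f I R₀) (a b c e : Fin 4) {x : Coord}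
    (hx : x ∈ kundtChart f I) :
    raise (kundtMetric f R₀) (weylTensor (kundtMetric f R₀)) ![a, b, c, e] x =
      weylFactor f R₀ (x 1) * diagRiem weylPattern (fun a => kundtInv f R₀ a x) a b c e := by
  rw [raise_weylTensor_kundt D _ hx, raiseDiag_weylUnit D hx]
  rfl

/-- The lowered components contain `h^a_a + h^b_b` once with a positive sign; raising all four
indices subtracts it twice, which reverses the sign of the `hDiag` term. -/
theorem variation_raise_weyl (D : KundtData f I R₀)
    (H : IsVariation (kundtChart f I) (kundtMetric f R₀) h) (a b : Fin 4) {x : Coord}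
    (hx : x ∈ kundtChart f I) :
    variation (kundtMetric f R₀) h (fun g => raise g (weylTensor g) ![a, b, a, b]) x =
      kundtInv f R₀ a x * kundtInv f R₀ b x * (weylSecVar f R₀ h a b x - (1 - kron a b) *
        ((hDiag f R₀ h a x + hDiag f R₀ h b x) * (weylFactor f R₀ (x 1) * weylPattern a b))) := by
  rw [variation_raise_of_diagonal H (isDiagonalInverse_kundt D) (smoothFunctional_weylTensor H)
    _ hx, Fin.prod_univ_four]
  have e : variation (kundtMetric f R₀) h (fun g => weylTensor g ![a, b, a, b]) x =
    variation (kundtMetric f R₀) h (fun g => weyl g a b a b) x := rfl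
  have e1 := kundtInv_mul_variation_weyl D H a b hx
  simp only [weylTensor_kundt D hx, mul_left_comm _ (weylFactor f R₀ (x 1)), ← Finset.mul_sum]
  rw [sum_update_weylUnit (fun i m => h x i m * kundtInv f R₀ m x) a b a b x rfl rfl rfl rfl, e]
  simp only [Matrix.cons_val]
  rcases eq_or_ne a b with rfl | hab
  · simp only [kron_self] at e1 ⊢
    linear_combination kundtInv f R₀ a x * kundtInv f R₀ a x * e1
  · simp only [kron_self, kron_of_ne hab, kron_of_ne hab.symm, hDiag] at e1 ⊢
    linear_combination kundtInv f R₀ a x * kundtInv f R₀ b x * e1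
      - 2 * weylFactor f R₀ (x 1) * weylPattern a b * kundtInv f R₀ a x * kundtInv f R₀ b x *
        (h x a a * kundtInv f R₀ a x + h x b b * kundtInv f R₀ b x) *
        (kundtDiag f R₀ b x * kundtInv f R₀ b x * kundtDiag_mul_kundtInv D hx a
          + kundtDiag_mul_kundtInv D hx b)

theorem variation_raise_weyl_swap (D : KundtData f I R₀)
    (H : IsVariation (kundtChart f I) (kundtMetric f R₀) h) (a b : Fin 4) {x : Coord}
    (hx : x ∈ kundtChart f I) :
    variation (kundtMetric f R₀) h (fun g => raise g (weylTensor g) ![a, b, b, a]) x =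
      -variation (kundtMetric f R₀) h (fun g => raise g (weylTensor g) ![a, b, a, b]) x := by
  rw [variation_raise_of_diagonal H (isDiagonalInverse_kundt D) (smoothFunctional_weylTensor H)
    _ hx, variation_raise_of_diagonal H (isDiagonalInverse_kundt D) (smoothFunctional_weylTensor H)
    _ hx, Fin.prod_univ_four, Fin.prod_univ_four]
  have e : variation (kundtMetric f R₀) h (fun g => weylTensor g ![a, b, b, a]) x =
    -variation (kundtMetric f R₀) h (fun g => weylTensor g ![a, b, a, b]) x :=
    variation_weyl_swap _ a b a b x
  simp only [weylTensor_kundt D hx, mul_left_comm _ (weylFactor f R₀ (x 1)), ← Finset.mul_sum]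
  rw [sum_update_weylUnit (fun i m => h x i m * kundtInv f R₀ m x) a b b a x rfl rfl rfl rfl,
    sum_update_weylUnit (fun i m => h x i m * kundtInv f R₀ m x) a b a b x rfl rfl rfl rfl, e]
  simp only [Matrix.cons_val]
  rcases eq_or_ne a b with rfl | hab
  · ring
  · simp only [kron_self, kron_of_ne hab, kron_of_ne hab.symm]
    ring

/-- The contraction with `δC` enters twice and contributes `12 w²` times the trace of `h`. The
raised indices, by the trace property, take the same amount away. -/
theorem variation_invCC (D : KundtData f I R₀)
    (H : IsVariation (kundtChart f I) (kundtMetric f R₀) h) {x : Coord}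
    (hx : x ∈ kundtChart f I) :
    variation (kundtMetric f R₀) h invCC x =
      4 * weylFactor f R₀ (x 1) * weylVar f R₀ h x := by
  have hC := smoothFunctional_weylTensor H
  have h1 : HasDerivAt (fun ε : ℝ => invCC (perturb (kundtMetric f R₀) h ε) x) _ 0 :=
    HasDerivAt.fun_sum fun (J : Fin 4 → Fin 4) (_ : J ∈ Finset.univ) =>
      ((hC J).hasDerivAt H hx).mul ((smoothFunctional_raise H hC J).hasDerivAt H hx)
  rw [variation, h1.deriv]
  simp only [perturb_zero, raise_weylTensor_kundt D _ hx, weylTensor_kundt D hx,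
    variation_raise_of_diagonal H (isDiagonalInverse_kundt D) hC _ hx]
  have h2 : ∀ J : Fin 4 → Fin 4, variation (kundtMetric f R₀) h (fun g => weylTensor g J) x *
        (weylFactor f R₀ (x 1) * raiseDiag (kundtInv f R₀) (weylUnit f R₀) J x) +
      weylFactor f R₀ (x 1) * weylUnit f R₀ J x * ((∏ j, kundtInv f R₀ (J j) x) *
        (variation (kundtMetric f R₀) h (fun g => weylTensor g J) x -
          ∑ j, ∑ m, h x (J j) m * kundtInv f R₀ m x *
            (weylFactor f R₀ (x 1) * weylUnit f R₀ (Function.update J j m) x))) =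
      2 * weylFactor f R₀ (x 1) * (raiseDiag (kundtInv f R₀) (weylUnit f R₀) J x *
        variation (kundtMetric f R₀) h (fun g => weylTensor g J) x) -
      weylFactor f R₀ (x 1) ^ 2 * (raiseDiag (kundtInv f R₀) (weylUnit f R₀) J x *
        ∑ j, ∑ m, h x (J j) m * kundtInv f R₀ m x * weylUnit f R₀ (Function.update J j m) x) :=
    fun J => by
      simp only [mul_left_comm _ (weylFactor f R₀ (x 1)), ← Finset.mul_sum, raiseDiag]
      ring
  simp only [h2, Finset.sum_sub_distrib]
  rw [← Finset.mul_sum, ← Finset.mul_sum, sum_weylUnit_mul_variation D H hx,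
    hasTraceProperty_weylUnit D x hx (fun a m => h x a m * kundtInv f R₀ m x)]
  simp only [hDiag]
  ring

/-- Write `s` for the block signs and `p` for the Weyl pattern. The sum of `p_ac s_c` over `c ≠ a`
is `2 s_a`, which gives the coefficient of `splitVar` from the two factors `S`. For the variation of
`C`, `s_a s_c = (4 p_ac - 1)/3`; tracelessness removes the constant and leaves `4/3` of `weylVar`.
-/
theorem variation_invSSC (D : KundtData f I R₀)
    (H : IsVariation (kundtChart f I) (kundtMetric f R₀) h) {x : Coord}
    (hx : x ∈ kundtChart f I) :
    variation (kundtMetric f R₀) h invSSC x =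
      4 * ricciSplit f R₀ (x 1) * weylFactor f R₀ (x 1) * splitVar f R₀ h x
      + 4 / 3 * ricciSplit f R₀ (x 1) ^ 2 * weylVar f R₀ h x := by
  have hC := smoothFunctional_weylTensor H
  have hS := smoothFunctional_tracelessRicci H
  have h1 : HasDerivAt (fun ε : ℝ => invSSC (perturb (kundtMetric f R₀) h ε) x) _ 0 :=
    HasDerivAt.fun_sum fun (a : Fin 4) (_ : a ∈ Finset.univ) =>
    HasDerivAt.fun_sum fun (b : Fin 4) (_ : b ∈ Finset.univ) =>
    HasDerivAt.fun_sum fun (c : Fin 4) (_ : c ∈ Finset.univ) =>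
    HasDerivAt.fun_sum fun (e : Fin 4) (_ : e ∈ Finset.univ) =>
      (((hS a b).hasDerivAt H hx).fun_mul ((hS c e).hasDerivAt H hx)).fun_mul
        ((smoothFunctional_raise H hC ![a, c, b, e]).hasDerivAt H hx)
  rw [variation, h1.deriv]
  simp only [perturb_zero, raise_weylTensor_kundt' D _ _ _ _ hx, tracelessRicci_kundt D hx]
  set w := weylFactor f R₀ (x 1) with hw
  set V : Fin 4 → Fin 4 → ℝ := fun a b =>
    variation (kundtMetric f R₀) h (fun g => tracelessRicci g a b) x with hV
  set Z : Fin 4 → Fin 4 → Fin 4 → Fin 4 → ℝ := fun a b c e =>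
    variation (kundtMetric f R₀) h (fun g => raise g (weylTensor g) ![a, b, c, e]) x with hZ
  set X : Fin 4 → ℝ := fun a =>
    kundtDiag f R₀ a x * (ricciSplit f R₀ (x 1) * blockSign a) with hX
  set Q : Fin 4 → Fin 4 → Fin 4 → Fin 4 → ℝ :=
    diagRiem weylPattern (fun a => kundtInv f R₀ a x) with hQ
  have h2 : ∀ a b c e, (V a b * (kron c e * kundtDiag f R₀ c x *
        (ricciSplit f R₀ (x 1) * blockSign c)) + kron a b * kundtDiag f R₀ a x *
        (ricciSplit f R₀ (x 1) * blockSign a) * V c e) * (w * Q a c b e) +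
      kron a b * kundtDiag f R₀ a x * (ricciSplit f R₀ (x 1) * blockSign a) *
        (kron c e * kundtDiag f R₀ c x * (ricciSplit f R₀ (x 1) * blockSign c)) * Z a c b e =
      w * (V a b * (kron c e * X c) * Q a c b e) + w * ((kron a b * X a) * V c e * Q a c b e) +
      (kron a b * X a) * (kron c e * X c) * Z a c b e := fun a b c e => by
    simp only [hX]; ring
  have h2' := fun a b c e => h2 a b c e
  simp only [hV, hZ] at h2'
  simp only [h2', Finset.sum_add_distrib, ← Finset.mul_sum]
  rw [sum_four_kron_left V X, sum_four_kron_right weylPattern_comm V X, sum_four_kron_kron X X Z]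
  have hd := kundtDiag_mul_kundtInv D hx
  have h3 : ∀ a c, (1 - kron a c) * weylPattern a c * kundtInv f R₀ a x * kundtInv f R₀ c x *
      V a a * X c = (1 - kron a c) * weylPattern a c * (ricciSplit f R₀ (x 1) * blockSign c) *
      (∑ e, secVar f R₀ h e a x - scalarVar f R₀ h x / 4
        + hDiag f R₀ h a x * (ricciSplit f R₀ (x 1) * blockSign a)) := fun a c => by
    rw [← kundtInv_mul_variation_tracelessRicci D H a hx]
    simp only [hX, hV]
    linear_combination (1 - kron a c) * weylPattern a c * (ricciSplit f R₀ (x 1) * blockSign c) *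
      kundtInv f R₀ a x * variation (kundtMetric f R₀) h (fun g => tracelessRicci g a a) x * hd c
  have h4 : ∀ a c, X a * X c * Z a c a c = ricciSplit f R₀ (x 1) ^ 2 * blockSign a * blockSign c *
      (weylSecVar f R₀ h a c x - (1 - kron a c) *
        ((hDiag f R₀ h a x + hDiag f R₀ h c x) * (w * weylPattern a c))) := fun a c => by
    simp only [hX, hZ, variation_raise_weyl D H a c hx]
    linear_combination ricciSplit f R₀ (x 1) ^ 2 * blockSign a * blockSign c *
      (weylSecVar f R₀ h a c x - (1 - kron a c) *
        ((hDiag f R₀ h a x + hDiag f R₀ h c x) * (w * weylPattern a c))) *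
      (kundtDiag f R₀ c x * kundtInv f R₀ c x * hd a + hd c)
  simp only [h3, h4, splitVar, weylVar, weylSecVar, scalarVar]
  simp only [Fin.sum_univ_four, secVar_self]
  simp [weylPattern, blockwise, kron, blockSign]
  ring

/-- The four terms with `h` come from the two metrics that lower the last pair of indices, combined
with the two Kronecker products of the background Weyl tensor. -/
theorem variation_mixed_weyl (D : KundtData f I R₀)
    (H : IsVariation (kundtChart f I) (kundtMetric f R₀) h) (c e m n : Fin 4) {x : Coord}
    (hx : x ∈ kundtChart f I) :
    HasDerivAt (fun ε : ℝ => ∑ i, ∑ j, raise (perturb (kundtMetric f R₀) h ε)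
        (weylTensor (perturb (kundtMetric f R₀) h ε)) ![c, e, i, j] x *
        perturb (kundtMetric f R₀) h ε x i m * perturb (kundtMetric f R₀) h ε x j n)
      (variation (kundtMetric f R₀) h (fun g => raise g (weylTensor g) ![c, e, m, n]) x *
          kundtDiag f R₀ m x * kundtDiag f R₀ n x
        + weylFactor f R₀ (x 1) * weylPattern c e * kundtInv f R₀ c x * kundtInv f R₀ e x *
          (h x c m * kron e n * kundtDiag f R₀ n x - h x e m * kron c n * kundtDiag f R₀ n x
          + h x e n * kron c m * kundtDiag f R₀ m x - h x c n * kron e m * kundtDiag f R₀ m x)) 0 := by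
  have hC := smoothFunctional_weylTensor H
  have hm : ∀ i j, HasDerivAt (fun ε : ℝ => perturb (kundtMetric f R₀) h ε x i j) (h x i j) 0 :=
    fun i j => by
      have := (smoothFunctional_metric H i j).hasDerivAt H hx
      rwa [variation_metric] at this
  have h1 := HasDerivAt.fun_sum fun (i : Fin 4) (_ : i ∈ Finset.univ) =>
    HasDerivAt.fun_sum fun (j : Fin 4) (_ : j ∈ Finset.univ) =>
      (((smoothFunctional_raise H hC ![c, e, i, j]).hasDerivAt H hx).fun_mul (hm i m)).fun_mul
        (hm j n)
  refine h1.congr_deriv ?_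
  simp only [perturb_zero, raise_weylTensor_kundt' D _ _ _ _ hx, kundtMetric_apply]
  set Z : Fin 4 → Fin 4 → ℝ := fun i j =>
    variation (kundtMetric f R₀) h (fun g => raise g (weylTensor g) ![c, e, i, j]) x with hZ
  have s : ∀ i j, (Z i j * (kron i m * kundtDiag f R₀ i x) + weylFactor f R₀ (x 1) *
        diagRiem weylPattern (fun a => kundtInv f R₀ a x) c e i j * h x i m) *
        (kron j n * kundtDiag f R₀ j x) +
      weylFactor f R₀ (x 1) * diagRiem weylPattern (fun a => kundtInv f R₀ a x) c e i j *
        (kron i m * kundtDiag f R₀ i x) * h x j n =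
      kron j n * (kron i m * (Z i j * kundtDiag f R₀ i x * kundtDiag f R₀ j x)) +
      diagRiem weylPattern (fun a => kundtInv f R₀ a x) c e i j *
        (weylFactor f R₀ (x 1) * h x i m * kron j n * kundtDiag f R₀ j x +
        weylFactor f R₀ (x 1) * h x j n * kron i m * kundtDiag f R₀ i x) := fun i j => by ring
  have s2 : ∑ i, ∑ j, kron j n * (kron i m * (Z i j * kundtDiag f R₀ i x * kundtDiag f R₀ j x)) =
      Z m n * kundtDiag f R₀ m x * kundtDiag f R₀ n x := by
    have s3 : ∀ i, ∑ j, kron j n * (kron i m * (Z i j * kundtDiag f R₀ i x * kundtDiag f R₀ j x)) =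
        kron i m * (Z i n * kundtDiag f R₀ i x * kundtDiag f R₀ n x) := fun i =>
      sum_kron_mul (fun j => kron i m * (Z i j * kundtDiag f R₀ i x * kundtDiag f R₀ j x)) n
    rw [Finset.sum_congr rfl fun i _ => s3 i,
      sum_kron_mul (fun i => Z i n * kundtDiag f R₀ i x * kundtDiag f R₀ n x)]
  have hk : ∀ a b, kron a b * kundtDiag f R₀ a x = kron a b * kundtDiag f R₀ b x := fun a b => by
    rcases eq_or_ne a b with rfl | hab
    · rfl
    · simp [kron_of_ne hab]
  rw [Finset.sum_congr rfl fun i _ => Finset.sum_congr rfl fun j _ => s i j]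
  simp only [Finset.sum_add_distrib]
  rw [s2, sum_diagRiem_mul_pair]
  linear_combination weylFactor f R₀ (x 1) * weylPattern c e * kundtInv f R₀ c x *
    kundtInv f R₀ e x * (h x c m * hk e n - h x e m * hk c n + h x e n * hk c m - h x c n * hk e m)

end

end

end SixDerivativeGravity


/-! ### First variation of the cubic Weyl invariant -/

namespace SixDerivativeGravity

open MeasureTheory Filter Topology

noncomputable section

section

variable {f : ℝ → ℝ} {I : Set ℝ} {R₀ : ℝ} {h : Coord → Matrix (Fin 4) (Fin 4) ℝ}

theorem diagRiem_swap_left (κ : Fin 4 → Fin 4 → ℝ) (hκ : ∀ a b, κ a b = κ b a) (d : Fin 4 → ℝ)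
    (a b c e : Fin 4) : diagRiem κ d b a c e = -diagRiem κ d a b c e := by
  simp only [diagRiem, hκ b a]
  ring

/-- The contraction of three tensors of Riemann type, two of them of diagonal form. -/
theorem sum_six_first {p : Fin 4 → Fin 4 → ℝ} (hp : ∀ a b, p a b = p b a) (q : Fin 4 → ℝ)
    (V : Fin 4 → Fin 4 → Fin 4 → Fin 4 → ℝ) :
    ∑ a, ∑ b, ∑ c, ∑ e, ∑ m, ∑ n, V a b c e * diagRiem p q a b m n *
        diagRiem p (fun _ => 1) c e m n =
      ∑ a, ∑ b, 2 * p a b ^ 2 * q a * q b * (V a b a b - V a b b a) := by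
  refine Finset.sum_congr rfl fun a _ => Finset.sum_congr rfl fun b _ => ?_
  have h1 : ∀ c e, ∑ m, ∑ n, V a b c e * diagRiem p q a b m n * diagRiem p (fun _ => 1) c e m n =
      diagRiem (fun a b => p a b ^ 2) q a b c e * (2 * V a b c e) := fun c e => by
    rw [← mul_diagRiem_one hp]
    have := sum_diagRiem_mul_pair p q (fun m n => V a b c e * diagRiem p (fun _ => 1) c e m n) a b
    simp only [← mul_assoc, mul_comm _ (V a b c e)] at this ⊢
    rw [this, diagRiem_swap]
    ring
  rw [Finset.sum_congr rfl fun c _ => Finset.sum_congr rfl fun e _ => h1 c e,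
    sum_diagRiem_mul_pair]
  ring

/-- This and `sum_six_third` treat the second and third factor of `C C C` as the varied one. With
constant diagonal `1` the tensor `diagRiem` represents the mixed components, and two background
factors always combine to the pattern `p²`. -/
theorem sum_six_second {p : Fin 4 → Fin 4 → ℝ} (hp : ∀ a b, p a b = p b a) (d : Fin 4 → ℝ)
    (V : Fin 4 → Fin 4 → Fin 4 → Fin 4 → ℝ) :
    ∑ a, ∑ b, ∑ c, ∑ e, ∑ m, ∑ n, diagRiem p d a b c e * V a b m n *
        diagRiem p (fun _ => 1) c e m n =
      ∑ a, ∑ b, 2 * p a b ^ 2 * d a * d b * (V a b a b - V a b b a) := by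
  rw [← sum_six_first hp d V]
  refine Finset.sum_congr rfl fun a _ => Finset.sum_congr rfl fun b _ => ?_
  rw [sum_swap_pairs]
  refine Finset.sum_congr rfl fun c _ => Finset.sum_congr rfl fun e _ =>
    Finset.sum_congr rfl fun m _ => Finset.sum_congr rfl fun n _ => ?_
  rw [diagRiem_pair_comm hp _ m n c e]
  ring

theorem sum_six_third {p : Fin 4 → Fin 4 → ℝ} (hp : ∀ a b, p a b = p b a) {d q : Fin 4 → ℝ}
    (hd : ∀ a, d a * q a = 1) (V : Fin 4 → Fin 4 → Fin 4 → Fin 4 → ℝ) :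
    ∑ a, ∑ b, ∑ c, ∑ e, ∑ m, ∑ n, diagRiem p d a b c e * diagRiem p q a b m n * V c e m n =
      ∑ a, ∑ b, 2 * p a b ^ 2 * (V a b a b - V a b b a) := by
  rw [sum_swap_pairs]
  refine Finset.sum_congr rfl fun c _ => Finset.sum_congr rfl fun e _ => ?_
  rw [sum_swap_pairs]
  have h1 : ∀ m n, ∑ a, ∑ b, diagRiem p d a b c e * diagRiem p q a b m n * V c e m n =
      diagRiem p q c e m n * (2 * p c e * d c * d e * V c e m n) := fun m n => by
    have := sum_diagRiem_mul_pair p d (fun a b => diagRiem p q a b m n * V c e m n) c e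
    simp only [diagRiem_pair_comm hp d _ _ c e, mul_assoc] at this ⊢
    rw [this, diagRiem_swap_left p hp]
    ring
  rw [Finset.sum_congr rfl fun m _ => Finset.sum_congr rfl fun n _ => h1 m n,
    sum_diagRiem_mul_pair]
  linear_combination 2 * p c e ^ 2 * (V c e c e - V c e e c) *
    (d e * q e * hd c + hd e)

theorem mixed_weyl_kundt (D : KundtData f I R₀) (c e m n : Fin 4) {x : Coord}
    (hx : x ∈ kundtChart f I) :
    ∑ i, ∑ j, raise (kundtMetric f R₀) (weylTensor (kundtMetric f R₀)) ![c, e, i, j] x *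
        kundtMetric f R₀ x i m * kundtMetric f R₀ x j n =
      weylFactor f R₀ (x 1) * diagRiem weylPattern (fun _ => 1) c e m n := by
  simp only [raise_weylTensor_kundt' D _ _ _ _ hx, kundtMetric_apply]
  have h1 : ∀ i j, weylFactor f R₀ (x 1) *
      diagRiem weylPattern (fun a => kundtInv f R₀ a x) c e i j *
      (kron i m * kundtDiag f R₀ i x) * (kron j n * kundtDiag f R₀ j x) =
      diagRiem weylPattern (fun a => kundtInv f R₀ a x) c e i j * (weylFactor f R₀ (x 1) *
        (kron i m * kundtDiag f R₀ i x) * (kron j n * kundtDiag f R₀ j x)) := fun i j => by ring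
  rw [Finset.sum_congr rfl fun i _ => Finset.sum_congr rfl fun j _ => h1 i j,
    sum_diagRiem_mul_pair]
  simp only [diagRiem]
  linear_combination weylFactor f R₀ (x 1) * weylPattern c e *
    (kron c m * kron e n - kron c n * kron e m) *
    (kundtDiag f R₀ e x * kundtInv f R₀ e x * kundtDiag_mul_kundtInv D hx c
      + kundtDiag_mul_kundtInv D hx e)

/-- The invariant is a cubic trace of the Weyl tensor acting on pairs of indices, so it varies by
three times the square of the background contracted with the mixed `δC`. The terms with `h` produced
by raising and lowering cancel among the three factors. -/
theorem variation_invCCC (D : KundtData f I R₀)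
    (H : IsVariation (kundtChart f I) (kundtMetric f R₀) h) {x : Coord}
    (hx : x ∈ kundtChart f I) :
    variation (kundtMetric f R₀) h invCCC x =
      6 * weylFactor f R₀ (x 1) ^ 2 * weylVar f R₀ h x := by
  have hC := smoothFunctional_weylTensor H
  have hd := kundtDiag_mul_kundtInv D hx
  set VC : Fin 4 → Fin 4 → Fin 4 → Fin 4 → ℝ := fun a b c e =>
    variation (kundtMetric f R₀) h (fun g => weyl g a b c e) x with hVC
  set Z : Fin 4 → Fin 4 → Fin 4 → Fin 4 → ℝ := fun a b c e =>
    variation (kundtMetric f R₀) h (fun g => raise g (weylTensor g) ![a, b, c, e]) x with hZ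
  set M : Fin 4 → Fin 4 → Fin 4 → Fin 4 → ℝ := fun c e m n =>
    Z c e m n * kundtDiag f R₀ m x * kundtDiag f R₀ n x
        + weylFactor f R₀ (x 1) * weylPattern c e * kundtInv f R₀ c x * kundtInv f R₀ e x *
          (h x c m * kron e n * kundtDiag f R₀ n x - h x e m * kron c n * kundtDiag f R₀ n x
          + h x e n * kron c m * kundtDiag f R₀ m x - h x c n * kron e m * kundtDiag f R₀ m x)
    with hM
  have h1 : HasDerivAt (fun ε : ℝ => invCCC (perturb (kundtMetric f R₀) h ε) x) _ 0 :=
    HasDerivAt.fun_sum fun (a : Fin 4) (_ : a ∈ Finset.univ) =>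
    HasDerivAt.fun_sum fun (b : Fin 4) (_ : b ∈ Finset.univ) =>
    HasDerivAt.fun_sum fun (c : Fin 4) (_ : c ∈ Finset.univ) =>
    HasDerivAt.fun_sum fun (e : Fin 4) (_ : e ∈ Finset.univ) =>
    HasDerivAt.fun_sum fun (m : Fin 4) (_ : m ∈ Finset.univ) =>
    HasDerivAt.fun_sum fun (n : Fin 4) (_ : n ∈ Finset.univ) =>
      (((hC ![a, b, c, e]).hasDerivAt H hx).fun_mul
        ((smoothFunctional_raise H hC ![a, b, m, n]).hasDerivAt H hx)).fun_mul
        (variation_mixed_weyl D H c e m n hx)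
  rw [variation, h1.deriv]
  simp only [perturb_zero]
  simp only [mixed_weyl_kundt D _ _ _ _ hx]
  simp only [raise_weylTensor_kundt' D _ _ _ _ hx, weylTensor_kundt D hx]
  set w := weylFactor f R₀ (x 1) with hw
  have h2 : ∀ a b c e m n, (variation (kundtMetric f R₀) h (fun g => weylTensor g ![a, b, c, e]) x *
        (w * diagRiem weylPattern (fun a => kundtInv f R₀ a x) a b m n) +
      w * weylUnit f R₀ ![a, b, c, e] x * variation (kundtMetric f R₀) h
        (fun g => raise g (weylTensor g) ![a, b, m, n]) x) *
        (w * diagRiem weylPattern (fun _ => 1) c e m n) +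
      w * weylUnit f R₀ ![a, b, c, e] x *
        (w * diagRiem weylPattern (fun a => kundtInv f R₀ a x) a b m n) * M c e m n =
      w ^ 2 * (VC a b c e * diagRiem weylPattern (fun a => kundtInv f R₀ a x) a b m n *
        diagRiem weylPattern (fun _ => 1) c e m n) +
      w ^ 2 * (diagRiem weylPattern (fun a => kundtDiag f R₀ a x) a b c e * Z a b m n *
        diagRiem weylPattern (fun _ => 1) c e m n) +
      w ^ 2 * (diagRiem weylPattern (fun a => kundtDiag f R₀ a x) a b c e *
        diagRiem weylPattern (fun a => kundtInv f R₀ a x) a b m n * M c e m n) :=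
    fun a b c e m n => by
      have e1 : weylUnit f R₀ ![a, b, c, e] x =
        diagRiem weylPattern (fun a => kundtDiag f R₀ a x) a b c e := rfl
      have e2 : variation (kundtMetric f R₀) h (fun g => weylTensor g ![a, b, c, e]) x =
        VC a b c e := rfl
      rw [e1, e2]
      ring
  rw [Finset.sum_congr rfl fun a _ => Finset.sum_congr rfl fun b _ => Finset.sum_congr rfl
    fun c _ => Finset.sum_congr rfl fun e _ => Finset.sum_congr rfl fun m _ =>
    Finset.sum_congr rfl fun n _ => h2 a b c e m n]
  simp only [Finset.sum_add_distrib, ← Finset.mul_sum]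
  rw [sum_six_first weylPattern_comm, sum_six_second weylPattern_comm,
    sum_six_third weylPattern_comm hd]
  have h3 : ∀ a b, VC a b b a = -VC a b a b := fun a b => variation_weyl_swap _ a b a b x
  have h4 : ∀ a b, Z a b b a = -Z a b a b := fun a b => variation_raise_weyl_swap D H a b hx
  have h5 : ∀ a b, M a b a b - M a b b a = 2 * (weylSecVar f R₀ h a b x) := fun a b => by
    have e : Z a b a b = _ := variation_raise_weyl D H a b hx
    simp only [hM, h4 a b, e, hDiag]
    rcases eq_or_ne a b with rfl | hab
    · have : weylSecVar f R₀ h a a x = 0 := by simp [weylSecVar, kron_self]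
      simp only [kron_self, this]
      ring
    · simp only [kron_self, kron_of_ne hab, kron_of_ne hab.symm]
      linear_combination 2 * weylSecVar f R₀ h a b x *
        (kundtDiag f R₀ b x * kundtInv f R₀ b x * hd a + hd b)
        - 2 * w * weylPattern a b * (h x a a * kundtInv f R₀ a x + h x b b * kundtInv f R₀ b x) *
        (kundtDiag f R₀ b x * kundtInv f R₀ b x * hd a + hd b)
        + 2 * w * weylPattern a b * (h x a a * kundtInv f R₀ a x * hd b
          + h x b b * kundtInv f R₀ b x * hd a)
  have h6 : ∀ a b, 2 * weylPattern a b ^ 2 * kundtInv f R₀ a x * kundtInv f R₀ b x *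
      (VC a b a b - VC a b b a) = 4 * weylPattern a b ^ 2 *
        (weylSecVar f R₀ h a b x + (1 - kron a b) * ((hDiag f R₀ h a x + hDiag f R₀ h b x) *
        (weylFactor f R₀ (x 1) * weylPattern a b))) := fun a b => by
    rw [h3, ← kundtInv_mul_variation_weyl D H a b hx]
    ring
  have h7 : ∀ a b, 2 * weylPattern a b ^ 2 * kundtDiag f R₀ a x * kundtDiag f R₀ b x *
      (Z a b a b - Z a b b a) = 4 * weylPattern a b ^ 2 *
        (weylSecVar f R₀ h a b x - (1 - kron a b) * ((hDiag f R₀ h a x + hDiag f R₀ h b x) *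
        (weylFactor f R₀ (x 1) * weylPattern a b))) := fun a b => by
    have e : Z a b a b = _ := variation_raise_weyl D H a b hx
    rw [h4, e]
    linear_combination 4 * weylPattern a b ^ 2 *
      (weylSecVar f R₀ h a b x - (1 - kron a b) * ((hDiag f R₀ h a x + hDiag f R₀ h b x) *
        (weylFactor f R₀ (x 1) * weylPattern a b))) *
      (kundtDiag f R₀ b x * kundtInv f R₀ b x * hd a + hd b)
  simp only [h5, h6, h7]
  -- On the values `1` and `-1/2` of the pattern, `p² = (p + 1)/2`. The constant part contracts to
  -- zero because the varied mixed Weyl tensor is traceless.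
  have h8 : ∑ a, ∑ b, weylPattern a b ^ 2 * weylSecVar f R₀ h a b x = weylVar f R₀ h x / 2 := by
    simp only [weylVar, weylSecVar, scalarVar, Fin.sum_univ_four, secVar_self]
    simp [weylPattern, blockwise, kron]
    ring
  have h9 : weylVar f R₀ h x = 2 * ∑ a, ∑ b, weylPattern a b ^ 2 * weylSecVar f R₀ h a b x := by
    rw [h8]; ring
  rw [h9]
  simp only [Finset.mul_sum, ← Finset.sum_add_distrib]
  exact Finset.sum_congr rfl fun a _ => Finset.sum_congr rfl fun b _ => by ring

/-! ### The first variation of the volume element -/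

theorem neg_det_kundtMetric {x : Coord} (hx : x ∈ kundtChart f I) :
    -(kundtMetric f R₀ x).det = (R₀ ^ 2 * Real.sin (x 2)) ^ 2 := by
  have hf : f (x 1) ≠ 0 := hx.2.1
  rw [kundtMetric, Matrix.det_diagonal, Fin.prod_univ_four]
  simp
  field_simp

/-- Factoring out the background gives `det (g + ε h) = det g · det (1 + ε g⁻¹h)`, and the second
determinant is `1 + ε tr (g⁻¹h) + O(ε²)`; the square root halves the trace. -/
theorem variation_sqrt_det (D : KundtData f I R₀) {x : Coord}
    (hx : x ∈ kundtChart f I) :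
    variation (kundtMetric f R₀) h (fun g x => √(-(g x).det)) x =
      R₀ ^ 2 * Real.sin (x 2) * (∑ a, hDiag f R₀ h a x) / 2 := by
  set N : Matrix (Fin 4) (Fin 4) ℝ := Matrix.diagonal (fun a => kundtInv f R₀ a x) * h x with hN
  have hg : kundtMetric f R₀ x = Matrix.diagonal fun a => kundtDiag f R₀ a x := rfl
  have h1 : ∀ ε : ℝ, perturb (kundtMetric f R₀) h ε x = kundtMetric f R₀ x * (1 + ε • N) :=
    fun ε => by
      have : kundtMetric f R₀ x * N = h x := by
        rw [hN, ← Matrix.mul_assoc, hg, Matrix.diagonal_mul_diagonal]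
        simp only [kundtDiag_mul_kundtInv D hx, Matrix.diagonal_one, Matrix.one_mul]
      rw [mul_add, mul_one, Matrix.mul_smul, this, perturb]
  have hs := sin_pos_of_mem_kundtChart hx
  have hR := D.pos
  have hdet := neg_det_kundtMetric (f := f) (R₀ := R₀) hx
  have h2 : HasDerivAt (fun ε : ℝ => (1 + ε • N).det) (∑ a, hDiag f R₀ h a x) 0 := by
    have e1 : (fun ε : ℝ => (1 + ε • N).det) = fun ε => 1 + N.trace * ε +
        (Polynomial.divX (Polynomial.divX (1 + (Polynomial.X : Polynomial ℝ) •
          N.map Polynomial.C).det)).eval ε * ε ^ 2 := funext fun ε => Matrix.det_one_add_smul ε N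
    rw [e1]
    have h3 := (((hasDerivAt_id (0 : ℝ)).const_mul N.trace).const_add 1).add
      ((Polynomial.hasDerivAt (Polynomial.divX (Polynomial.divX (1 + (Polynomial.X : Polynomial ℝ) •
          N.map Polynomial.C).det)) 0).mul ((hasDerivAt_id (0 : ℝ)).pow 2))
    refine h3.congr_deriv ?_
    simp [Matrix.trace, hN, hDiag, mul_comm]
  have h4 := (h2.const_mul ((R₀ ^ 2 * Real.sin (x 2)) ^ 2)).sqrt (by simpa using ⟨hR.ne', hs.ne'⟩)
  have h5 : (fun ε : ℝ => √(-(perturb (kundtMetric f R₀) h ε x).det)) =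
      fun ε : ℝ => √((R₀ ^ 2 * Real.sin (x 2)) ^ 2 * (1 + ε • N).det) := by
    simp only [h1, Matrix.det_mul, ← neg_mul, hdet]
  rw [variation, h5, h4.deriv]
  simp only [zero_smul, add_zero, Matrix.det_one, mul_one]
  rw [Real.sqrt_sq (by positivity)]
  field_simp

end

end

end SixDerivativeGravity


namespace SixDerivativeGravity

open MeasureTheory Filter Topology

noncomputable section

/-! ### The first variation of the invariants with derivatives of the curvature -/

/-- The d'Alembertian of a function of `r`. -/
def radialBox (f φ : ℝ → ℝ) (r : ℝ) : ℝ := f r * deriv (deriv φ) r + deriv f r * deriv φ r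

/-- The contraction of `K` with the first variation of `T`. -/
def contractVar (q : Fin 4 → Coord → ℝ) {k : ℕ} (K : TensorField k) (T : Metric → TensorField k)
    (g : Metric) (h : Coord → Matrix (Fin 4) (Fin 4) ℝ) (x : Coord) : ℝ :=
  ∑ J, raiseDiag q K J x * variation g h (fun g => T g J) x

/-- The divergence of the vector field `w Γ̇^a_{ea}`, with an additional derivative of `w`. -/
def traceDiv (g : Metric) (q : Fin 4 → Coord → ℝ) (h : Coord → Matrix (Fin 4) (Fin 4) ℝ)
    (w : Coord → ℝ) (x : Coord) : ℝ :=
  ∑ e, q e x * (pd e (fun y => w y * traceGamma g h e y) x -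
    ∑ m, christoffel g m e e x * (w x * traceGamma g h m x) + pd e w x * traceGamma g h e x)

/-- The first variation of the d'Alembertian of the function `φ` of `r`, up to the sign. -/
def boxVar (f : ℝ → ℝ) (R₀ : ℝ) (h : Coord → Matrix (Fin 4) (Fin 4) ℝ) (φ : ℝ → ℝ)
    (x : Coord) : ℝ :=
  deriv φ (x 1) * ∑ e, kundtInv f R₀ e x *
      variation (kundtMetric f R₀) h (fun g => christoffel g 1 e e) x
    + hDiag f R₀ h 0 x * (deriv f (x 1) * deriv φ (x 1) / 2)
    + hDiag f R₀ h 1 x *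
      (f (x 1) * deriv (deriv φ) (x 1) + deriv f (x 1) * deriv φ (x 1) / 2)

section

variable {f : ℝ → ℝ} {I : Set ℝ} {R₀ : ℝ} {h : Coord → Matrix (Fin 4) (Fin 4) ℝ}

theorem KundtData.smooth_curvU (D : KundtData f I R₀) : ContDiffOn ℝ ∞ (curvU f) I :=
  D.smooth_deriv_deriv.neg.div_const 2

theorem KundtData.smooth_weylFactor (D : KundtData f I R₀) :
    ContDiffOn ℝ ∞ (weylFactor f R₀) I :=
  (D.smooth_curvU.add contDiffOn_const).div_const 3

theorem KundtData.contDiffOn_deriv (D : KundtData f I R₀) {φ : ℝ → ℝ} (hφ : ContDiffOn ℝ ∞ φ I) :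
    ContDiffOn ℝ ∞ (deriv φ) I := hφ.deriv_of_isOpen D.isOpen (by simp)

theorem pd_radius (D : KundtData f I R₀) {φ : ℝ → ℝ} (hφ : ContDiffOn ℝ ∞ φ I) (i : Fin 4)
    {x : Coord} (hx : x ∈ kundtChart f I) :
    pd i (fun y => φ (y 1)) x = if i = 1 then deriv φ (x 1) else 0 :=
  pd_comp_radius (D.hasDerivAt hφ hx.1) i

theorem hessian_radius (D : KundtData f I R₀) {φ : ℝ → ℝ} (hφ : ContDiffOn ℝ ∞ φ I) (e b : Fin 4)
    {x : Coord} (hx : x ∈ kundtChart f I) :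
    hessian (kundtMetric f R₀) e b (fun y => φ (y 1)) x =
      (if e = 1 ∧ b = 1 then deriv (deriv φ) (x 1) else 0)
        - kundtGamma f 1 e b x * deriv φ (x 1) := by
  have h1 : pd e (pd b fun y => φ (y 1)) x =
      if e = 1 ∧ b = 1 then deriv (deriv φ) (x 1) else 0 := by
    rw [pd_congr_of_isOpen D.isOpen_chart (fun y hy => pd_radius D hφ b hy) e hx]
    by_cases hb : b = 1
    · simp only [hb, if_true, and_true]
      exact pd_radius D (D.contDiffOn_deriv hφ) e hx
    · simp [hb, pd_const]
  rw [hessian, h1]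
  simp [pd_radius D hφ _ hx, christoffel_kundt D hx]

theorem laplacian_radius (D : KundtData f I R₀) {φ : ℝ → ℝ} (hφ : ContDiffOn ℝ ∞ φ I)
    {x : Coord} (hx : x ∈ kundtChart f I) :
    laplacian (kundtMetric f R₀) (kundtInv f R₀) (fun y => φ (y 1)) x =
      radialBox f φ (x 1) := by
  have h1 := hx.2.1
  simp only [laplacian, hessian_radius D hφ _ _ hx, Fin.sum_univ_four, radialBox]
  simp [kundtInv, kundtGamma]
  field_simp
  ring

/-- The Hessian of a function of `r` is diagonal, because `Γ^r_{eb}` is; hence only diagonal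
components of `h` enter explicitly. -/
theorem sum_hessian_radius (D : KundtData f I R₀)
    (H : IsVariation (kundtChart f I) (kundtMetric f R₀) h) {φ : ℝ → ℝ} (hφ : ContDiffOn ℝ ∞ φ I)
    {x : Coord} (hx : x ∈ kundtChart f I) :
    ∑ e, kundtInv f R₀ e x * ∑ m, variation (kundtMetric f R₀) h
        (fun g => christoffel g m e e) x * pd m (fun y => φ (y 1)) x
      + ∑ e, ∑ b, kundtInv f R₀ e x * h x e b * kundtInv f R₀ b x *
        hessian (kundtMetric f R₀) e b (fun y => φ (y 1)) x = boxVar f R₀ h φ x := by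
  have h1 := hx.2.1
  simp only [hessian_radius D hφ _ _ hx, pd_radius D hφ _ hx, boxVar, mul_ite, mul_zero,
    Finset.sum_ite_eq', Finset.mem_univ, if_true, Finset.mul_sum]
  rw [add_assoc]
  congr 1
  · exact Finset.sum_congr rfl fun e _ => by ring
  · simp only [Fin.sum_univ_four]
    simp [kundtInv, kundtGamma, hDiag, H.symm_h x 1 0]
    field_simp

/-- An instance of `variation_contractBox` with `K = weylUnit`, for which the trace constant `c` and
the norm `N` are both `12`. -/
theorem variation_invCBoxC (D : KundtData f I R₀)
    (H : IsVariation (kundtChart f I) (kundtMetric f R₀) h) {x : Coord}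
    (hx : x ∈ kundtChart f I) :
    variation (kundtMetric f R₀) h invCBoxC x =
      radialBox f (weylFactor f R₀) (x 1) * (2 * weylVar f R₀ h x
        - 6 * weylFactor f R₀ (x 1) * ∑ a, hDiag f R₀ h a x)
      + weylFactor f R₀ (x 1) * (laplacian (kundtMetric f R₀) (kundtInv f R₀)
          (contractVar (kundtInv f R₀) (weylUnit f R₀) weylTensor (kundtMetric f R₀) h) x
        - 12 * traceDiv (kundtMetric f R₀) (kundtInv f R₀) h
          (fun y => weylFactor f R₀ (y 1)) x - 12 * boxVar f R₀ h (weylFactor f R₀) x) := by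
  have h1 := variation_contractBox H (isDiagonalInverse_kundt D) (contDiffOn_kundtInv D)
    (isCompatible_kundt D) (isParallel_weylUnit D) (contDiffOn_weylUnit D)
    (smoothFunctional_weylTensor H) (contDiffOn_comp_radius D.smooth_weylFactor)
    (fun x hx J => weylTensor_kundt D hx J) (hasTraceProperty_weylUnit D)
    (fun x hx => sum_raiseDiag_mul_weylUnit D hx) hx
  rw [sum_weylUnit_mul_variation D H hx, laplacian_radius D D.smooth_weylFactor hx] at h1
  rw [← sum_hessian_radius D H D.smooth_weylFactor hx]
  refine Eq.trans h1 ?_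
  have e : (fun y => ∑ J, raiseDiag (kundtInv f R₀) (weylUnit f R₀) J y *
      variation (kundtMetric f R₀) h (fun g => weylTensor g J) y) =
    contractVar (kundtInv f R₀) (weylUnit f R₀) weylTensor (kundtMetric f R₀) h := rfl
  rw [e]
  simp only [traceDiv, hDiag]
  ring

theorem variation_invRBoxR (D : KundtData f I R₀)
    (H : IsVariation (kundtChart f I) (kundtMetric f R₀) h) {x : Coord}
    (hx : x ∈ kundtChart f I) :
    variation (kundtMetric f R₀) h invRBoxR x =
      6 * radialBox f (weylFactor f R₀) (x 1) * scalarVar f R₀ h x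
      + 6 * weylFactor f R₀ (x 1) * (laplacian (kundtMetric f R₀) (kundtInv f R₀)
          (variation (kundtMetric f R₀) h ricciScalar) x
        - 6 * boxVar f R₀ h (weylFactor f R₀) x) := by
  have hU : ∀ F : (Fin 0 → Fin 4) → ℝ, ∑ J, F J = F Fin.elim0 := fun F => by
    rw [Fintype.sum_unique]; congr 1
  have e0 : ∀ x, raiseDiag (kundtInv f R₀) (fun (_ : Fin 0 → Fin 4) (_ : Coord) => (1 : ℝ))
      Fin.elim0 x = 1 := fun x => by simp [raiseDiag]
  have hs := D.smooth_weylFactor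
  have h6 : ContDiffOn ℝ ∞ (fun r => 6 * weylFactor f R₀ r) I := contDiffOn_const.mul hs
  have hb : radialBox f (fun r => 6 * weylFactor f R₀ r) (x 1) =
      6 * radialBox f (weylFactor f R₀) (x 1) := by
    have : deriv (fun r => 6 * weylFactor f R₀ r) = fun r => 6 * deriv (weylFactor f R₀) r :=
      funext fun r => deriv_const_mul_field 6
    simp only [radialBox, this, deriv_const_mul_field]
    ring
  have hbv : boxVar f R₀ h (fun r => 6 * weylFactor f R₀ r) x =
      6 * boxVar f R₀ h (weylFactor f R₀) x := by
    have : deriv (fun r => 6 * weylFactor f R₀ r) = fun r => 6 * deriv (weylFactor f R₀) r :=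
      funext fun r => deriv_const_mul_field 6
    simp only [boxVar, this, deriv_const_mul_field]
    ring
  have e1 : invRBoxR = contractBox (k := 0) (fun g _ => ricciScalar g) := by
    funext g x
    rw [contractBox, hU, invRBoxR, raise, hU]
    simp
  -- Rank zero with `K = 1`: without slots the trace constant is `0`, and the norm is `1`.
  have h1 := variation_contractBox (k := 0) (K := fun _ _ => 1) (c := 0) (N := 1)
    (T := fun g _ => ricciScalar g) H (isDiagonalInverse_kundt D)
    (contDiffOn_kundtInv D) (isCompatible_kundt D) (fun x _ e J => by simp [pd_const])
    (fun _ => contDiffOn_const) (fun _ => smoothFunctional_ricciScalar H)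
    (contDiffOn_comp_radius h6) (fun x hx J => by rw [ricciScalar_kundt D hx, mul_one])
    (fun x _ A => by simp) (fun x _ => by rw [hU, e0, mul_one]) hx
  rw [← e1, laplacian_radius D h6 hx] at h1
  simp only [hU, e0, one_mul, variation_ricciScalar D H hx, zero_mul, sub_zero] at h1
  have e2 : (fun y => variation (kundtMetric f R₀) h (fun g => ricciScalar g) y) =
    variation (kundtMetric f R₀) h ricciScalar := rfl
  rw [h1, hb, e2]
  linear_combination -6 * weylFactor f R₀ (x 1) * (sum_hessian_radius D H h6 hx).trans hbv

end

end

end SixDerivativeGravity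


namespace SixDerivativeGravity

open MeasureTheory Filter Topology

noncomputable section

/-! ### The first variation of the Lagrangian -/

/-- The value of the Lagrangian. -/
def kundtLagrangian (κ : Couplings) (f : ℝ → ℝ) (R₀ : ℝ) (r : ℝ) : ℝ :=
  κ.γ * (6 * weylFactor f R₀ r - 2 * κ.Λ)
    + (36 * κ.β - 12 * κ.α) * weylFactor f R₀ r ^ 2
    + (36 * κ.η₂ - 12 * κ.η₁) * (weylFactor f R₀ r * radialBox f (weylFactor f R₀) r)
    + (216 * κ.η₃ + 72 * κ.η₇ + 12 * κ.η₈) * weylFactor f R₀ r ^ 3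
    + (24 * κ.η₄ + 8 * κ.η₆) * (weylFactor f R₀ r * ricciSplit f R₀ r ^ 2)

/-- The coefficient of `scalarVar` in the first variation of the Lagrangian. -/
def coefScalar (κ : Couplings) (f : ℝ → ℝ) (R₀ : ℝ) (r : ℝ) : ℝ :=
  κ.γ + 12 * κ.β * weylFactor f R₀ r + (108 * κ.η₃ + 12 * κ.η₇) * weylFactor f R₀ r ^ 2
    + 4 * κ.η₄ * ricciSplit f R₀ r ^ 2 + 12 * κ.η₂ * radialBox f (weylFactor f R₀) r

/-- The coefficient of `splitVar` in the first variation of the Lagrangian. -/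
def coefSplit (κ : Couplings) (f : ℝ → ℝ) (R₀ : ℝ) (r : ℝ) : ℝ :=
  (12 * κ.η₄ + 4 * κ.η₆) * (ricciSplit f R₀ r * weylFactor f R₀ r)

/-- The coefficient of `weylVar` in the first variation of the Lagrangian. -/
def coefWeyl (κ : Couplings) (f : ℝ → ℝ) (R₀ : ℝ) (r : ℝ) : ℝ :=
  -4 * κ.α * weylFactor f R₀ r + 4 / 3 * κ.η₆ * ricciSplit f R₀ r ^ 2
    + (24 * κ.η₇ + 6 * κ.η₈) * weylFactor f R₀ r ^ 2 - 4 * κ.η₁ * radialBox f (weylFactor f R₀) r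

section

variable {f : ℝ → ℝ} {I : Set ℝ} {R₀ : ℝ} {h : Coord → Matrix (Fin 4) (Fin 4) ℝ}

theorem invCC_kundt (D : KundtData f I R₀) {x : Coord} (hx : x ∈ kundtChart f I) :
    invCC (kundtMetric f R₀) x = 12 * weylFactor f R₀ (x 1) ^ 2 := by
  simp only [invCC, raise_weylTensor_kundt D _ hx, weylTensor_kundt D hx]
  rw [← sum_raiseDiag_mul_weylUnit D hx, Finset.sum_mul]
  exact Finset.sum_congr rfl fun J _ => by ring

theorem invSS_kundt (D : KundtData f I R₀) {x : Coord} (hx : x ∈ kundtChart f I) :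
    invSS (kundtMetric f R₀) x = 4 * ricciSplit f R₀ (x 1) ^ 2 := by
  simp only [invSS, raise_sTensor_kundt D _ _ hx, tracelessRicci_kundt D hx]
  have h1 : ∀ a, ∑ b, kron a b * kundtDiag f R₀ a x * (ricciSplit f R₀ (x 1) * blockSign a) *
      (kron a b * (kundtInv f R₀ a x * (ricciSplit f R₀ (x 1) * blockSign a))) =
      ricciSplit f R₀ (x 1) ^ 2 * blockSign a ^ 2 := fun a => by
    rw [Finset.sum_eq_single a (fun b _ hb => by simp [kron_of_ne hb.symm]) (by simp), kron_self]
    linear_combination ricciSplit f R₀ (x 1) ^ 2 * blockSign a ^ 2 * kundtDiag_mul_kundtInv D hx a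
  simp only [h1]
  simp [Fin.sum_univ_four, blockSign]
  ring

theorem invSSC_kundt (D : KundtData f I R₀) {x : Coord} (hx : x ∈ kundtChart f I) :
    invSSC (kundtMetric f R₀) x = 8 * weylFactor f R₀ (x 1) * ricciSplit f R₀ (x 1) ^ 2 := by
  simp only [invSSC, raise_weylTensor_kundt' D _ _ _ _ hx, tracelessRicci_kundt D hx]
  set X : Fin 4 → ℝ := fun a =>
    kundtDiag f R₀ a x * (ricciSplit f R₀ (x 1) * blockSign a) with hX
  have hd := kundtDiag_mul_kundtInv D hx
  have h1 := sum_four_kron_kron X X fun a c b e => weylFactor f R₀ (x 1) *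
    diagRiem weylPattern (fun a => kundtInv f R₀ a x) a c b e
  simp only [hX, ← mul_assoc] at h1 ⊢
  rw [h1]
  have h2 : ∀ a c, kundtDiag f R₀ a x * ricciSplit f R₀ (x 1) * blockSign a *
      kundtDiag f R₀ c x * ricciSplit f R₀ (x 1) * blockSign c * weylFactor f R₀ (x 1) *
      diagRiem weylPattern (fun a => kundtInv f R₀ a x) a c a c =
      ricciSplit f R₀ (x 1) ^ 2 * weylFactor f R₀ (x 1) * (blockSign a * blockSign c *
        weylPattern a c * (1 - kron a c ^ 2)) := fun a c => by
    simp only [diagRiem, kron_self, kron_comm c a]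
    linear_combination ricciSplit f R₀ (x 1) ^ 2 * weylFactor f R₀ (x 1) * (blockSign a *
      blockSign c * weylPattern a c * (1 - kron a c ^ 2)) *
      (kundtDiag f R₀ c x * kundtInv f R₀ c x * hd a + hd c)
  simp only [h2, Fin.sum_univ_four]
  simp [blockSign, weylPattern, blockwise, kron]
  ring

theorem invCCC_kundt (D : KundtData f I R₀) {x : Coord} (hx : x ∈ kundtChart f I) :
    invCCC (kundtMetric f R₀) x = 12 * weylFactor f R₀ (x 1) ^ 3 := by
  have hd := kundtDiag_mul_kundtInv D hx
  simp only [invCCC, mixed_weyl_kundt D _ _ _ _ hx]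
  simp only [raise_weylTensor_kundt' D _ _ _ _ hx, weyl_kundt D hx]
  have h1 := sum_six_first weylPattern_comm (fun a => kundtInv f R₀ a x)
    fun a b c e => diagRiem weylPattern (fun a => kundtDiag f R₀ a x) a b c e
  have h2 : ∀ a b, 2 * weylPattern a b ^ 2 * kundtInv f R₀ a x * kundtInv f R₀ b x *
      (diagRiem weylPattern (fun a => kundtDiag f R₀ a x) a b a b -
        diagRiem weylPattern (fun a => kundtDiag f R₀ a x) a b b a) =
      4 * weylPattern a b ^ 3 * (1 - kron a b ^ 2) := fun a b => by
    rw [diagRiem_swap]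
    simp only [diagRiem, kron_self, kron_comm b a]
    linear_combination 4 * weylPattern a b ^ 3 * (1 - kron a b ^ 2) *
      (kundtDiag f R₀ b x * kundtInv f R₀ b x * hd a + hd b)
  have h3 : ∑ a, ∑ b, 4 * weylPattern a b ^ 3 * (1 - kron a b ^ 2) = 12 := by
    simp only [Fin.sum_univ_four]
    simp [weylPattern, blockwise, kron]
    norm_num
  simp only [h2, h3] at h1
  rw [← h1]
  simp only [Finset.sum_mul]
  exact Finset.sum_congr rfl fun a _ => Finset.sum_congr rfl fun b _ => Finset.sum_congr rfl
    fun c _ => Finset.sum_congr rfl fun e _ => Finset.sum_congr rfl fun m _ =>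
    Finset.sum_congr rfl fun n _ => by ring

/-- The eigenvalues `σ, σ, -σ, -σ` have cubes that add up to zero. -/
theorem invSSS_kundt (D : KundtData f I R₀) {x : Coord} (hx : x ∈ kundtChart f I) :
    invSSS (kundtMetric f R₀) x = 0 := by
  simp only [invSSS, raise_sTensor_kundt D _ _ hx, tracelessRicci_kundt D hx,
    isDiagonalInverse_kundt D x hx, ite_mul, zero_mul, Finset.sum_ite_eq, Finset.mem_univ, if_true]
  have h1 : ∀ a, ∑ b, ∑ c, kron a b * kundtDiag f R₀ a x * (ricciSplit f R₀ (x 1) * blockSign a) *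
      (kundtInv f R₀ a x * (kron a c * kundtDiag f R₀ a x *
        (ricciSplit f R₀ (x 1) * blockSign a))) *
      (kron c b * (kundtInv f R₀ c x * (ricciSplit f R₀ (x 1) * blockSign c))) =
      ricciSplit f R₀ (x 1) ^ 3 * blockSign a ^ 3 := fun a => by
    rw [Finset.sum_eq_single a (fun b _ hb => by simp [kron_of_ne hb.symm]) (by simp),
      Finset.sum_eq_single a (fun b _ hb => by simp [kron_of_ne hb.symm]) (by simp), kron_self]
    have := kundtDiag_mul_kundtInv D hx a
    linear_combination ricciSplit f R₀ (x 1) ^ 3 * blockSign a ^ 3 *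
      (kundtDiag f R₀ a x * kundtInv f R₀ a x + 1) * this
  simp only [h1]
  simp [Fin.sum_univ_four, blockSign]
  ring

theorem invCBoxC_kundt (D : KundtData f I R₀) {x : Coord} (hx : x ∈ kundtChart f I) :
    invCBoxC (kundtMetric f R₀) x =
      12 * (weylFactor f R₀ (x 1) * radialBox f (weylFactor f R₀) (x 1)) := by
  have hw := D.smooth_weylFactor
  simp only [invCBoxC, raise_of_diagonal (isDiagonalInverse_kundt D) _ _ hx,
    box_mul_parallel D.isOpen_chart (isDiagonalInverse_kundt D) (isParallel_weylUnit D)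
      (contDiffOn_weylUnit D) (contDiffOn_comp_radius hw) (fun x hx J => weylTensor_kundt D hx J)
      _ hx, weylTensor_kundt D hx, laplacian_radius D hw hx]
  rw [← sum_raiseDiag_mul_weylUnit D hx, Finset.sum_mul]
  exact Finset.sum_congr rfl fun J _ => by simp only [raiseDiag]; ring

theorem invRBoxR_kundt (D : KundtData f I R₀) {x : Coord} (hx : x ∈ kundtChart f I) :
    invRBoxR (kundtMetric f R₀) x =
      36 * (weylFactor f R₀ (x 1) * radialBox f (weylFactor f R₀) (x 1)) := by
  have h6 : ContDiffOn ℝ ∞ (fun r => 6 * weylFactor f R₀ r) I :=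
    contDiffOn_const.mul D.smooth_weylFactor
  have hb : radialBox f (fun r => 6 * weylFactor f R₀ r) (x 1) =
      6 * radialBox f (weylFactor f R₀) (x 1) := by
    have : deriv (fun r => 6 * weylFactor f R₀ r) = fun r => 6 * deriv (weylFactor f R₀) r :=
      funext fun r => deriv_const_mul_field 6
    simp only [radialBox, this, deriv_const_mul_field]
    ring
  rw [invRBoxR, box_mul_parallel (k := 0) (K := fun _ _ => 1) D.isOpen_chart
    (isDiagonalInverse_kundt D) (fun x _ e J => by simp [pd_const]) (fun _ => contDiffOn_const)
    (contDiffOn_comp_radius h6) (fun x hx J => by rw [ricciScalar_kundt D hx, mul_one]) _ hx,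
    ricciScalar_kundt D hx, laplacian_radius D h6 hx, hb]
  ring

theorem lagrangian_kundt (D : KundtData f I R₀) (κ : Couplings) {x : Coord}
    (hx : x ∈ kundtChart f I) :
    lagrangian κ (kundtMetric f R₀) x = kundtLagrangian κ f R₀ (x 1) := by
  rw [lagrangian, ricciScalar_kundt D hx, invCC_kundt D hx, invCBoxC_kundt D hx,
    invRBoxR_kundt D hx, invSS_kundt D hx, invSSS_kundt D hx, invSSC_kundt D hx, invCCC_kundt D hx,
    kundtLagrangian]
  ring

/-- The terms with `□` of a variation are arranged as `w □ s - (□ w) s`, which become divergences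
after multiplication by the volume element. The `(□ w) s` added in return doubles the coefficients
of `radialBox` in `coefScalar` and `coefWeyl`. -/
theorem variation_lagrangian (D : KundtData f I R₀)
    (H : IsVariation (kundtChart f I) (kundtMetric f R₀) h) (κ : Couplings) {x : Coord}
    (hx : x ∈ kundtChart f I) :
    variation (kundtMetric f R₀) h (lagrangian κ) x =
      coefScalar κ f R₀ (x 1) * scalarVar f R₀ h x + coefSplit κ f R₀ (x 1) * splitVar f R₀ h x
      + coefWeyl κ f R₀ (x 1) * weylVar f R₀ h x
      - (36 * κ.η₂ - 12 * κ.η₁) * (weylFactor f R₀ (x 1) * boxVar f R₀ h (weylFactor f R₀) x)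
      - κ.η₁ * (weylFactor f R₀ (x 1) * laplacian (kundtMetric f R₀) (kundtInv f R₀)
          (contractVar (kundtInv f R₀) (weylUnit f R₀) weylTensor (kundtMetric f R₀) h) x
        - radialBox f (weylFactor f R₀) (x 1) *
          contractVar (kundtInv f R₀) (weylUnit f R₀) weylTensor (kundtMetric f R₀) h x)
      + 12 * κ.η₁ * (weylFactor f R₀ (x 1) * traceDiv (kundtMetric f R₀) (kundtInv f R₀) h
          (fun y => weylFactor f R₀ (y 1)) x)
      + 6 * κ.η₂ * (weylFactor f R₀ (x 1) * laplacian (kundtMetric f R₀) (kundtInv f R₀)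
          (variation (kundtMetric f R₀) h ricciScalar) x
        - radialBox f (weylFactor f R₀) (x 1) *
          variation (kundtMetric f R₀) h ricciScalar x) := by
  have hR := (smoothFunctional_ricciScalar H).hasDerivAt H hx
  have hCC := (smoothFunctional_invCC H).hasDerivAt H hx
  have hCBC := (smoothFunctional_invCBoxC H).hasDerivAt H hx
  have hRBR := (smoothFunctional_invRBoxR H).hasDerivAt H hx
  have hSS := (smoothFunctional_invSS H).hasDerivAt H hx
  have hSSS := (smoothFunctional_invSSS H).hasDerivAt H hx
  have hSSC := (smoothFunctional_invSSC H).hasDerivAt H hx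
  have hCCC := (smoothFunctional_invCCC H).hasDerivAt H hx
  have h1 : HasDerivAt (fun ε : ℝ => lagrangian κ (perturb (kundtMetric f R₀) h ε) x) _ 0 :=
    (((((((((((hR.sub_const (2 * κ.Λ)).const_mul κ.γ).add ((hR.fun_pow 2).const_mul κ.β)).sub
      (hCC.const_mul κ.α)).sub (hCBC.const_mul κ.η₁)).add (hRBR.const_mul κ.η₂)).add
      ((hR.fun_pow 3).const_mul κ.η₃)).add ((hR.fun_mul hSS).const_mul κ.η₄)).add
      (hSSS.const_mul κ.η₅)).add (hSSC.const_mul κ.η₆)).add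
      ((hR.fun_mul hCC).const_mul κ.η₇)).add (hCCC.const_mul κ.η₈)
  rw [variation, h1.deriv]
  simp only [perturb_zero, ricciScalar_kundt D hx, invCC_kundt D hx, invSS_kundt D hx,
    variation_ricciScalar D H hx, variation_invCC D H hx, variation_invCBoxC D H hx,
    variation_invRBoxR D H hx, variation_invSS D H hx, variation_invSSS D H hx,
    variation_invSSC D H hx, variation_invCCC D H hx]
  have e : contractVar (kundtInv f R₀) (weylUnit f R₀) weylTensor (kundtMetric f R₀) h x =
    2 * weylVar f R₀ h x + 6 * weylFactor f R₀ (x 1) * ∑ a, hDiag f R₀ h a x :=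
    sum_weylUnit_mul_variation D H hx
  rw [e, coefScalar, coefSplit, coefWeyl]
  push_cast
  ring

end

end

end SixDerivativeGravity


namespace SixDerivativeGravity

open MeasureTheory Filter Topology

noncomputable section

/-! ### Total derivatives in the first variation of the action -/

/-- The volume element. -/
def kundtVol (R₀ : ℝ) (x : Coord) : ℝ := R₀ ^ 2 * Real.sin (x 2)

/-- The first variation of the Christoffel symbols. -/
def gammaVar (f : ℝ → ℝ) (R₀ : ℝ) (h : Coord → Matrix (Fin 4) (Fin 4) ℝ) (a b c : Fin 4)
    (x : Coord) : ℝ :=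
  variation (kundtMetric f R₀) h (fun g => christoffel g a b c) x

theorem IsDivergence.const_mul {U K : Set Coord} (hU : IsOpen U) {D : Coord → ℝ}
    (hD : IsDivergence U K D) (c : ℝ) : IsDivergence U K (fun x => c * D x) := by
  obtain ⟨V, hV, hV0, hVD⟩ := hD
  refine ⟨fun i x => c * V i x, fun i => contDiffOn_const.mul (hV i), fun i x hx => ?_,
    fun x hx => ?_⟩
  · simp [hV0 i x hx]
  · show c * D x = ∑ i, pd i (fun y => c * V i y) x
    rw [hVD x hx, Finset.mul_sum]
    exact Finset.sum_congr rfl fun i _ => (pd_const_mul i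
      (((hV i).contDiffAt (hU.mem_nhds hx)).differentiableAt (by simp)) c).symm

theorem pd_eq_zero_of_notMem {K : Set Coord} (hK : IsClosed K) {F : Coord → ℝ}
    (hF : ∀ x ∉ K, F x = 0) (i : Fin 4) {x : Coord} (hx : x ∉ K) : pd i F x = 0 := by
  rw [pd_congr_of_isOpen hK.isOpen_compl (G := fun _ => 0) (fun y hy => hF y hy) i hx, pd_const]

section

variable {f : ℝ → ℝ} {I : Set ℝ} {R₀ : ℝ} {h : Coord → Matrix (Fin 4) (Fin 4) ℝ}

theorem differentiableAt_of_contDiffOn_kundtChart (D : KundtData f I R₀) {F : Coord → ℝ}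
    (hF : ContDiffOn ℝ ∞ F (kundtChart f I)) {x : Coord} (hx : x ∈ kundtChart f I) :
    DifferentiableAt ℝ F x :=
  (hF.contDiffAt (D.isOpen_chart.mem_nhds hx)).differentiableAt (by simp)

theorem contDiffOn_kundtVol : ContDiffOn ℝ ∞ (kundtVol R₀) (kundtChart f I) :=
  contDiffOn_const.mul (contDiffOn_comp_angle Real.contDiff_sin)

theorem pd_kundtVol (i : Fin 4) (x : Coord) :
    pd i (kundtVol R₀) x = if i = 2 then R₀ ^ 2 * Real.cos (x 2) else 0 :=
  pd_comp_angle ((Real.hasDerivAt_sin (x 2)).const_mul (R₀ ^ 2)) i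

/-- The identity `∂_a(√g g^{ae}) = -√g g^{ab} Γ^e_{ab}` in diagonal coordinates. It is what turns
`√g` times a covariant divergence into a coordinate divergence. -/
theorem pd_kundtVol_mul_kundtInv (D : KundtData f I R₀) (e : Fin 4) {x : Coord}
    (hx : x ∈ kundtChart f I) : pd e (fun y => kundtVol R₀ y * kundtInv f R₀ e y) x =
      -(kundtVol R₀ x * ∑ a, kundtInv f R₀ a x * kundtGamma f e a a x) := by
  have h1 := hx.2.1
  have h2 := D.pos.ne'
  have h3 := (sin_pos_of_mem_kundtChart hx).ne'
  rw [pd_mul e (differentiableAt_of_contDiffOn_kundtChart D contDiffOn_kundtVol hx)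
    (differentiableAt_of_contDiffOn_kundtChart D (contDiffOn_kundtInv D e) hx),
    pd_kundtInv D hx, pd_kundtDiag D hx, pd_kundtVol]
  fin_cases e <;> simp [Fin.sum_univ_four, kundtInv, kundtGamma, kundtVol] <;> field_simp <;>
    ring_nf <;> try simp

/-- Green's identity: `□` is formally self-adjoint, and the vector field is `√g (w ∂^e s - s ∂^e
w)`. -/
theorem isDivergence_box (D : KundtData f I R₀) {K : Set Coord} (hK : IsClosed K)
    {w s : Coord → ℝ} (hw : ContDiffOn ℝ ∞ w (kundtChart f I))
    (hs : ContDiffOn ℝ ∞ s (kundtChart f I)) (hs0 : ∀ x ∉ K, s x = 0) :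
    IsDivergence (kundtChart f I) K (fun x => kundtVol R₀ x *
      (w x * laplacian (kundtMetric f R₀) (kundtInv f R₀) s x
        - laplacian (kundtMetric f R₀) (kundtInv f R₀) w x * s x)) := by
  have hU := D.isOpen_chart
  have hS : ∀ e, ContDiffOn ℝ ∞ (fun y => kundtVol R₀ y * kundtInv f R₀ e y) (kundtChart f I) :=
    fun e => contDiffOn_kundtVol.mul (contDiffOn_kundtInv D e)
  have hws := fun e => contDiffOn_pd hU hs e
  have hww := fun e => contDiffOn_pd hU hw e
  refine ⟨fun e x => (kundtVol R₀ x * kundtInv f R₀ e x) * (w x * pd e s x - pd e w x * s x),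
    fun e => (hS e).mul ((hw.mul (hws e)).sub ((hww e).mul hs)), fun e x hx => ?_, fun x hx => ?_⟩
  · simp [hs0 x hx, pd_eq_zero_of_notMem hK hs0 e hx]
  · have hd : ∀ {F : Coord → ℝ}, ContDiffOn ℝ ∞ F (kundtChart f I) → DifferentiableAt ℝ F x :=
      fun hF => differentiableAt_of_contDiffOn_kundtChart D hF hx
    have h1 : ∀ e, pd e (fun x => (kundtVol R₀ x * kundtInv f R₀ e x) *
        (w x * pd e s x - pd e w x * s x)) x =
        -(kundtVol R₀ x * ∑ a, kundtInv f R₀ a x * kundtGamma f e a a x) *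
          (w x * pd e s x - pd e w x * s x) + kundtVol R₀ x * kundtInv f R₀ e x *
          (w x * pd e (pd e s) x - pd e (pd e w) x * s x) := fun e => by
      rw [pd_mul e (hd (hS e)) (hd ((hw.mul (hws e)).sub ((hww e).mul hs))),
        pd_kundtVol_mul_kundtInv D e hx, pd_sub e (hd (hw.mul (hws e))) (hd ((hww e).mul hs)),
        pd_mul e (hd hw) (hd (hws e)), pd_mul e (hd (hww e)) (hd hs)]
      ring
    simp only [h1, laplacian, hessian, christoffel_kundt D hx, Fin.sum_univ_four]
    ring

/-- With `G_e` the trace of `δΓ`, `w (∇^e(w G_e) + ∂^e w G_e) = ∇^e(w² G_e)`. Thus these terms of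
the variation of `C □ C` do not reach the field equations. -/
theorem isDivergence_traceDiv (D : KundtData f I R₀)
    (H : IsVariation (kundtChart f I) (kundtMetric f R₀) h)
    {w : Coord → ℝ} (hw : ContDiffOn ℝ ∞ w (kundtChart f I)) :
    IsDivergence (kundtChart f I) (tsupport h) (fun x => kundtVol R₀ x *
      (w x * traceDiv (kundtMetric f R₀) (kundtInv f R₀) h w x)) := by
  have hS : ∀ e, ContDiffOn ℝ ∞ (fun y => kundtVol R₀ y * kundtInv f R₀ e y) (kundtChart f I) :=
    fun e => contDiffOn_kundtVol.mul (contDiffOn_kundtInv D e)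
  have hG : ∀ e, ContDiffOn ℝ ∞ (traceGamma (kundtMetric f R₀) h e) (kundtChart f I) := fun e =>
    ContDiffOn.sum fun a _ => (smoothFunctional_christoffel H a e a).contDiffOn_variation H
  refine ⟨fun e x => (kundtVol R₀ x * kundtInv f R₀ e x) *
    (w x * (w x * traceGamma (kundtMetric f R₀) h e x)),
    fun e => (hS e).mul (hw.mul (hw.mul (hG e))), fun e x hx => ?_, fun x hx => ?_⟩
  · simp [traceGamma, variation_eq_zero_of_notMem (isLocal_christoffel _ _ _) hx]
  · have hd : ∀ {F : Coord → ℝ}, ContDiffOn ℝ ∞ F (kundtChart f I) → DifferentiableAt ℝ F x :=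
      fun hF => differentiableAt_of_contDiffOn_kundtChart D hF hx
    have h1 : ∀ e, pd e (fun x => (kundtVol R₀ x * kundtInv f R₀ e x) *
        (w x * (w x * traceGamma (kundtMetric f R₀) h e x))) x =
        -(kundtVol R₀ x * ∑ a, kundtInv f R₀ a x * kundtGamma f e a a x) *
          (w x * (w x * traceGamma (kundtMetric f R₀) h e x))
        + kundtVol R₀ x * kundtInv f R₀ e x *
          (pd e w x * (w x * traceGamma (kundtMetric f R₀) h e x)
          + w x * pd e (fun x => w x * traceGamma (kundtMetric f R₀) h e x) x) := fun e => by
      rw [pd_mul e (hd (hS e)) (hd (hw.mul (hw.mul (hG e)))),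
        pd_kundtVol_mul_kundtInv D e hx, pd_mul e (hd hw) (hd (hw.mul (hG e)))]
    simp only [h1, traceDiv, christoffel_kundt D hx, Fin.sum_univ_four]
    ring

/-- Every matrix `g + ε h` is symmetric, so each connection of the family is torsion-free. -/
theorem gammaVar_symm (H : IsVariation (kundtChart f I) (kundtMetric f R₀) h) (a b c : Fin 4)
    (x : Coord) : gammaVar f R₀ h a b c x = gammaVar f R₀ h a c b x := by
  have h0 : ∀ (ε : ℝ) (y : Coord) (b c : Fin 4), perturb (kundtMetric f R₀) h ε y b c =
      perturb (kundtMetric f R₀) h ε y c b := fun ε y b c => by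
    simp only [perturb, Matrix.add_apply, Matrix.smul_apply, H.symm_h y b c]
    congr 1
    rw [kundtMetric_apply, kundtMetric_apply, kron_comm]
    rcases eq_or_ne b c with rfl | hbc
    · rfl
    · simp [kron_of_ne hbc.symm]
  simp only [gammaVar, variation, christoffel]
  congr 1
  funext ε
  congr 1
  refine Finset.sum_congr rfl fun d _ => ?_
  congr 1
  rw [show (fun y => perturb (kundtMetric f R₀) h ε y b c) =
    fun y => perturb (kundtMetric f R₀) h ε y c b from funext fun y => h0 ε y b c]
  ring

/-- The covariant formula for `δΓ` in terms of `∇h`, in coordinates: the terms with varied inverse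
metric reassemble into background Christoffel symbols. -/
theorem gammaVar_eq (D : KundtData f I R₀)
    (H : IsVariation (kundtChart f I) (kundtMetric f R₀) h) (a b c : Fin 4) {x : Coord}
    (hx : x ∈ kundtChart f I) : gammaVar f R₀ h a b c x =
      kundtInv f R₀ a x * ((pd b (fun y => h y a c) x + pd c (fun y => h y a b) x
        - pd a (fun y => h y b c) x) / 2 - ∑ m, h x a m * kundtGamma f m b c x) := by
  have hq := isDiagonalInverse_kundt D
  have hm : ∀ i b c, HasDerivAt (fun ε : ℝ =>
      pd i (fun y => perturb (kundtMetric f R₀) h ε y b c) x) (pd i (fun y => h y b c) x) 0 :=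
    fun i b c => by
      have := ((smoothFunctional_metric H b c).pd H i).hasDerivAt H hx
      rw [(smoothFunctional_metric H b c).variation_pd H i hx] at this
      have e : variation (kundtMetric f R₀) h (fun g x => g x b c) = fun y => h y b c :=
        funext fun y => variation_metric b c y
      rwa [e] at this
  have h1 : HasDerivAt (fun ε : ℝ => christoffel (perturb (kundtMetric f R₀) h ε) a b c x) _ 0 :=
    (HasDerivAt.fun_sum fun (d : Fin 4) (_ : d ∈ Finset.univ) =>
      ((smoothFunctional_ginv H a d).hasDerivAt H hx).mul
        (((hm b d c).add (hm c d b)).sub (hm d b c))).const_mul (1 / 2)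
  rw [gammaVar, variation, h1.deriv]
  have h2 : ∀ m, kundtGamma f m b c x = 1 / 2 * (kundtInv f R₀ m x *
      (pd b (fun y => kundtMetric f R₀ y m c) x + pd c (fun y => kundtMetric f R₀ y m b) x
        - pd m (fun y => kundtMetric f R₀ y b c) x)) := fun m => by
    rw [← christoffel_kundt D hx, christoffel]
    simp [hq x hx]
  simp only [perturb_zero, variation_ginv_of_diagonal H hq _ _ hx, hq x hx, h2,
    Finset.sum_add_distrib, ite_mul, zero_mul, Finset.sum_ite_eq, Finset.mem_univ, if_true,
    Pi.add_apply, Pi.sub_apply]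
  rw [mul_add, Finset.mul_sum, mul_sub (kundtInv f R₀ a x) (_ / 2), Finset.mul_sum, add_comm,
    sub_eq_add_neg (kundtInv f R₀ a x * (_ / 2)), ← Finset.sum_neg_distrib]
  congr 1
  · ring
  · exact Finset.sum_congr rfl fun m _ => by ring

end

end

end SixDerivativeGravity


/-! ### Integration by parts of the curvature and connection variations -/

namespace SixDerivativeGravity

open MeasureTheory Filter Topology

noncomputable section

section

variable {f : ℝ → ℝ} {I : Set ℝ} {R₀ : ℝ} {h : Coord → Matrix (Fin 4) (Fin 4) ℝ}

theorem contDiffOn_gammaVar (H : IsVariation (kundtChart f I) (kundtMetric f R₀) h)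
    (a b c : Fin 4) : ContDiffOn ℝ ∞ (gammaVar f R₀ h a b c) (kundtChart f I) :=
  (smoothFunctional_christoffel H a b c).contDiffOn_variation H

theorem gammaVar_eq_zero (a b c : Fin 4) {x : Coord} (hx : x ∉ tsupport h) :
    gammaVar f R₀ h a b c x = 0 :=
  variation_eq_zero_of_notMem (isLocal_christoffel a b c) hx

theorem pd_kundtVol_mul_kundtInv_apply (D : KundtData f I R₀) (e i : Fin 4) {x : Coord}
    (hx : x ∈ kundtChart f I) : pd i (fun y => kundtVol R₀ y * kundtInv f R₀ e y) x =
      (if i = 2 then R₀ ^ 2 * Real.cos (x 2) else 0) * kundtInv f R₀ e x -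
      kundtVol R₀ x * (2 * kundtInv f R₀ e x * kundtGamma f e i e x) := by
  have h1 := isCompatible_kundt D x hx i e e
  simp only [if_true, christoffel_kundt D hx] at h1
  rw [pd_mul i (differentiableAt_of_contDiffOn_kundtChart D contDiffOn_kundtVol hx)
    (differentiableAt_of_contDiffOn_kundtChart D (contDiffOn_kundtInv D e) hx), pd_kundtVol]
  linear_combination kundtVol R₀ x * h1

theorem contDiffOn_blockwise {p₁₁ p₁₂ p₂₁ p₂₂ : ℝ → ℝ} (h₁₁ : ContDiffOn ℝ ∞ p₁₁ I)
    (h₁₂ : ContDiffOn ℝ ∞ p₁₂ I) (h₂₁ : ContDiffOn ℝ ∞ p₂₁ I) (h₂₂ : ContDiffOn ℝ ∞ p₂₂ I)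
    (a b : Fin 4) : ContDiffOn ℝ ∞ (fun r => blockwise (p₁₁ r) (p₁₂ r) (p₂₁ r) (p₂₂ r) a b) I := by
  fin_cases a <;> fin_cases b <;> assumption

theorem deriv_blockwise (p₁₁ p₁₂ p₂₁ p₂₂ : ℝ → ℝ) (a b : Fin 4) (r : ℝ) :
    deriv (fun r => blockwise (p₁₁ r) (p₁₂ r) (p₂₁ r) (p₂₂ r) a b) r =
      blockwise (deriv p₁₁ r) (deriv p₁₂ r) (deriv p₂₁ r) (deriv p₂₂ r) a b := by
  fin_cases a <;> fin_cases b <;> rfl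

/-- Integration by parts of a linear combination of the first variations of the curvatures. -/
theorem isDivergence_curvature (D : KundtData f I R₀)
    (H : IsVariation (kundtChart f I) (kundtMetric f R₀) h) {p₁₁ p₁₂ p₂₁ p₂₂ : ℝ → ℝ}
    (h₁₁ : ContDiffOn ℝ ∞ p₁₁ I) (h₁₂ : ContDiffOn ℝ ∞ p₁₂ I) (h₂₁ : ContDiffOn ℝ ∞ p₂₁ I)
    (h₂₂ : ContDiffOn ℝ ∞ p₂₂ I) :
    IsDivergence (kundtChart f I) (tsupport h) (fun x => kundtVol R₀ x *
      (∑ a, ∑ b, blockwise (p₁₁ (x 1)) (p₁₂ (x 1)) (p₂₁ (x 1)) (p₂₂ (x 1)) a b *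
        (kundtInv f R₀ b x * variation (kundtMetric f R₀) h (fun g => riemannUp g a b a b) x)
      + ∑ b, (blockwise (deriv p₁₁ (x 1)) (deriv p₁₂ (x 1)) (deriv p₂₁ (x 1)) (deriv p₂₂ (x 1)) 1 b
          * kundtInv f R₀ b x * gammaVar f R₀ h 1 b b x
        - blockwise (deriv p₁₁ (x 1)) (deriv p₁₂ (x 1)) (deriv p₂₁ (x 1)) (deriv p₂₂ (x 1)) b 1
          * kundtInv f R₀ 1 x * gammaVar f R₀ h b b 1 x))) := by
  set Φ : Fin 4 → Fin 4 → ℝ → ℝ := fun a b r =>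
    blockwise (p₁₁ r) (p₁₂ r) (p₂₁ r) (p₂₂ r) a b with hΦ
  have hΦs : ∀ a b, ContDiffOn ℝ ∞ (Φ a b) I := contDiffOn_blockwise h₁₁ h₁₂ h₂₁ h₂₂
  have hΦc : ∀ a b, ContDiffOn ℝ ∞ (fun x : Coord => Φ a b (x 1)) (kundtChart f I) := fun a b =>
    contDiffOn_comp_radius (hΦs a b)
  have hG := contDiffOn_gammaVar (f := f) (I := I) H
  have hS : ∀ e, ContDiffOn ℝ ∞ (fun y => kundtVol R₀ y * kundtInv f R₀ e y) (kundtChart f I) :=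
    fun e => contDiffOn_kundtVol.mul (contDiffOn_kundtInv D e)
  have hV1 : ∀ b c, ContDiffOn ℝ ∞ (fun x => (kundtVol R₀ x * kundtInv f R₀ b x) *
      (Φ c b (x 1) * gammaVar f R₀ h c b b x)) (kundtChart f I) := fun b c =>
    (hS b).mul ((hΦc c b).mul (hG c b b))
  have hV2 : ∀ a c, ContDiffOn ℝ ∞ (fun x => (kundtVol R₀ x * kundtInv f R₀ c x) *
      (Φ a c (x 1) * gammaVar f R₀ h a a c x)) (kundtChart f I) := fun a c =>
    (hS c).mul ((hΦc a c).mul (hG a a c))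
  -- The Palatini identity `δR^a_{bab} = ∇_a δΓ^a_{bb} - ∇_b δΓ^a_{ab}` suggests this field. The
  -- coefficients `Φ` behave like scalars because the connection preserves the blocks, so only their
  -- `r`-derivatives are left over.
  refine ⟨fun c x => ∑ b, ((kundtVol R₀ x * kundtInv f R₀ b x) *
      (Φ c b (x 1) * gammaVar f R₀ h c b b x) - (kundtVol R₀ x * kundtInv f R₀ c x) *
      (Φ b c (x 1) * gammaVar f R₀ h b b c x)),
    fun c => ContDiffOn.sum fun b _ => (hV1 b c).sub (hV2 b c), fun c x hx => ?_, fun x hx => ?_⟩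
  · simp [gammaVar_eq_zero _ _ _ hx]
  have hd : ∀ {F : Coord → ℝ}, ContDiffOn ℝ ∞ F (kundtChart f I) → DifferentiableAt ℝ F x :=
    fun hF => differentiableAt_of_contDiffOn_kundtChart D hF hx
  have hpΦ : ∀ a b i, pd i (fun y => Φ a b (y 1)) x = if i = 1 then
      blockwise (deriv p₁₁ (x 1)) (deriv p₁₂ (x 1)) (deriv p₂₁ (x 1)) (deriv p₂₂ (x 1)) a b
      else 0 := fun a b i => by
    rw [pd_radius D (hΦs a b) i hx, deriv_blockwise]
  have hpV1 : ∀ b c, pd c (fun x => (kundtVol R₀ x * kundtInv f R₀ b x) *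
      (Φ c b (x 1) * gammaVar f R₀ h c b b x)) x = _ := fun b c => by
    rw [pd_mul c (hd (hS b)) (hd ((hΦc c b).mul (hG c b b))), pd_mul c (hd (hΦc c b))
      (hd (hG c b b)), pd_kundtVol_mul_kundtInv_apply D _ _ hx, hpΦ]
  have hpV2 : ∀ a c, pd c (fun x => (kundtVol R₀ x * kundtInv f R₀ c x) *
      (Φ a c (x 1) * gammaVar f R₀ h a a c x)) x = _ := fun a c => by
    rw [pd_mul c (hd (hS c)) (hd ((hΦc a c).mul (hG a a c))), pd_mul c (hd (hΦc a c))
      (hd (hG a a c)), pd_kundtVol_mul_kundtInv_apply D _ _ hx, hpΦ]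
  have hpV : ∀ c, pd c (fun x => ∑ b, ((kundtVol R₀ x * kundtInv f R₀ b x) *
      (Φ c b (x 1) * gammaVar f R₀ h c b b x) - (kundtVol R₀ x * kundtInv f R₀ c x) *
      (Φ b c (x 1) * gammaVar f R₀ h b b c x))) x =
      ∑ b, (pd c (fun x => (kundtVol R₀ x * kundtInv f R₀ b x) *
        (Φ c b (x 1) * gammaVar f R₀ h c b b x)) x - pd c (fun x => (kundtVol R₀ x *
        kundtInv f R₀ c x) * (Φ b c (x 1) * gammaVar f R₀ h b b c x)) x) := fun c => by
    rw [pd_sum c _ fun b _ => (hd (hV1 b c)).fun_sub (hd (hV2 b c))]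
    exact Finset.sum_congr rfl fun b _ => pd_sub c (hd (hV1 b c)) (hd (hV2 b c))
  simp only [hpV, hpV1, hpV2]
  have hR : ∀ a b, variation (kundtMetric f R₀) h (fun g => riemannUp g a b a b) x =
      pd a (gammaVar f R₀ h a b b) x - pd b (gammaVar f R₀ h a a b) x
        + ∑ e, (gammaVar f R₀ h a a e x * kundtGamma f e b b x
          + kundtGamma f a a e x * gammaVar f R₀ h e b b x
          - (gammaVar f R₀ h a b e x * kundtGamma f e a b x
            + kundtGamma f a b e x * gammaVar f R₀ h e a b x)) := fun a b => by
    rw [variation_riemannUp H a b a b hx]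
    simp only [christoffel_kundt D hx]
    rfl
  simp only [hR]
  set G : Fin 4 → Fin 4 → Fin 4 → ℝ := fun a b c => gammaVar f R₀ h a b c x with hGdef
  have hGs : ∀ a b c, G a b c = G a c b := fun a b c => gammaVar_symm H a b c x
  set P : Fin 4 → Fin 4 → Fin 4 → Fin 4 → ℝ := fun i a b c => pd i (gammaVar f R₀ h a b c) x
    with hPdef
  have hGa : ∀ a b c, gammaVar f R₀ h a b c x = G a b c := fun a b c => rfl
  have hPa : ∀ i a b c, pd i (gammaVar f R₀ h a b c) x = P i a b c := fun a b c i => rfl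
  simp only [hGa, hPa]
  have f1 := hx.2.1
  have f2 := D.pos.ne'
  have f3 := (sin_pos_of_mem_kundtChart hx).ne'
  have s10 := fun a => hGs a 1 0
  have s20 := fun a => hGs a 2 0
  have s21 := fun a => hGs a 2 1
  have s30 := fun a => hGs a 3 0
  have s31 := fun a => hGs a 3 1
  have s32 := fun a => hGs a 3 2
  -- From here on `δΓ` and its partial derivatives are free variables, related only by the symmetry
  -- of the lower indices; the claim is an algebraic identity in them.
  clear_value G P
  simp only [Fin.sum_univ_four, s10, s20, s21, s30, s31, s32]
  simp [hΦ, blockwise, kundtGamma, kundtInv, kundtVol]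
  field_simp
  ring

/-- Both types of `δΓ` are first order in `h`, so a second integration by parts removes all
derivatives of `h`. The off-diagonal components `h_{1c}` occur only inside the divergence; just the
diagonal `h^a_a` survive. -/
theorem isDivergence_gammaVar (D : KundtData f I R₀)
    (H : IsVariation (kundtChart f I) (kundtMetric f R₀) h) {p₁ p₂ q₁ q₂ : ℝ → ℝ}
    (hp₁ : ContDiffOn ℝ ∞ p₁ I) (hp₂ : ContDiffOn ℝ ∞ p₂ I) (hq₁ : ContDiffOn ℝ ∞ q₁ I)
    (hq₂ : ContDiffOn ℝ ∞ q₂ I) :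
    IsDivergence (kundtChart f I) (tsupport h) (fun x => kundtVol R₀ x *
      (∑ b, ((![p₁, p₁, p₂, p₂] : Fin 4 → ℝ → ℝ) b (x 1) * kundtInv f R₀ b x *
          gammaVar f R₀ h 1 b b x
        + (![q₁, q₁, q₂, q₂] : Fin 4 → ℝ → ℝ) b (x 1) * kundtInv f R₀ 1 x *
          gammaVar f R₀ h b b 1 x)
        + (hDiag f R₀ h 0 x * (f (x 1) * (deriv q₁ (x 1) - deriv p₁ (x 1)) / 2
            + q₁ (x 1) * deriv f (x 1) / 2)
          + hDiag f R₀ h 1 x * (f (x 1) * (deriv q₁ (x 1) + deriv p₁ (x 1)) / 2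
            + q₁ (x 1) * deriv f (x 1) / 2)
          + (hDiag f R₀ h 2 x + hDiag f R₀ h 3 x) *
            ((f (x 1) * (deriv q₂ (x 1) - deriv p₂ (x 1))
            + deriv f (x 1) * (q₂ (x 1) - p₂ (x 1))) / 2)))) := by
  set P : Fin 4 → ℝ → ℝ := ![p₁, p₁, p₂, p₂] with hP
  set Q : Fin 4 → ℝ → ℝ := ![q₁, q₁, q₂, q₂] with hQ
  have hPs : ∀ b, ContDiffOn ℝ ∞ (P b) I := fun b => by fin_cases b <;> assumption
  have hQs : ∀ b, ContDiffOn ℝ ∞ (Q b) I := fun b => by fin_cases b <;> assumption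
  have hA : ∀ b, ContDiffOn ℝ ∞ (fun r => f r * P b r) I := fun b => D.smooth.mul (hPs b)
  have hB : ∀ b, ContDiffOn ℝ ∞ (fun r => f r * (Q b r - P b r) / 2) I := fun b =>
    (D.smooth.mul ((hQs b).sub (hPs b))).div_const 2
  have hAc : ∀ b, ContDiffOn ℝ ∞ (fun x : Coord => f (x 1) * P b (x 1)) (kundtChart f I) :=
    fun b => contDiffOn_comp_radius (hA b)
  have hBc : ∀ b, ContDiffOn ℝ ∞ (fun x : Coord => f (x 1) * (Q b (x 1) - P b (x 1)) / 2)
    (kundtChart f I) := fun b => contDiffOn_comp_radius (hB b)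
  have hh : ∀ a b, ContDiffOn ℝ ∞ (fun x => h x a b) (kundtChart f I) := fun a b =>
    (H.smooth_h a b).contDiffOn
  have hS : ∀ e, ContDiffOn ℝ ∞ (fun y => kundtVol R₀ y * kundtInv f R₀ e y) (kundtChart f I) :=
    fun e => contDiffOn_kundtVol.mul (contDiffOn_kundtInv D e)
  have hV1 : ∀ c, ContDiffOn ℝ ∞ (fun x => (kundtVol R₀ x * kundtInv f R₀ c x) *
      (f (x 1) * P c (x 1) * h x 1 c)) (kundtChart f I) := fun c =>
    (hS c).mul ((hAc c).mul (hh 1 c))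
  have hV2 : ∀ b, ContDiffOn ℝ ∞ (fun x => (kundtVol R₀ x * kundtInv f R₀ b x) *
      (f (x 1) * (Q b (x 1) - P b (x 1)) / 2 * h x b b)) (kundtChart f I) := fun b =>
    (hS b).mul ((hBc b).mul (hh b b))
  have hV3 : ∀ c, ContDiffOn ℝ ∞ (fun x => kron c 1 * ∑ b,
      (kundtVol R₀ x * kundtInv f R₀ b x) * (f (x 1) * (Q b (x 1) - P b (x 1)) / 2 * h x b b))
      (kundtChart f I) := fun c => contDiffOn_const.mul (ContDiffOn.sum fun b _ => hV2 b)
  have hh0 : ∀ a b, ∀ x ∉ tsupport h, h x a b = 0 := fun a b x hx => by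
    rw [image_eq_zero_of_notMem_tsupport hx]; rfl
  -- The first summand collects the derivatives `∂_c h_{1c}` in `δΓ^1_{cc}`. The second is purely
  -- radial and collects `∂_r h_bb`, which enters `δΓ^1_{bb}` with `-1/2` and `δΓ^b_{b1}` with
  -- `1/2`; hence `(Q - P)/2`.
  refine ⟨fun c x => (kundtVol R₀ x * kundtInv f R₀ c x) * (f (x 1) * P c (x 1) * h x 1 c)
    + kron c 1 * ∑ b, (kundtVol R₀ x * kundtInv f R₀ b x) *
      (f (x 1) * (Q b (x 1) - P b (x 1)) / 2 * h x b b),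
    fun c => (hV1 c).add (hV3 c), fun c x hx => by simp [hh0 _ _ x hx], fun x hx => ?_⟩
  have hd : ∀ {F : Coord → ℝ}, ContDiffOn ℝ ∞ F (kundtChart f I) → DifferentiableAt ℝ F x :=
    fun hF => differentiableAt_of_contDiffOn_kundtChart D hF hx
  have df := D.hasDerivAt D.smooth hx.1
  have dP := fun b => D.hasDerivAt (hPs b) hx.1
  have dQ := fun b => D.hasDerivAt (hQs b) hx.1
  have hpA : ∀ b i, pd i (fun x : Coord => f (x 1) * P b (x 1)) x = _ := fun b i =>
    pd_comp_radius (df.fun_mul (dP b)) i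
  have hpB : ∀ b i, pd i (fun x : Coord => f (x 1) * (Q b (x 1) - P b (x 1)) / 2) x = _ :=
    fun b i => pd_comp_radius ((df.fun_mul ((dQ b).fun_sub (dP b))).div_const 2) i
  have hpV : ∀ c, pd c (fun x => (kundtVol R₀ x * kundtInv f R₀ c x) *
      (f (x 1) * P c (x 1) * h x 1 c) + kron c 1 * ∑ b, (kundtVol R₀ x * kundtInv f R₀ b x) *
      (f (x 1) * (Q b (x 1) - P b (x 1)) / 2 * h x b b)) x =
      pd c (fun x => (kundtVol R₀ x * kundtInv f R₀ c x) * (f (x 1) * P c (x 1) * h x 1 c)) x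
      + kron c 1 * ∑ b, pd c (fun x => (kundtVol R₀ x * kundtInv f R₀ b x) *
      (f (x 1) * (Q b (x 1) - P b (x 1)) / 2 * h x b b)) x := fun c => by
    rw [pd_add c (hd (hV1 c)) (hd (hV3 c)), pd_const_mul c (hd (ContDiffOn.sum fun b _ => hV2 b)),
      pd_sum c _ fun b _ => hd (hV2 b)]
  have hpV1 : ∀ c, pd c (fun x => (kundtVol R₀ x * kundtInv f R₀ c x) *
      (f (x 1) * P c (x 1) * h x 1 c)) x = _ := fun c => by
    rw [pd_mul c (hd (hS c)) (hd ((hAc c).mul (hh 1 c))), pd_mul c (hd (hAc c)) (hd (hh 1 c)),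
      pd_kundtVol_mul_kundtInv_apply D _ _ hx, hpA]
  have hpV2 : ∀ b c, pd c (fun x => (kundtVol R₀ x * kundtInv f R₀ b x) *
      (f (x 1) * (Q b (x 1) - P b (x 1)) / 2 * h x b b)) x = _ := fun b c => by
    rw [pd_mul c (hd (hS b)) (hd ((hBc b).mul (hh b b))), pd_mul c (hd (hBc b)) (hd (hh b b)),
      pd_kundtVol_mul_kundtInv_apply D _ _ hx, hpB]
  simp only [hpV, hpV1, hpV2, gammaVar_eq D H _ _ _ hx]
  have f1 := hx.2.1
  have f2 := D.pos.ne'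
  have f3 := (sin_pos_of_mem_kundtChart hx).ne'
  have hs : ∀ a b, (fun y => h y a b) = fun y => h y b a := fun a b =>
    funext fun y => H.symm_h y a b
  simp only [Fin.sum_univ_four, hs 1 0, hs 2 1, hs 3 1, H.symm_h x 1 0,
    H.symm_h x 2 0, H.symm_h x 2 1, H.symm_h x 3 0, H.symm_h x 3 1, H.symm_h x 3 2]
  simp [hP, hQ, kron, kundtGamma, kundtInv, kundtVol, hDiag]
  field_simp
  ring

end

end

end SixDerivativeGravity


namespace SixDerivativeGravity

open MeasureTheory Filter Topology

noncomputable section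

/-! ### The field equations -/

/-- The coefficient of the curvature of the `(t, r)` block in the first variation. -/
def coefRadial (κ : Couplings) (f : ℝ → ℝ) (R₀ : ℝ) (r : ℝ) : ℝ :=
  coefScalar κ f R₀ r + coefSplit κ f R₀ r + coefWeyl κ f R₀ r

/-- The coefficient of the curvature of the `(θ, φ)` block in the first variation. -/
def coefSphere (κ : Couplings) (f : ℝ → ℝ) (R₀ : ℝ) (r : ℝ) : ℝ :=
  coefScalar κ f R₀ r - coefSplit κ f R₀ r + coefWeyl κ f R₀ r

/-- The mean coefficient of the mixed curvatures in the first variation. -/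
def coefMixed (κ : Couplings) (f : ℝ → ℝ) (R₀ : ℝ) (r : ℝ) : ℝ :=
  coefScalar κ f R₀ r - coefWeyl κ f R₀ r / 2

/-- The field equations of six-derivative gravity for a static spherically symmetric Kundt
metric. -/
structure KundtEquations (κ : Couplings) (f : ℝ → ℝ) (R₀ : ℝ) (r : ℝ) : Prop where
  null : deriv (deriv (coefRadial κ f R₀)) r +
    (36 * κ.η₂ - 12 * κ.η₁) * deriv (weylFactor f R₀) r ^ 2 = 0
  radial : kundtLagrangian κ f R₀ r / 2 - coefRadial κ f R₀ r * curvU f r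
    - deriv (coefRadial κ f R₀) r * deriv f r / 2
    + (36 * κ.η₂ - 12 * κ.η₁) * (f r * (deriv (weylFactor f R₀) r ^ 2
      - weylFactor f R₀ r * deriv (deriv (weylFactor f R₀)) r)
      - weylFactor f R₀ r * deriv f r * deriv (weylFactor f R₀) r) / 2 = 0
  sphere : kundtLagrangian κ f R₀ r / 2 - coefSphere κ f R₀ r * (R₀ ^ 2)⁻¹
    - (f r * deriv (deriv (coefMixed κ f R₀)) r + deriv f r * deriv (coefMixed κ f R₀) r)
    - (36 * κ.η₂ - 12 * κ.η₁) * (f r * (deriv (weylFactor f R₀) r ^ 2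
      + weylFactor f R₀ r * deriv (deriv (weylFactor f R₀)) r)
      + deriv f r * weylFactor f R₀ r * deriv (weylFactor f R₀) r) / 2 = 0

section

variable {f : ℝ → ℝ} {I : Set ℝ} {R₀ : ℝ} {h : Coord → Matrix (Fin 4) (Fin 4) ℝ}

theorem KundtData.smooth_radialBox (D : KundtData f I R₀) {φ : ℝ → ℝ} (hφ : ContDiffOn ℝ ∞ φ I) :
    ContDiffOn ℝ ∞ (radialBox f φ) I :=
  (D.smooth.mul (D.contDiffOn_deriv (D.contDiffOn_deriv hφ))).add
    (D.smooth_deriv.mul (D.contDiffOn_deriv hφ))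

theorem KundtData.smooth_ricciSplit (D : KundtData f I R₀) :
    ContDiffOn ℝ ∞ (ricciSplit f R₀) I :=
  (D.smooth_curvU.sub contDiffOn_const).div_const 2

theorem KundtData.smooth_coefScalar (D : KundtData f I R₀) (κ : Couplings) :
    ContDiffOn ℝ ∞ (coefScalar κ f R₀) I :=
  (((contDiffOn_const.add (contDiffOn_const.mul D.smooth_weylFactor)).add
    (contDiffOn_const.mul (D.smooth_weylFactor.pow 2))).add
    (contDiffOn_const.mul (D.smooth_ricciSplit.pow 2))).add
    (contDiffOn_const.mul (D.smooth_radialBox D.smooth_weylFactor))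

theorem KundtData.smooth_coefSplit (D : KundtData f I R₀) (κ : Couplings) :
    ContDiffOn ℝ ∞ (coefSplit κ f R₀) I :=
  contDiffOn_const.mul (D.smooth_ricciSplit.mul D.smooth_weylFactor)

theorem KundtData.smooth_coefWeyl (D : KundtData f I R₀) (κ : Couplings) :
    ContDiffOn ℝ ∞ (coefWeyl κ f R₀) I :=
  (((contDiffOn_const.mul D.smooth_weylFactor).add
    (contDiffOn_const.mul (D.smooth_ricciSplit.pow 2))).add
    (contDiffOn_const.mul (D.smooth_weylFactor.pow 2))).sub
    (contDiffOn_const.mul (D.smooth_radialBox D.smooth_weylFactor))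

theorem KundtData.smooth_coefRadial (D : KundtData f I R₀) (κ : Couplings) :
    ContDiffOn ℝ ∞ (coefRadial κ f R₀) I :=
  ((D.smooth_coefScalar κ).add (D.smooth_coefSplit κ)).add (D.smooth_coefWeyl κ)

theorem KundtData.smooth_coefSphere (D : KundtData f I R₀) (κ : Couplings) :
    ContDiffOn ℝ ∞ (coefSphere κ f R₀) I :=
  ((D.smooth_coefScalar κ).sub (D.smooth_coefSplit κ)).add (D.smooth_coefWeyl κ)

theorem KundtData.smooth_coefMixed (D : KundtData f I R₀) (κ : Couplings) :
    ContDiffOn ℝ ∞ (coefMixed κ f R₀) I :=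
  (D.smooth_coefScalar κ).sub ((D.smooth_coefWeyl κ).div_const 2)

/-- Each of the three scalars weights the sectional variations by a function of the two blocks
alone, which is the form that `isDivergence_curvature` can integrate by parts. -/
theorem sum_blockwise_mul_secVar (a b c : ℝ) (x : Coord) :
    a * scalarVar f R₀ h x + b * splitVar f R₀ h x + c * weylVar f R₀ h x =
      ∑ i, ∑ j, blockwise (a + b + c) (a - c / 2 - b) (a - c / 2 + b) (a - b + c) i j *
        (kundtInv f R₀ j x * variation (kundtMetric f R₀) h (fun g => riemannUp g i j i j) x)
      - (a + b + c) * curvU f (x 1) * (hDiag f R₀ h 0 x + hDiag f R₀ h 1 x)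
      - (a - b + c) * (R₀ ^ 2)⁻¹ * (hDiag f R₀ h 2 x + hDiag f R₀ h 3 x) := by
  have h1 : ∀ i j, kundtInv f R₀ j x *
      variation (kundtMetric f R₀) h (fun g => riemannUp g i j i j) x =
      secVar f R₀ h i j x + (1 - kron i j) * (hDiag f R₀ h j x * sectional f R₀ x i j) :=
    fun i j => by rw [secVar]; ring
  simp only [h1, scalarVar, splitVar, weylVar, Fin.sum_univ_four]
  simp [blockwise, blockSign, weylPattern, kron, sectional]
  ring

theorem sqrt_neg_det_kundt (D : KundtData f I R₀) {x : Coord} (hx : x ∈ kundtChart f I) :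
    √(-(kundtMetric f R₀ x).det) = kundtVol R₀ x := by
  have hs := sin_pos_of_mem_kundtChart hx
  have hR := D.pos
  rw [neg_det_kundtMetric hx, Real.sqrt_sq (by positivity), kundtVol]

theorem variation_density (D : KundtData f I R₀)
    (H : IsVariation (kundtChart f I) (kundtMetric f R₀) h) (κ : Couplings) {x : Coord}
    (hx : x ∈ kundtChart f I) :
    variation (kundtMetric f R₀) h (fun g x => √(-(g x).det) * lagrangian κ g x) x =
      kundtVol R₀ x * (variation (kundtMetric f R₀) h (lagrangian κ) x
        + (∑ a, hDiag f R₀ h a x) / 2 * kundtLagrangian κ f R₀ (x 1)) := by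
  have h1 := ((smoothFunctional_sqrt_det H).hasDerivAt H hx).fun_mul
    ((smoothFunctional_lagrangian H κ).hasDerivAt H hx)
  rw [variation, h1.deriv]
  simp only [perturb_zero, variation_sqrt_det D hx, lagrangian_kundt D κ hx,
    sqrt_neg_det_kundt D hx, kundtVol]
  ring

/-- The first variation of the density of the action is a divergence. -/
theorem isDivergence_variation_density (D : KundtData f I R₀)
    (H : IsVariation (kundtChart f I) (kundtMetric f R₀) h) (κ : Couplings)
    (hE : ∀ r ∈ I, KundtEquations κ f R₀ r) :
    IsDivergence (kundtChart f I) (tsupport h)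
      (variation (kundtMetric f R₀) h (fun g x => √(-(g x).det) * lagrangian κ g x)) := by
  have hU := D.isOpen_chart
  have hn := D.smooth_coefRadial κ
  have hl := D.smooth_coefSphere κ
  have hm := D.smooth_coefMixed κ
  have hB := D.smooth_coefSplit κ
  have hw := D.smooth_weylFactor
  have hn' := D.contDiffOn_deriv hn
  have hm' := D.contDiffOn_deriv hm
  have hB' := D.contDiffOn_deriv hB
  have hw' := D.contDiffOn_deriv hw
  set N := coefRadial κ f R₀ with hN
  set L := coefSphere κ f R₀ with hL
  set M := coefMixed κ f R₀ with hM
  set B := coefSplit κ f R₀ with hBdef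
  set w := weylFactor f R₀ with hwdef
  set q : ℝ := 36 * κ.η₂ - 12 * κ.η₁ with hq
  have D1 := isDivergence_curvature D H hn (hm.sub hB) (hm.add hB) hl
  -- The coefficients cancel the connection terms left by `D1`; the extra `q w w'` supplies the
  -- connection term of `boxVar`. In the sphere components only the difference `q₂ - p₂` enters,
  -- from which `B` drops out.
  have D2 := isDivergence_gammaVar D H (p₁ := fun r => -(deriv N r + q * (w r * deriv w r)))
    (p₂ := fun r => -(deriv M r - deriv B r + q * (w r * deriv w r)))
    (q₁ := deriv N) (q₂ := fun r => deriv M r + deriv B r)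
    (hn'.add (contDiffOn_const.mul (hw.mul hw'))).neg
    ((hm'.sub hB').add (contDiffOn_const.mul (hw.mul hw'))).neg hn' (hm'.add hB')
  have hsC : ContDiffOn ℝ ∞ (contractVar (kundtInv f R₀) (weylUnit f R₀) weylTensor
      (kundtMetric f R₀) h) (kundtChart f I) :=
    ContDiffOn.sum fun J _ => ((contDiffOn_prod fun j _ => contDiffOn_kundtInv D (J j)).mul
      (contDiffOn_weylUnit D J)).mul ((smoothFunctional_weylTensor H J).contDiffOn_variation H)
  have D3 := isDivergence_box D (isClosed_tsupport h) (contDiffOn_comp_radius hw) hsC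
    (fun x hx => by simp [contractVar, variation_eq_zero_of_notMem (isLocal_weylTensor _) hx])
  have D4 := isDivergence_traceDiv D H (contDiffOn_comp_radius hw)
  have D5 := isDivergence_box D (isClosed_tsupport h) (contDiffOn_comp_radius hw)
    ((smoothFunctional_ricciScalar H).contDiffOn_variation H)
    (fun x hx => variation_eq_zero_of_notMem isLocal_ricciScalar hx)
  refine ((((D1.add hU D2).add hU (D3.const_mul hU (-κ.η₁))).add hU
    (D4.const_mul hU (12 * κ.η₁))).add hU (D5.const_mul hU (6 * κ.η₂))).congr fun x hx => ?_
  obtain ⟨e1, e2, e3⟩ := hE (x 1) hx.1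
  have dw := D.hasDerivAt hw hx.1
  have dw' := D.hasDerivAt hw' hx.1
  have dm := D.hasDerivAt hm hx.1
  have dm' := D.hasDerivAt hm' hx.1
  have dB := D.hasDerivAt hB hx.1
  have dB' := D.hasDerivAt hB' hx.1
  have dn' := D.hasDerivAt hn' hx.1
  have d1 : deriv (fun r => M r - B r) (x 1) = _ := (dm.fun_sub dB).deriv
  have d2 : deriv (fun r => M r + B r) (x 1) = _ := (dm.fun_add dB).deriv
  have d3 : deriv (fun r => -(deriv N r + q * (w r * deriv w r))) (x 1) = _ :=
    (dn'.fun_add ((dw.fun_mul dw').const_mul q)).fun_neg.deriv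
  have d4 : deriv (fun r => -(deriv M r - deriv B r + q * (w r * deriv w r))) (x 1) = _ :=
    ((dm'.fun_sub dB').fun_add ((dw.fun_mul dw').const_mul q)).fun_neg.deriv
  have d5 : deriv (fun r => deriv M r + deriv B r) (x 1) = _ := (dm'.fun_add dB').deriv
  have hs := sum_blockwise_mul_secVar (f := f) (R₀ := R₀) (h := h) (coefScalar κ f R₀ (x 1)) (coefSplit κ f R₀ (x 1))
    (coefWeyl κ f R₀ (x 1)) x
  have g1 : coefScalar κ f R₀ (x 1) + coefSplit κ f R₀ (x 1) + coefWeyl κ f R₀ (x 1) = N (x 1) :=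
    rfl
  have g2 : coefScalar κ f R₀ (x 1) - coefWeyl κ f R₀ (x 1) / 2 = M (x 1) := rfl
  have g3 : coefScalar κ f R₀ (x 1) - coefSplit κ f R₀ (x 1) + coefWeyl κ f R₀ (x 1) = L (x 1) :=
    rfl
  have g4 : coefSplit κ f R₀ (x 1) = B (x 1) := rfl
  rw [g1, g2, g3, g4] at hs
  rw [variation_density D H κ hx, variation_lagrangian D H κ hx, hs, boxVar,
    laplacian_radius D hw hx, d1, d2, d3, d4, d5]
  have hG : ∀ e, variation (kundtMetric f R₀) h (fun g => christoffel g 1 e e) x =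
    gammaVar f R₀ h 1 e e x := fun e => rfl
  simp only [hG]
  rw [← hwdef, ← hq]
  -- The sum of the connection terms of `D1` and `D2` is exactly the one in `boxVar`.
  have t1 : ∑ b, (blockwise (deriv N (x 1)) (deriv M (x 1) - deriv B (x 1))
          (deriv M (x 1) + deriv B (x 1)) (deriv L (x 1)) 1 b
          * kundtInv f R₀ b x * gammaVar f R₀ h 1 b b x
        - blockwise (deriv N (x 1)) (deriv M (x 1) - deriv B (x 1))
          (deriv M (x 1) + deriv B (x 1)) (deriv L (x 1)) b 1
          * kundtInv f R₀ 1 x * gammaVar f R₀ h b b 1 x) +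
      ∑ b, ((![fun r => -(deriv N r + q * (w r * deriv w r)),
          fun r => -(deriv N r + q * (w r * deriv w r)),
          fun r => -(deriv M r - deriv B r + q * (w r * deriv w r)),
          fun r => -(deriv M r - deriv B r + q * (w r * deriv w r))] : Fin 4 → ℝ → ℝ) b (x 1) *
          kundtInv f R₀ b x * gammaVar f R₀ h 1 b b x
        + (![deriv N, deriv N, fun r => deriv M r + deriv B r, fun r => deriv M r + deriv B r] :
          Fin 4 → ℝ → ℝ) b (x 1) * kundtInv f R₀ 1 x * gammaVar f R₀ h b b 1 x) =
      -q * (w (x 1) * (deriv w (x 1) * ∑ e, kundtInv f R₀ e x * gammaVar f R₀ h 1 e e x)) := by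
    simp only [Fin.sum_univ_four]
    simp [blockwise]
    ring
  rw [Fin.sum_univ_four (fun a => hDiag f R₀ h a x)]
  -- The coefficients of `h^t_t` and `h^r_r` differ by `f` times the null equation, so the three
  -- equations annihilate all diagonal components of `h`.
  linear_combination kundtVol R₀ x * ((hDiag f R₀ h 0 x + hDiag f R₀ h 1 x) * e2
    + (hDiag f R₀ h 2 x + hDiag f R₀ h 3 x) * e3 - hDiag f R₀ h 0 x * f (x 1) * e1 - t1)

end

end

end SixDerivativeGravity


/-! ### From the field equations to vacuum solutions -/

namespace SixDerivativeGravity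

open MeasureTheory Filter Topology

noncomputable section

section

variable {f : ℝ → ℝ} {I : Set ℝ} {R₀ : ℝ} {h : Coord → Matrix (Fin 4) (Fin 4) ℝ}

theorem contDiffOn_kundtMetric (D : KundtData f I R₀) (a b : Fin 4) :
    ContDiffOn ℝ ∞ (fun x => kundtMetric f R₀ x a b) (kundtChart f I) := by
  simp only [kundtMetric_apply]
  exact contDiffOn_const.mul (contDiffOn_kundtDiag D a)

theorem isLorentzianOn_kundt (D : KundtData f I R₀) :
    IsLorentzianOn (kundtChart f I) (kundtMetric f R₀) := by
  refine ⟨contDiffOn_kundtMetric D, fun x hx => ⟨Matrix.isSymm_diagonal _, ?_⟩⟩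
  have hR := D.pos
  have hs := sin_pos_of_mem_kundtChart hx
  rcases lt_or_gt_of_ne hx.2.1 with hf | hf
  · have h0 : 0 < -f (x 1) := neg_pos.2 hf
    have h1 := Real.sq_sqrt h0.le
    have h2 := Real.sqrt_pos.2 h0
    -- For `f < 0` the coordinate `r` is the timelike one, so the frame exchanges the first two
    -- directions.
    refine ⟨!![0, (√(-f (x 1)))⁻¹, 0, 0; √(-f (x 1)), 0, 0, 0; 0, 0, R₀⁻¹, 0;
      0, 0, 0, (R₀ * Real.sin (x 2))⁻¹], ?_⟩
    have e : f (x 1) = -√(-f (x 1)) ^ 2 := by linarith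
    set s := √(-f (x 1)) with hsdef
    rw [kundtMetric, e]
    ext a b
    fin_cases a <;> fin_cases b <;>
      simp [Matrix.mul_apply, Fin.sum_univ_four, Matrix.diagonal_apply] <;> field_simp
  · have h1 := Real.sq_sqrt hf.le
    have h2 := Real.sqrt_pos.2 hf
    refine ⟨Matrix.diagonal ![(√(f (x 1)))⁻¹, √(f (x 1)), R₀⁻¹, (R₀ * Real.sin (x 2))⁻¹], ?_⟩
    set s := √(f (x 1)) with hsdef
    rw [kundtMetric, ← h1, Matrix.diagonal_transpose, Matrix.diagonal_mul_diagonal,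
      Matrix.diagonal_mul_diagonal]
    congr 1
    funext a
    fin_cases a <;> simp <;> field_simp

/-- A static spherically symmetric Kundt metric that satisfies the field equations is a vacuum
solution. -/
theorem isKundtVacuum_of_kundtEquations (D : KundtData f I R₀) {κ : Couplings}
    (hE : ∀ r ∈ I, KundtEquations κ f R₀ r) : IsKundtVacuum κ f I R₀ := by
  refine ⟨D.isOpen_chart, isLorentzianOn_kundt D, fun h hh hsymm hc hsub => ?_⟩
  have H : IsVariation (kundtChart f I) (kundtMetric f R₀) h :=
    { isOpen := D.isOpen_chart
      smooth := contDiffOn_kundtMetric D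
      symm := fun x _ a b => (Matrix.isSymm_diagonal _).apply b a
      det_neg := fun x hx => by
        have h1 := neg_det_kundtMetric (R₀ := R₀) hx
        have h2 := sin_pos_of_mem_kundtChart hx
        have h3 := D.pos
        have h4 : 0 < (R₀ ^ 2 * Real.sin (x 2)) ^ 2 := by positivity
        linarith
      smooth_h := hh
      symm_h := fun x a b => (hsymm x).apply b a
      compact := hc
      subset := hsub }
  refine (H.hasDerivAt_action κ).congr_deriv ?_
  exact (isDivergence_variation_density D H κ hE).integral_eq_zero D.isOpen_chart hc hsub

end

/-! ### The field equations in terms of the derivatives of `f` -/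

section

variable {f f₁ f₂ f₃ f₄ f₅ f₆ : ℝ → ℝ} {I : Set ℝ} {R₀ : ℝ}

/-- `f₁, …, f₆` are the derivatives of `f` on the open set `I`. -/
structure HasJets (f f₁ f₂ f₃ f₄ f₅ f₆ : ℝ → ℝ) (I : Set ℝ) : Prop where
  isOpen : IsOpen I
  d₁ : ∀ r ∈ I, HasDerivAt f (f₁ r) r
  d₂ : ∀ r ∈ I, HasDerivAt f₁ (f₂ r) r
  d₃ : ∀ r ∈ I, HasDerivAt f₂ (f₃ r) r
  d₄ : ∀ r ∈ I, HasDerivAt f₃ (f₄ r) r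
  d₅ : ∀ r ∈ I, HasDerivAt f₄ (f₅ r) r
  d₆ : ∀ r ∈ I, HasDerivAt f₅ (f₆ r) r

theorem hasDerivAt_congr_of_isOpen {φ ψ : ℝ → ℝ} {ψ' r : ℝ} (hI : IsOpen I)
    (h : ∀ r ∈ I, φ r = ψ r) (hr : r ∈ I) (hψ : HasDerivAt ψ ψ' r) : HasDerivAt φ ψ' r :=
  hψ.congr_of_eventuallyEq (Filter.eventuallyEq_of_mem (hI.mem_nhds hr) h)

/-- The field equations as polynomial equations for the derivatives of `f` of order up to six, in
terms of the curvature `k` of the spheres, with the combinations of the coupling constants that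
occur in them. -/
def JetEquations (γ Λ n₁ n₂ n₃ q m₁ m₂ m₃ m₄ k f₀ f₁ f₂ f₃ f₄ f₅ f₆ : ℝ) : Prop :=
  ∀ w σ w' w'' b b' b'' : ℝ, w = (k - f₂ / 2) / 3 → σ = -(f₂ / 2 + k) / 2 → w' = -f₃ / 6 →
    w'' = -f₄ / 6 → b = -(f₀ * f₄ + f₁ * f₃) / 6 → b' = -(f₀ * f₅ + 2 * f₁ * f₄ + f₂ * f₃) / 6 →
    b'' = -(f₀ * f₆ + 3 * f₁ * f₅ + 3 * f₂ * f₄ + f₃ ^ 2) / 6 →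
    (n₁ + 2 * n₂ * w + n₃ * (6 * σ + 9 / 2 * w)) * w'' + (2 * n₂ + 27 / 2 * n₃) * w' ^ 2
      + q / 3 * b'' + q * w' ^ 2 = 0 ∧
    (γ * (6 * w - 2 * Λ) + 3 * n₁ * w ^ 2 + q * w * b + 2 * n₂ * w ^ 3 + 6 * n₃ * w * σ ^ 2) / 2
      + (γ + n₁ * w + n₂ * w ^ 2 + n₃ * σ ^ 2 + 3 * n₃ * σ * w + q / 3 * b) * f₂ / 2
      - ((n₁ + 2 * n₂ * w + n₃ * (6 * σ + 9 / 2 * w)) * w' + q / 3 * b') * f₁ / 2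
      + q * (f₀ * (w' ^ 2 - w * w'') - w * f₁ * w') / 2 = 0 ∧
    (γ * (6 * w - 2 * Λ) + 3 * n₁ * w ^ 2 + q * w * b + 2 * n₂ * w ^ 3 + 6 * n₃ * w * σ ^ 2) / 2
      - (γ + n₁ * w + n₂ * w ^ 2 + n₃ * σ ^ 2 - 3 * n₃ * σ * w + q / 3 * b) * k
      - (f₀ * ((m₁ + 2 * m₂ * w + 3 * m₃ * σ) * w'' + (2 * m₂ + 9 / 2 * m₃) * w' ^ 2 + m₄ * b'')
        + f₁ * ((m₁ + 2 * m₂ * w + 3 * m₃ * σ) * w' + m₄ * b'))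
      - q * (f₀ * (w' ^ 2 + w * w'') + f₁ * w * w') / 2 = 0

/-- Both `w` and `σ` are affine in `f''`, with `σ' = 3 w'/2`, so derivatives of `σ` can be
eliminated. The coefficients contain `□ w`, of fourth order in `f`; two further derivatives bring
the order to six. -/
theorem HasJets.kundtEquations (J : HasJets f f₁ f₂ f₃ f₄ f₅ f₆ I) (κ : Couplings) {r : ℝ}
    (hr : r ∈ I) (hE : JetEquations κ.γ κ.Λ (12 * κ.β - 4 * κ.α)
      (108 * κ.η₃ + 36 * κ.η₇ + 6 * κ.η₈) (4 * κ.η₄ + 4 / 3 * κ.η₆) (36 * κ.η₂ - 12 * κ.η₁)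
      (12 * κ.β + 2 * κ.α) (108 * κ.η₃ - 3 * κ.η₈) (4 * κ.η₄ - 2 / 3 * κ.η₆)
      (12 * κ.η₂ + 2 * κ.η₁) (R₀ ^ 2)⁻¹ (f r) (f₁ r) (f₂ r) (f₃ r) (f₄ r) (f₅ r) (f₆ r)) :
    KundtEquations κ f R₀ r := by
  have hI := J.isOpen
  set k := (R₀ ^ 2)⁻¹ with hk
  have e1 : ∀ r ∈ I, deriv f r = f₁ r := fun r hr => (J.d₁ r hr).deriv
  have e2 : ∀ r ∈ I, deriv (deriv f) r = f₂ r := fun r hr =>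
    (hasDerivAt_congr_of_isOpen hI e1 hr (J.d₂ r hr)).deriv
  have ew : ∀ r ∈ I, weylFactor f R₀ r = (k - f₂ r / 2) / 3 := fun r hr => by
    rw [weylFactor, curvU, e2 r hr]; ring
  have es : ∀ r ∈ I, ricciSplit f R₀ r = -(f₂ r / 2 + k) / 2 := fun r hr => by
    rw [ricciSplit, curvU, e2 r hr]; ring
  have hw : ∀ r ∈ I, HasDerivAt (weylFactor f R₀) (-f₃ r / 6) r := fun r hr =>
    hasDerivAt_congr_of_isOpen hI ew hr
      (((((J.d₃ r hr).div_const 2).const_sub k).div_const 3).congr_deriv (by ring))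
  have hs : ∀ r ∈ I, HasDerivAt (ricciSplit f R₀) (-f₃ r / 4) r := fun r hr =>
    hasDerivAt_congr_of_isOpen hI es hr
      (((((J.d₃ r hr).div_const 2).add_const k).fun_neg.div_const 2).congr_deriv (by ring))
  have ew1 : ∀ r ∈ I, deriv (weylFactor f R₀) r = -f₃ r / 6 := fun r hr => (hw r hr).deriv
  have hw1 : ∀ r ∈ I, HasDerivAt (deriv (weylFactor f R₀)) (-f₄ r / 6) r := fun r hr =>
    hasDerivAt_congr_of_isOpen hI ew1 hr ((J.d₄ r hr).fun_neg.div_const 6)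
  have eb : ∀ r ∈ I, radialBox f (weylFactor f R₀) r = -(f r * f₄ r + f₁ r * f₃ r) / 6 :=
    fun r hr => by
      rw [radialBox, (hw1 r hr).deriv, ew1 r hr, e1 r hr]; ring
  have hb : ∀ r ∈ I, HasDerivAt (radialBox f (weylFactor f R₀))
      (-(f r * f₅ r + 2 * f₁ r * f₄ r + f₂ r * f₃ r) / 6) r := fun r hr =>
    hasDerivAt_congr_of_isOpen hI eb hr (((((J.d₁ r hr).fun_mul (J.d₅ r hr)).fun_add
      ((J.d₂ r hr).fun_mul (J.d₄ r hr))).fun_neg.div_const 6).congr_deriv (by ring))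
  have hb1 : ∀ r ∈ I, HasDerivAt (fun r => -(f r * f₅ r + 2 * f₁ r * f₄ r + f₂ r * f₃ r) / 6)
      (-(f r * f₆ r + 3 * f₁ r * f₅ r + 3 * f₂ r * f₄ r + f₃ r ^ 2) / 6) r := fun r hr =>
    (((((J.d₁ r hr).fun_mul (J.d₆ r hr)).fun_add
      (((J.d₂ r hr).const_mul 2).fun_mul (J.d₅ r hr))).fun_add
      ((J.d₃ r hr).fun_mul (J.d₄ r hr))).fun_neg.div_const 6).congr_deriv (by ring)
  have ha : ∀ r ∈ I, HasDerivAt (coefScalar κ f R₀) _ r := fun r hr =>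
    (((((hw r hr).const_mul (12 * κ.β)).const_add κ.γ).fun_add
      (((hw r hr).fun_pow 2).const_mul (108 * κ.η₃ + 12 * κ.η₇))).fun_add
      (((hs r hr).fun_pow 2).const_mul (4 * κ.η₄))).fun_add ((hb r hr).const_mul (12 * κ.η₂))
  have hB : ∀ r ∈ I, HasDerivAt (coefSplit κ f R₀) _ r := fun r hr =>
    ((hs r hr).fun_mul (hw r hr)).const_mul (12 * κ.η₄ + 4 * κ.η₆)
  have hc : ∀ r ∈ I, HasDerivAt (coefWeyl κ f R₀) _ r := fun r hr =>
    ((((hw r hr).const_mul (-4 * κ.α)).fun_add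
      (((hs r hr).fun_pow 2).const_mul (4 / 3 * κ.η₆))).fun_add
      (((hw r hr).fun_pow 2).const_mul (24 * κ.η₇ + 6 * κ.η₈))).fun_sub
      ((hb r hr).const_mul (4 * κ.η₁))
  have hn : ∀ r ∈ I, HasDerivAt (coefRadial κ f R₀) _ r := fun r hr =>
    ((ha r hr).fun_add (hB r hr)).fun_add (hc r hr)
  have hm : ∀ r ∈ I, HasDerivAt (coefMixed κ f R₀) _ r := fun r hr =>
    (ha r hr).fun_sub ((hc r hr).div_const 2)
  have en : ∀ r ∈ I, deriv (coefRadial κ f R₀) r =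
      (12 * κ.β - 4 * κ.α + 2 * (108 * κ.η₃ + 36 * κ.η₇ + 6 * κ.η₈) * weylFactor f R₀ r
        + (4 * κ.η₄ + 4 / 3 * κ.η₆) * (6 * ricciSplit f R₀ r + 9 / 2 * weylFactor f R₀ r))
          * (-f₃ r / 6)
        + (36 * κ.η₂ - 12 * κ.η₁) / 3 * (-(f r * f₅ r + 2 * f₁ r * f₄ r + f₂ r * f₃ r) / 6) :=
    fun r hr => by
      rw [(hn r hr).deriv]
      push_cast
      ring
  have em : ∀ r ∈ I, deriv (coefMixed κ f R₀) r =
      (12 * κ.β + 2 * κ.α + 2 * (108 * κ.η₃ - 3 * κ.η₈) * weylFactor f R₀ r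
        + 3 * (4 * κ.η₄ - 2 / 3 * κ.η₆) * ricciSplit f R₀ r) * (-f₃ r / 6)
        + (12 * κ.η₂ + 2 * κ.η₁) * (-(f r * f₅ r + 2 * f₁ r * f₄ r + f₂ r * f₃ r) / 6) :=
    fun r hr => by
      rw [(hm r hr).deriv]
      push_cast
      ring
  have hw3 : ∀ r ∈ I, HasDerivAt (fun r => -f₃ r / 6) (-f₄ r / 6) r := fun r hr =>
    (J.d₄ r hr).fun_neg.div_const 6
  have hn1 : deriv (deriv (coefRadial κ f R₀)) r = _ :=
    (hasDerivAt_congr_of_isOpen hI en hr (((((hw r hr).const_mul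
      (2 * (108 * κ.η₃ + 36 * κ.η₇ + 6 * κ.η₈))).const_add (12 * κ.β - 4 * κ.α)).fun_add
      ((((hs r hr).const_mul 6).fun_add ((hw r hr).const_mul (9 / 2))).const_mul
        (4 * κ.η₄ + 4 / 3 * κ.η₆))).fun_mul (hw3 r hr) |>.fun_add
      ((hb1 r hr).const_mul ((36 * κ.η₂ - 12 * κ.η₁) / 3)))).deriv
  have hm1 : deriv (deriv (coefMixed κ f R₀)) r = _ :=
    (hasDerivAt_congr_of_isOpen hI em hr (((((hw r hr).const_mul
      (2 * (108 * κ.η₃ - 3 * κ.η₈))).const_add (12 * κ.β + 2 * κ.α)).fun_add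
      ((hs r hr).const_mul (3 * (4 * κ.η₄ - 2 / 3 * κ.η₆)))).fun_mul (hw3 r hr) |>.fun_add
      ((hb1 r hr).const_mul (12 * κ.η₂ + 2 * κ.η₁)))).deriv
  obtain ⟨E1, E2, E3⟩ := hE (weylFactor f R₀ r) (ricciSplit f R₀ r) (-f₃ r / 6) (-f₄ r / 6)
    (radialBox f (weylFactor f R₀) r) (-(f r * f₅ r + 2 * f₁ r * f₄ r + f₂ r * f₃ r) / 6)
    (-(f r * f₆ r + 3 * f₁ r * f₅ r + 3 * f₂ r * f₄ r + f₃ r ^ 2) / 6)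
    (ew r hr) (es r hr) rfl rfl (eb r hr) rfl rfl
  have dw1 := (hw1 r hr).deriv
  refine ⟨?_, ?_, ?_⟩
  · rw [hn1, ew1 r hr]
    linear_combination E1
  · rw [en r hr, ew1 r hr, dw1, kundtLagrangian, coefRadial, coefScalar, coefSplit, coefWeyl,
      curvU, e1 r hr, e2 r hr]
    linear_combination E2
  · rw [em r hr, hm1, ew1 r hr, dw1, kundtLagrangian, coefSphere, coefScalar, coefSplit, coefWeyl,
      e1 r hr]
    linear_combination E3

theorem HasJets.isKundtVacuum (J : HasJets f f₁ f₂ f₃ f₄ f₅ f₆ I) (hf : ContDiffOn ℝ ∞ f I)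
    (hR₀ : 0 < R₀) (κ : Couplings)
    (hE : ∀ r ∈ I, JetEquations κ.γ κ.Λ (12 * κ.β - 4 * κ.α)
      (108 * κ.η₃ + 36 * κ.η₇ + 6 * κ.η₈) (4 * κ.η₄ + 4 / 3 * κ.η₆) (36 * κ.η₂ - 12 * κ.η₁)
      (12 * κ.β + 2 * κ.α) (108 * κ.η₃ - 3 * κ.η₈) (4 * κ.η₄ - 2 / 3 * κ.η₆)
      (12 * κ.η₂ + 2 * κ.η₁) (R₀ ^ 2)⁻¹ (f r) (f₁ r) (f₂ r) (f₃ r) (f₄ r) (f₅ r) (f₆ r)) :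
    IsKundtVacuum κ f I R₀ :=
  isKundtVacuum_of_kundtEquations ⟨J.isOpen, hf, hR₀⟩ fun _ hr => J.kundtEquations κ hr (hE _ hr)

end

end

end SixDerivativeGravity


namespace SixDerivativeGravity

noncomputable section

/-! ### Polynomials, powers and arbitrary functions -/

variable {R₀ : ℝ}

theorem isKundtVacuum_quartic (hR₀ : 0 < R₀) (κ : Couplings) (a₀ a₁ a₂ a₃ a₄ : ℝ)
    (hE : ∀ r, JetEquations κ.γ κ.Λ (12 * κ.β - 4 * κ.α)
      (108 * κ.η₃ + 36 * κ.η₇ + 6 * κ.η₈) (4 * κ.η₄ + 4 / 3 * κ.η₆) (36 * κ.η₂ - 12 * κ.η₁)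
      (12 * κ.β + 2 * κ.α) (108 * κ.η₃ - 3 * κ.η₈) (4 * κ.η₄ - 2 / 3 * κ.η₆)
      (12 * κ.η₂ + 2 * κ.η₁) (R₀ ^ 2)⁻¹ (a₀ + a₁ * r + a₂ * r ^ 2 + a₃ * r ^ 3 + a₄ * r ^ 4)
      (a₁ + 2 * a₂ * r + 3 * a₃ * r ^ 2 + 4 * a₄ * r ^ 3) (2 * a₂ + 6 * a₃ * r + 12 * a₄ * r ^ 2)
      (6 * a₃ + 24 * a₄ * r) (24 * a₄) 0 0) :
    IsKundtVacuum κ (fun r => a₀ + a₁ * r + a₂ * r ^ 2 + a₃ * r ^ 3 + a₄ * r ^ 4)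
      Set.univ R₀ := by
  have key : ∀ b₀ b₁ b₂ b₃ b₄ r : ℝ,
      HasDerivAt (fun r => b₀ + b₁ * r + b₂ * r ^ 2 + b₃ * r ^ 3 + b₄ * r ^ 4)
        (b₁ + 2 * b₂ * r + 3 * b₃ * r ^ 2 + 4 * b₄ * r ^ 3) r := fun b₀ b₁ b₂ b₃ b₄ r => by
    refine ((((((hasDerivAt_id r).const_mul b₁).const_add b₀).fun_add
      ((hasDerivAt_pow 2 r).const_mul b₂)).fun_add ((hasDerivAt_pow 3 r).const_mul b₃)).fun_add
      ((hasDerivAt_pow 4 r).const_mul b₄)).congr_deriv ?_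
    push_cast
    ring
  have key' : ∀ (φ ψ : ℝ → ℝ) (b₀ b₁ b₂ b₃ : ℝ),
      (φ = fun r => b₀ + b₁ * r + b₂ * r ^ 2 + b₃ * r ^ 3) →
      (ψ = fun r => b₁ + 2 * b₂ * r + 3 * b₃ * r ^ 2) →
      ∀ r ∈ Set.univ, HasDerivAt φ (ψ r) r := by
    rintro _ _ b₀ b₁ b₂ b₃ rfl rfl r -
    simpa using key b₀ b₁ b₂ b₃ 0 r
  refine HasJets.isKundtVacuum
    (f₁ := fun r => a₁ + 2 * a₂ * r + 3 * a₃ * r ^ 2 + 4 * a₄ * r ^ 3)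
    (f₂ := fun r => 2 * a₂ + 6 * a₃ * r + 12 * a₄ * r ^ 2) (f₃ := fun r => 6 * a₃ + 24 * a₄ * r)
    (f₄ := fun _ => 24 * a₄) (f₅ := fun _ => 0) (f₆ := fun _ => 0)
    ⟨isOpen_univ, fun r _ => key a₀ a₁ a₂ a₃ a₄ r,
      key' _ _ a₁ (2 * a₂) (3 * a₃) (4 * a₄) rfl (by ext; ring),
      key' _ _ (2 * a₂) (6 * a₃) (12 * a₄) 0 (by ext; ring) (by ext; ring),
      key' _ _ (6 * a₃) (24 * a₄) 0 0 (by ext; ring) (by ext; ring),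
      fun r _ => hasDerivAt_const r _, fun r _ => hasDerivAt_const r _⟩
    (ContDiff.contDiffOn (by fun_prop)) hR₀ κ fun r _ => hE r

/-- The substitution `r = x ρ`, `t = τ/x` preserves the form of the metric and replaces `f(r)` by
`f(x ρ)/x²`, under which `f''` is invariant. The null equation has weight `-2` in `x`, the other two
have weight zero. -/
theorem JetEquations.scale {γ Λ n₁ n₂ n₃ q m₁ m₂ m₃ m₄ k f₀ f₁ f₂ f₃ f₄ f₅ f₆ x : ℝ}
    (h : JetEquations γ Λ n₁ n₂ n₃ q m₁ m₂ m₃ m₄ k f₀ f₁ f₂ f₃ f₄ f₅ f₆) (hx : x ≠ 0) :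
    JetEquations γ Λ n₁ n₂ n₃ q m₁ m₂ m₃ m₄ k (f₀ * x ^ 2) (f₁ * x) f₂ (f₃ / x) (f₄ / x ^ 2)
      (f₅ / x ^ 3) (f₆ / x ^ 4) := by
  rintro w σ w' w'' b b' b'' hw hσ hw' hw'' hb hb' hb''
  obtain ⟨h1, h2, h3⟩ := h w σ (w' * x) (w'' * x ^ 2) b (b' * x) (b'' * x ^ 2) hw hσ
    (by rw [hw']; field_simp) (by rw [hw'']; field_simp) (by rw [hb]; field_simp)
    (by rw [hb']; field_simp) (by rw [hb'']; field_simp)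
  refine ⟨?_, ?_, ?_⟩
  · refine (mul_eq_zero.1 (?_ : x ^ 2 * _ = 0)).resolve_left (pow_ne_zero 2 hx)
    linear_combination h1
  · linear_combination h2
  · linear_combination h3

theorem isOpen_powDomain (p : ℝ) : IsOpen (powDomain p) := by
  by_cases hp : ∃ n : ℤ, p = n
  · have : powDomain p = {0}ᶜ := by
      ext r
      simp only [powDomain, hp, and_true, Set.mem_ofPred_eq, Set.mem_compl_iff,
        Set.mem_singleton_iff]
      exact ⟨fun h => h.elim ne_of_gt id, Or.inr⟩
    rw [this]
    exact isOpen_compl_singleton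
  · have : powDomain p = Set.Ioi 0 := by
      ext r
      simp [powDomain, hp]
    rw [this]
    exact isOpen_Ioi

theorem ne_zero_of_mem_powDomain {p r : ℝ} (hr : r ∈ powDomain p) : r ≠ 0 :=
  hr.elim ne_of_gt And.left

/-- The jet of `A (r + b) ^ 2 + C (r + b) ^ p` satisfies the field equations if it does so at
`r + b = 1`, for all values of `C`. -/
theorem isKundtVacuum_power (hR₀ : 0 < R₀) (κ : Couplings) (A C b p : ℝ) {I : Set ℝ}
    (hI : IsOpen I) (hb : ∀ r ∈ I, r + b ≠ 0)
    (hE : ∀ z, JetEquations κ.γ κ.Λ (12 * κ.β - 4 * κ.α)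
      (108 * κ.η₃ + 36 * κ.η₇ + 6 * κ.η₈) (4 * κ.η₄ + 4 / 3 * κ.η₆) (36 * κ.η₂ - 12 * κ.η₁)
      (12 * κ.β + 2 * κ.α) (108 * κ.η₃ - 3 * κ.η₈) (4 * κ.η₄ - 2 / 3 * κ.η₆)
      (12 * κ.η₂ + 2 * κ.η₁) (R₀ ^ 2)⁻¹ (A + z) (2 * A + p * z) (2 * A + p * (p - 1) * z)
      (p * (p - 1) * (p - 2) * z) (p * (p - 1) * (p - 2) * (p - 3) * z)
      (p * (p - 1) * (p - 2) * (p - 3) * (p - 4) * z)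
      (p * (p - 1) * (p - 2) * (p - 3) * (p - 4) * (p - 5) * z)) :
    IsKundtVacuum κ (fun r => A * (r + b) ^ 2 + C * (r + b) ^ p) I R₀ := by
  have key : ∀ c s : ℝ, ∀ r ∈ I,
      HasDerivAt (fun r => c * (r + b) ^ s) (c * s * (r + b) ^ (s - 1)) r := fun c s r hr =>
    ((((hasDerivAt_id r).add_const b).rpow_const (p := s) (Or.inl (hb r hr))).const_mul
      c).congr_deriv (by simp; ring)
  have h2 : ∀ r ∈ I, HasDerivAt (fun r => A * (r + b) ^ 2) (2 * A * (r + b)) r := fun r hr =>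
    ((((hasDerivAt_id r).add_const b).fun_pow 2).const_mul A).congr_deriv (by simp; ring)
  have h1 : ∀ r ∈ I, HasDerivAt (fun r => 2 * A * (r + b)) (2 * A) r := fun r hr =>
    (((hasDerivAt_id r).add_const b).const_mul (2 * A)).congr_deriv (by simp)
  refine HasJets.isKundtVacuum
    (f₁ := fun r => 2 * A * (r + b) + C * p * (r + b) ^ (p - 1))
    (f₂ := fun r => 2 * A + C * p * (p - 1) * (r + b) ^ (p - 1 - 1))
    (f₃ := fun r => C * p * (p - 1) * (p - 1 - 1) * (r + b) ^ (p - 1 - 1 - 1))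
    (f₄ := fun r => C * p * (p - 1) * (p - 1 - 1) * (p - 1 - 1 - 1) *
      (r + b) ^ (p - 1 - 1 - 1 - 1))
    (f₅ := fun r => C * p * (p - 1) * (p - 1 - 1) * (p - 1 - 1 - 1) * (p - 1 - 1 - 1 - 1) *
      (r + b) ^ (p - 1 - 1 - 1 - 1 - 1))
    (f₆ := fun r => C * p * (p - 1) * (p - 1 - 1) * (p - 1 - 1 - 1) * (p - 1 - 1 - 1 - 1) *
      (p - 1 - 1 - 1 - 1 - 1) * (r + b) ^ (p - 1 - 1 - 1 - 1 - 1 - 1))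
    ⟨hI, fun r hr => (h2 r hr).fun_add (key _ _ r hr),
      fun r hr => (h1 r hr).fun_add (key _ _ r hr), fun r hr => (key _ _ r hr).const_add _,
      key _ _, key _ _, key _ _⟩ ?_ hR₀ κ fun r hr => ?_
  · intro r hr
    refine ContDiffAt.contDiffWithinAt (ContDiffAt.add (by fun_prop) (contDiffAt_const.mul ?_))
    exact (Real.contDiffAt_rpow_const_of_ne (hb r hr)).comp r
      (f := fun r => r + b) (contDiffAt_id.add contDiffAt_const)
  · have hx := hb r hr
    -- With `x = r + b`, scaling `x` to `1` fixes the coefficient `A` of the square and turns the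
    -- power into `z = C x^p / x²`.
    have h := (hE (C * (r + b) ^ p / (r + b) ^ 2)).scale hx
    simp only [Real.rpow_sub_one hx]
    convert h using 1 <;> field_simp <;> ring

/-- For an unspecified function the derivatives up to order six are treated as independent, so the
equations are required as identities in them. -/
theorem isKundtVacuum_of_contDiffOn (hR₀ : 0 < R₀) (κ : Couplings) {f : ℝ → ℝ} {I : Set ℝ}
    (hI : IsOpen I) (hf : ContDiffOn ℝ ∞ f I)
    (hE : ∀ f₀ f₁ f₂ f₃ f₄ f₅ f₆, JetEquations κ.γ κ.Λ (12 * κ.β - 4 * κ.α)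
      (108 * κ.η₃ + 36 * κ.η₇ + 6 * κ.η₈) (4 * κ.η₄ + 4 / 3 * κ.η₆) (36 * κ.η₂ - 12 * κ.η₁)
      (12 * κ.β + 2 * κ.α) (108 * κ.η₃ - 3 * κ.η₈) (4 * κ.η₄ - 2 / 3 * κ.η₆)
      (12 * κ.η₂ + 2 * κ.η₁) (R₀ ^ 2)⁻¹ f₀ f₁ f₂ f₃ f₄ f₅ f₆) :
    IsKundtVacuum κ f I R₀ := by
  have step : ∀ φ : ℝ → ℝ, ContDiffOn ℝ ∞ φ I →
      ContDiffOn ℝ ∞ (deriv φ) I ∧ ∀ r ∈ I, HasDerivAt φ (deriv φ r) r := fun φ hφ =>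
    ⟨((contDiffOn_infty_iff_deriv_of_isOpen hI).1 hφ).2, fun r hr =>
      ((hφ.differentiableOn (by simp)).differentiableAt (hI.mem_nhds hr)).hasDerivAt⟩
  obtain ⟨s1, d1⟩ := step f hf
  obtain ⟨s2, d2⟩ := step _ s1
  obtain ⟨s3, d3⟩ := step _ s2
  obtain ⟨s4, d4⟩ := step _ s3
  obtain ⟨s5, d5⟩ := step _ s4
  obtain ⟨-, d6⟩ := step _ s5
  exact HasJets.isKundtVacuum ⟨hI, d1, d2, d3, d4, d5, d6⟩ hf hR₀ κ fun r _ => hE _ _ _ _ _ _ _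

end

end SixDerivativeGravity


namespace SixDerivativeGravity

noncomputable section

/-! ### Solutions with polynomial or arbitrary functions -/

variable {R₀ : ℝ} {κ : Couplings}

theorem exists_sq_eq_inv (hR₀ : 0 < R₀) : ∃ k : ℝ, 0 < k ∧ R₀ ^ 2 = k⁻¹ ∧ R₀ ^ 4 = (k ^ 2)⁻¹ :=
  ⟨(R₀ ^ 2)⁻¹, by positivity, by rw [inv_inv], by rw [inv_pow, inv_inv]; ring⟩

/-- For a quadratic function the field equations are two algebraic equations. -/
theorem isKundtVacuum_quadratic (hR₀ : 0 < R₀) {k : ℝ} (hk : R₀ ^ 2 = k⁻¹) (a₀ a₁ : ℝ)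
    {a₂ w σ L M : ℝ} (hw : w = (k - a₂) / 3) (hσ : σ = -(a₂ + k) / 2)
    (hL : L = κ.γ * (3 * w - κ.Λ) - 6 * (κ.α - 3 * κ.β) * w ^ 2 + 3 * κ.c₁ * w ^ 3
      - 4 / 3 * κ.c₂ * w * σ ^ 2)
    (hM : M = κ.γ - 4 * (κ.α - 3 * κ.β) * w + 3 * κ.c₁ * w ^ 2 - 4 / 9 * κ.c₂ * σ ^ 2)
    (h₁ : L + (M - 4 / 3 * κ.c₂ * σ * w) * a₂ = 0)
    (h₂ : L - (M + 4 / 3 * κ.c₂ * σ * w) * k = 0) :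
    IsKundtVacuum κ (fun r => a₀ + a₁ * r + a₂ * r ^ 2) Set.univ R₀ := by
  subst hL hM
  -- With constant curvature the couplings enter only through `n₁ = -4 (α - 3β)`, `n₂ = 3 c₁` and
  -- `n₃ = -4 c₂/9`, apart from `γ` and `Λ`.
  simp only [Couplings.c₁, Couplings.c₂] at h₁ h₂
  convert isKundtVacuum_quartic hR₀ κ a₀ a₁ a₂ 0 0 ?_ using 2
  · simp
  intro r
  rw [hk, inv_inv]
  rintro w₁ σ₁ _ _ _ _ _ h h' rfl rfl rfl rfl rfl
  obtain rfl : w₁ = w := by rw [h, hw]; ring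
  obtain rfl : σ₁ = σ := by rw [h', hσ]; ring
  -- The null equation is trivial because all derivatives of `f` from the third on vanish.
  refine ⟨by ring, ?_, ?_⟩
  · linear_combination h₁
  · linear_combination h₂

/-- Equal curvatures of the two factors mean `σ = 0`, so `c₂` drops out; `α` and `β` cancel since
terms quadratic in curvature are scale invariant in dimension four. The two algebraic equations
coincide. -/
theorem isKundtVacuum_nariai (hR₀ : 0 < R₀)
    (h : 9 * κ.γ * R₀ ^ 4 * (κ.Λ * R₀ ^ 2 - 1) + 4 * κ.c₁ = 0) (a₀ a₁ a₂ : ℝ)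
    (ha : a₂ = -1 / R₀ ^ 2) :
    IsKundtVacuum κ (fun r => a₀ + a₁ * r + a₂ * r ^ 2) Set.univ R₀ := by
  obtain ⟨k, hk, h2, h4⟩ := exists_sq_eq_inv hR₀
  rw [h2, h4] at h
  rw [h2, div_inv_eq_mul, neg_one_mul] at ha
  subst ha
  field_simp at h
  refine isKundtVacuum_quadratic hR₀ h2 a₀ a₁ rfl rfl rfl rfl ?_ ?_
  · linear_combination (-1 / 9) * h
  · linear_combination (-1 / 9) * h

/-- The relation `R₀ ^ 2 = 2 / 3 * √(c / γ)` without the square root. -/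
theorem radius_relation {c γ : ℝ} (h : 0 < c / γ) (hR : R₀ ^ 2 = 2 / 3 * √(c / γ)) :
    9 * γ * R₀ ^ 4 = 4 * c := by
  have hγ : γ ≠ 0 := fun h0 => by simp [h0] at h
  have h4 : R₀ ^ 4 = 4 / 9 * (c / γ) := by
    rw [← Real.sq_sqrt h.le]
    linear_combination (R₀ ^ 2 + 2 / 3 * √(c / γ)) * hR
  rw [h4]
  field_simp

/-- Opposite curvatures mean `w = 0`; the sum and difference of the two equations are `γ Λ = 0` and
`9 γ = 4 c₂ k²`. -/
theorem isKundtVacuum_bertottiRobinson (hR₀ : 0 < R₀) (hΛ : κ.γ * κ.Λ = 0)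
    (h : 9 * κ.γ * R₀ ^ 4 = 4 * κ.c₂) (a₀ a₁ a₂ : ℝ) (ha : a₂ = 1 / R₀ ^ 2) :
    IsKundtVacuum κ (fun r => a₀ + a₁ * r + a₂ * r ^ 2) Set.univ R₀ := by
  obtain ⟨k, hk, h2, h4⟩ := exists_sq_eq_inv hR₀
  rw [h4] at h
  rw [h2, div_inv_eq_mul, one_mul] at ha
  subst ha
  field_simp at h
  refine isKundtVacuum_quadratic hR₀ h2 a₀ a₁ rfl rfl rfl rfl ?_ ?_
  · linear_combination a₂ / 9 * h - hΛ
  · linear_combination -a₂ / 9 * h - hΛ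

/-- With `m` the ratio of the curvatures of the two factors, the prescribed `a₂` fixes `γ` in terms
of `m`, and both equations reduce to the quadratic equation `c₁ (m + 1)² = c₂ (m² + 1)`. The sign
`s` selects its root. -/
theorem isKundtVacuum_bachian (hR₀ : 0 < R₀) (hΛ : κ.Λ = 0) (hδ : κ.α = 3 * κ.β) {s : ℝ}
    (hs : s = 1 ∨ s = -1) (hQ : 0 ≤ κ.c₂ ^ 3 * (2 * κ.c₁ - κ.c₂))
    (hρ : 0 < (κ.c₁ * κ.c₂ + s * √(κ.c₂ ^ 3 * (2 * κ.c₁ - κ.c₂))) / ((κ.c₂ - κ.c₁) * κ.γ))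
    (hR : R₀ ^ 2 = √2 / 3 *
      √((κ.c₁ * κ.c₂ + s * √(κ.c₂ ^ 3 * (2 * κ.c₁ - κ.c₂))) / ((κ.c₂ - κ.c₁) * κ.γ)))
    (a₀ a₁ a₂ : ℝ) (ha : a₂ = -(9 * κ.γ * R₀ ^ 2) / (2 * κ.c₂)) :
    IsKundtVacuum κ (fun r => a₀ + a₁ * r + a₂ * r ^ 2) Set.univ R₀ := by
  obtain ⟨k, hk, h2, h4⟩ := exists_sq_eq_inv hR₀
  have hk0 := hk.ne'
  have hden : (κ.c₂ - κ.c₁) * κ.γ ≠ 0 := fun h0 => by simp [h0] at hρ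
  have hc : κ.c₂ - κ.c₁ ≠ 0 := left_ne_zero_of_mul hden
  have hγ : κ.γ ≠ 0 := right_ne_zero_of_mul hden
  have hc₂ : κ.c₂ ≠ 0 := fun h0 => by simp [h0] at hρ
  have hs2 : s ^ 2 = 1 := by rcases hs with rfl | rfl <;> norm_num
  have hQ2 := Real.sq_sqrt hQ
  have h22 := Real.sq_sqrt (zero_le_two (α := ℝ))
  have hρ2 := Real.sq_sqrt hρ.le
  set Q := √(κ.c₂ ^ 3 * (2 * κ.c₁ - κ.c₂))
  set ρ := (κ.c₁ * κ.c₂ + s * Q) / ((κ.c₂ - κ.c₁) * κ.γ) with hρdef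
  have hR4 : R₀ ^ 4 = 2 / 9 * ρ := by
    linear_combination (R₀ ^ 2 + √2 / 3 * √ρ) * hR + √ρ ^ 2 / 9 * h22 + 2 / 9 * hρ2
  -- The value of `m` for which `a₂ = -m k`.
  obtain ⟨m, hm⟩ : ∃ m, m = 9 / 2 * κ.γ / (κ.c₂ * k ^ 2) := ⟨_, rfl⟩
  have hγm : κ.γ = 2 / 9 * m * κ.c₂ * k ^ 2 := by rw [hm]; field_simp
  have ham : a₂ = -m * k := by rw [ha, h2, hm]; field_simp
  have e : (κ.c₂ - κ.c₁) * (m * κ.c₂) = κ.c₁ * κ.c₂ + s * Q := by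
    have : ρ = 9 / 2 * (k ^ 2)⁻¹ := by rw [← h4, hR4]; ring
    rw [hρdef, div_eq_iff hden] at this
    rw [this, hm]
    field_simp
  -- The square root is eliminated by multiplying `e` with its conjugate and using `s² = 1`.
  have h3 : κ.c₁ * (m + 1) ^ 2 = κ.c₂ * (m ^ 2 + 1) := by
    refine mul_left_cancel₀ (mul_ne_zero hc (pow_ne_zero 2 hc₂)) ?_
    linear_combination -((κ.c₂ - κ.c₁) * (m * κ.c₂) - κ.c₁ * κ.c₂ + s * Q) * e - Q ^ 2 * hs2 - hQ2
  refine isKundtVacuum_quadratic hR₀ h2 a₀ a₁ rfl rfl rfl rfl ?_ ?_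
  · rw [hΛ, hδ, hγm, ham]
    linear_combination k ^ 3 * (1 - 2 * m) / 9 * h3
  · rw [hΛ, hδ, hγm, ham]
    linear_combination k ^ 3 * (m - 2) / 9 * h3

/-- A flat `t, r` surface leaves two equations: one is `3 γ R₀⁴ - 4 (α - 3β) R₀² + c₃ = 0`, with `c₃
= c₁ - c₂`, whose roots are the stated radii; the other then determines `Λ`. -/
theorem isKundtVacuum_linear (hR₀ : 0 < R₀) (hγ : κ.γ ≠ 0) {s : ℝ} (hs : s = 1 ∨ s = -1)
    (hQ : 0 ≤ 4 * (κ.α - 3 * κ.β) ^ 2 - 3 * κ.γ * κ.c₃)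
    (hR : R₀ ^ 2 = (2 * (κ.α - 3 * κ.β) + s * √(4 * (κ.α - 3 * κ.β) ^ 2 - 3 * κ.γ * κ.c₃))
      / (3 * κ.γ))
    (hΛ : κ.Λ = -(2 * (κ.α - 3 * κ.β - 3 * κ.γ * R₀ ^ 2)) / (9 * κ.γ * R₀ ^ 4)) (a₀ a₁ : ℝ) :
    IsKundtVacuum κ (fun r => a₀ + a₁ * r) Set.univ R₀ := by
  obtain ⟨k, hk, h2, h4⟩ := exists_sq_eq_inv hR₀
  have hs2 : s ^ 2 = 1 := by rcases hs with rfl | rfl <;> norm_num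
  have hQ2 := Real.sq_sqrt hQ
  set Q := √(4 * (κ.α - 3 * κ.β) ^ 2 - 3 * κ.γ * κ.c₃)
  rw [eq_div_iff (by simpa using hγ)] at hR
  have hX : 3 * κ.γ * (R₀ ^ 2) ^ 2 - 4 * (κ.α - 3 * κ.β) * R₀ ^ 2 + κ.c₃ = 0 := by
    refine mul_left_cancel₀ (mul_ne_zero three_ne_zero hγ) ?_
    linear_combination (3 * κ.γ * R₀ ^ 2 - 2 * (κ.α - 3 * κ.β) + s * Q) * hR + Q ^ 2 * hs2 + hQ2
  rw [h2, h4, eq_div_iff (by positivity)] at hΛ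
  rw [h2] at hX
  field_simp at hX hΛ
  have e := isKundtVacuum_quadratic (κ := κ) (a₂ := 0) hR₀ h2 a₀ a₁ rfl rfl rfl rfl ?_ ?_
  · simpa using e
  · simp only [Couplings.c₁, Couplings.c₂, Couplings.c₃] at hX ⊢
    linear_combination k / 9 * hX - hΛ / 9
  · simp only [Couplings.c₁, Couplings.c₂, Couplings.c₃] at hX ⊢
    linear_combination -2 / 9 * k * hX - hΛ / 9

/-- The coupling `η₅` multiplies an invariant that vanishes together with its first variation, so it
does not appear in the jet equations. -/
theorem isKundtVacuum_of_only_η₅ (hR₀ : 0 < R₀) (hγ : κ.γ = 0) (hα : κ.α = 0) (hβ : κ.β = 0)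
    (h₁ : κ.η₁ = 0) (h₂ : κ.η₂ = 0) (h₃ : κ.η₃ = 0) (h₄ : κ.η₄ = 0) (h₆ : κ.η₆ = 0)
    (h₇ : κ.η₇ = 0) (h₈ : κ.η₈ = 0) {f : ℝ → ℝ} {I : Set ℝ} (hI : IsOpen I)
    (hf : ContDiffOn ℝ ∞ f I) : IsKundtVacuum κ f I R₀ := by
  refine isKundtVacuum_of_contDiffOn hR₀ κ hI hf fun f₀ f₁ f₂ f₃ f₄ f₅ f₆ => ?_
  rw [hγ, hα, hβ, h₁, h₂, h₃, h₄, h₆, h₇, h₈]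
  rintro _ _ _ _ _ _ _ - - - - - - -
  refine ⟨by ring, by ring, by ring⟩

theorem isKundtVacuum_of_radius (hR₀ : 0 < R₀) (hγ : κ.γ = 0) (h₁ : κ.η₁ = 0) (h₂ : κ.η₂ = 0)
    (hδ : κ.α = 3 * κ.β) (hβ : κ.β ≠ 0) (h₆ : κ.η₆ = -3 * κ.η₄) (h₄ : κ.η₄ ≠ 0)
    (h₇ : κ.η₇ = -(3 / 4) * (12 * κ.η₃ + κ.η₄)) (h₈ : κ.η₈ = 9 / 2 * (8 * κ.η₃ + κ.η₄))
    (hR : R₀ ^ 2 = κ.η₄ / κ.β) {f : ℝ → ℝ} {I : Set ℝ} (hI : IsOpen I)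
    (hf : ContDiffOn ℝ ∞ f I) : IsKundtVacuum κ f I R₀ := by
  refine isKundtVacuum_of_contDiffOn hR₀ κ hI hf fun f₀ f₁ f₂ f₃ f₄ f₅ f₆ => ?_
  -- The condition on the radius is read as a formula for `β`; the equations then hold identically
  -- in the derivatives of `f`.
  have hk : κ.β = κ.η₄ * (R₀ ^ 2)⁻¹ := by rw [hR]; field_simp
  rw [hγ, h₁, h₂, h₆, h₇, h₈, hδ, hk]
  rintro _ _ _ _ _ _ _ rfl rfl rfl rfl rfl rfl rfl
  refine ⟨by ring, by ring, by ring⟩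

/-- The couplings for which the cubic functions are solutions, up to a relation between `α`, `Λ`
and the coefficients of the function. -/
theorem isKundtVacuum_cubic (hR₀ : 0 < R₀) {k : ℝ} (hk : R₀ ^ 2 = k⁻¹) (hβ : κ.β = 0)
    (h₁ : κ.η₁ = 3 * κ.η₂) (h₆ : κ.η₁ = 1 / 6 * (6 * κ.η₄ - κ.η₆))
    (h₃ : κ.η₃ = -(1 / 108) * (3 * κ.η₄ + 4 * κ.η₆ + 12 * κ.η₇))
    (h₈ : 2 * κ.η₁ - 6 * κ.η₂ + κ.c₃ = 0) (hγ : 9 * κ.γ = 4 * κ.c₂ * k ^ 2)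
    (hα : κ.Λ * (4 * k * κ.α - 3 * κ.γ) = 0)
    (a₀ a₁ a₂ a₃ : ℝ) (ha : 3 * a₁ * a₃ = a₂ ^ 2 + 2 * κ.Λ * k - k ^ 2) :
    IsKundtVacuum κ (fun r => a₀ + a₁ * r + a₂ * r ^ 2 + a₃ * r ^ 3) Set.univ R₀ := by
  convert isKundtVacuum_quartic hR₀ κ a₀ a₁ a₂ a₃ 0 ?_ using 2
  · simp
  intro r
  rw [hk, inv_inv]
  simp only [Couplings.c₂, Couplings.c₃] at h₈ hγ
  have e6 : κ.η₆ = 6 * κ.η₄ - 18 * κ.η₂ := by linarith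
  -- For a cubic the null equation is `f'''²` times a multiple of the left side of `h₈`. With `η₁ =
  -- 3 η₂` it says `c₃ = 0`.
  have e8 : κ.η₈ = -(36 * κ.η₃ + 9 * κ.η₄ + 3 * κ.η₆ + 12 * κ.η₇) / 2 := by linarith
  have eγ : κ.γ = -12 * k ^ 2 * (κ.η₄ - 2 * κ.η₂) := by
    rw [e6] at hγ; linear_combination hγ / 9
  rw [e8, h₃, e6, h₁, hβ]
  rintro _ _ _ _ _ _ _ rfl rfl rfl rfl rfl rfl rfl
  rw [eγ] at hα ⊢
  refine ⟨by ring, ?_, ?_⟩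
  -- The combination `a₂² - 3 a₁ a₃ = (f''² - 2 f' f''')/4` is constant in `r`; the equations
  -- constrain only this combination, so `a₀` stays free.
  · linear_combination (-2 / 3 * κ.α - 12 * k * (κ.η₄ - 2 * κ.η₂)) * ha - hα / 3
  · linear_combination 2 / 3 * κ.α * ha + hα / 3

end

end SixDerivativeGravity


namespace SixDerivativeGravity

noncomputable section

/-! ### Solutions with powers -/

variable {R₀ : ℝ} {κ : Couplings}

theorem isKundtVacuum_square_add_power (hR₀ : 0 < R₀) {p : ℝ} (hp0 : p ≠ 0) (hp1 : p ≠ 1)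
    (hγ : κ.γ = 0) (hδ : κ.α = 3 * κ.β) (h₁ : κ.η₁ = 3 * κ.η₂) (h₆ : κ.η₆ = -3 * κ.η₄)
    (h₇ : κ.η₇ = 6 * (p - 2) * (2 * p - 3) * κ.η₂ / ((p - 1) * p) - 9 * κ.η₃ - 3 * κ.η₄ / 4)
    (h₈ : κ.η₈ = -6 * (3 * κ.η₃ + κ.η₇)) {A : ℝ} (C : ℝ)
    (hd : (p - 1) * p * κ.β + (p - 3) * (p - 2) * (p ^ 2 + p - 4) * A * κ.η₂ ≠ 0)
    (hR : R₀ ^ 2 = -(4 * (p - 2) * (2 * p - 3) * κ.η₂ - (p - 1) * p * κ.η₄) /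
      ((p - 1) * p * κ.β + (p - 3) * (p - 2) * (p ^ 2 + p - 4) * A * κ.η₂)) :
    IsKundtVacuum κ (fun r => A * r ^ 2 + C * r ^ p) (powDomain p) R₀ := by
  obtain ⟨k, hk, h2, -⟩ := exists_sq_eq_inv hR₀
  have hp1' := sub_ne_zero.2 hp1
  rw [h2, eq_div_iff hd] at hR
  -- The relation for the radius is linear in `β`; solving it for `β` leaves `k` and the coefficient
  -- `A` as free parameters.
  have hβ : κ.β = (-k * (4 * (p - 2) * (2 * p - 3) * κ.η₂ - (p - 1) * p * κ.η₄)
      - (p - 3) * (p - 2) * (p ^ 2 + p - 4) * A * κ.η₂) / ((p - 1) * p) := by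
    field_simp at hR ⊢
    linear_combination hR
  have e := isKundtVacuum_power hR₀ κ A C 0 p (isOpen_powDomain p)
    (fun r hr => by simpa using ne_zero_of_mem_powDomain hr) fun z => ?_
  · simpa using e
  rw [h2, inv_inv, h₈, h₇, h₆, h₁, hδ, hγ, hβ]
  rintro _ _ _ _ _ _ _ rfl rfl rfl rfl rfl rfl rfl
  refine ⟨?_, ?_, ?_⟩ <;> field_simp <;> ring

theorem isKundtVacuum_monomial (hR₀ : 0 < R₀) {p : ℝ} (hp0 : p ≠ 0) (hp1 : p ≠ 1)
    (hp3 : p ≠ 3 / 2) (hp2 : p ≠ 2) (hq : p * (5 * p - 21) + 20 ≠ 0) (hΛ : κ.Λ ≠ 0)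
    (hα : κ.α = 9 * κ.η₄ * κ.Λ
      - κ.γ * (p - 1) * (3 * p - 4) * p ^ 2 /
        (36 * κ.Λ * (p - 2) * (2 * p - 3) * (p * (5 * p - 21) + 20))
      - 12 * κ.η₁ * κ.Λ * (p - 2) * (2 * p - 3) / ((p - 1) * p))
    (hβ : κ.β = -(κ.γ / (6 * κ.Λ)) + 3 * κ.η₄ * κ.Λ
      - κ.γ * (p - 1) * (3 * p - 4) * p ^ 2 /
        (108 * κ.Λ * (p - 2) * (2 * p - 3) * (p * (5 * p - 21) + 20))
      - 4 * κ.η₁ * κ.Λ * (p - 2) * (2 * p - 3) / ((p - 1) * p))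
    (h₂ : κ.η₂ = κ.η₁ / 3
      + κ.γ * (p - 1) * p * (2 * p - 5) / (54 * κ.Λ ^ 2 * (p - 2) * (p * (5 * p - 21) + 20)))
    (h₆ : κ.η₆ = -3 * κ.η₄)
    (h₇ : κ.η₇ = -9 * κ.η₃ - 3 * κ.η₄ / 4
      + κ.γ * (7 * p - 15) * (13 * (p - 4) * p + 48) /
        (216 * κ.Λ ^ 2 * (p - 2) * (p * (5 * p - 21) + 20))
      + 2 * κ.η₁ * (p - 2) * (2 * p - 3) / ((p - 1) * p))
    (h₈ : κ.η₈ = 36 * κ.η₃ + 9 * κ.η₄ / 2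
      + κ.γ * (p * ((373 - 61 * p) * p - 744) + 480) /
        (36 * κ.Λ ^ 2 * (p - 2) * (p * (5 * p - 21) + 20))
      - 12 * κ.η₁ * (p - 2) * (2 * p - 3) / ((p - 1) * p))
    (hR : R₀ ^ 2 = 1 / (3 * κ.Λ)) (C : ℝ) :
    IsKundtVacuum κ (fun r => C * r ^ p) (powDomain p) R₀ := by
  have hp1' := sub_ne_zero.2 hp1
  have hp2' := sub_ne_zero.2 hp2
  have hp3' : 2 * p - 3 ≠ 0 := fun h => hp3 (by linarith)
  -- The quadratic in `p` occurs in the denominators and is kept as a single nonzero quantity until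
  -- these are cleared; its value is needed only in the final polynomial identity.
  obtain ⟨q, hqdef⟩ : ∃ q, q = p * (5 * p - 21) + 20 := ⟨_, rfl⟩
  have e := isKundtVacuum_power hR₀ κ 0 C 0 p (isOpen_powDomain p)
    (fun r hr => by simpa using ne_zero_of_mem_powDomain hr) fun z => ?_
  · simpa using e
  rw [← hqdef] at hq hα hβ h₂ h₇ h₈
  rw [hR, one_div, inv_inv, h₈, h₇, h₆, h₂, hα, hβ]
  rintro _ _ _ _ _ _ _ rfl rfl rfl rfl rfl rfl rfl
  refine ⟨?_, ?_, ?_⟩ <;> field_simp <;> rw [hqdef] <;> ring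

theorem isKundtVacuum_square_add_fourth (hR₀ : 0 < R₀) (hγ : κ.γ ≠ 0) (hδ : κ.α ≠ 3 * κ.β)
    (h₁₂ : κ.η₁ = -69 * κ.η₂) (h₁ : κ.η₁ = 391 * (κ.α - 3 * κ.β) ^ 2 / (2214 * κ.γ))
    (h₄ : κ.η₄ = 2 * (104 * κ.α - 5847 * κ.β) * (κ.α - 3 * κ.β) / (16605 * κ.γ))
    (h₆ : κ.η₆ = 2 * (κ.α - 3 * κ.β) * (1201 * κ.α + 1932 * κ.β) / (5535 * κ.γ))
    (h₇ : κ.η₇ = -((1987 * κ.α - 22566 * κ.β) * (κ.α - 3 * κ.β) / (33210 * κ.γ)) - 9 * κ.η₃)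
    (h₈ : κ.η₈ = -((κ.α - 3 * κ.β) * (4648 * κ.α + 2661 * κ.β) / (5535 * κ.γ)) + 36 * κ.η₃)
    (hΛ : κ.Λ = -(8883 * κ.γ / (1312 * (κ.α - 3 * κ.β))))
    (hR : R₀ ^ 2 = -(2 * (κ.α - 3 * κ.β) / (3 * κ.γ))) (a₄ : ℝ) :
    IsKundtVacuum κ (fun r => 15 * κ.γ * r ^ 2 / (8 * (κ.α - 3 * κ.β)) + a₄ * r ^ 4)
      Set.univ R₀ := by
  -- Taking `δ` and `β` as independent parameters, with `α = δ + 3β`, makes all denominators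
  -- monomials in `γ` and `δ`.
  obtain ⟨δ, hδdef⟩ : ∃ δ, δ = κ.α - 3 * κ.β := ⟨_, rfl⟩
  have hδ0 : δ ≠ 0 := by rw [hδdef]; exact sub_ne_zero.2 hδ
  have hα : κ.α = δ + 3 * κ.β := by rw [hδdef]; ring
  have h₂ : κ.η₂ = -κ.η₁ / 69 := by rw [h₁₂]; ring
  rw [← hδdef] at h₁ h₄ h₆ h₇ h₈ hΛ hR ⊢
  have e := isKundtVacuum_quartic hR₀ κ 0 0 (15 * κ.γ / (8 * δ)) 0 a₄ fun r => ?_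
  · convert e using 2
    ring
  rw [hR, h₈, h₇, h₆, h₄, h₂, h₁, hΛ, hα]
  rintro _ _ _ _ _ _ _ rfl rfl rfl rfl rfl rfl rfl
  refine ⟨?_, ?_, ?_⟩ <;> field_simp <;> ring

theorem isKundtVacuum_fiveHalves₁ (hR₀ : 0 < R₀) (hγ : κ.γ ≠ 0) (hδ : κ.α ≠ 3 * κ.β)
    (h₁ : κ.η₁ = 3 * κ.η₂)
    (h₈ : κ.η₈ = 19 * (κ.α - 3 * κ.β) * (κ.α + 141 * κ.β) / (3072 * κ.γ) - 27 * κ.η₂ / 8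
      + 36 * κ.η₃)
    (h₇ : κ.η₇ = 19 * (7 * κ.α - 165 * κ.β) * (κ.α - 3 * κ.β) / (18432 * κ.γ) + 9 * κ.η₂ / 16
      - 9 * κ.η₃)
    (h₆ : κ.η₆ = 19 * (31 * κ.α - 237 * κ.β) * (κ.α - 3 * κ.β) / (4608 * κ.γ) - 83 * κ.η₂ / 20)
    (h₄ : κ.η₄ = -(19 * (7 * κ.α - 165 * κ.β) * (κ.α - 3 * κ.β) / (13824 * κ.γ)) + 83 * κ.η₂ / 60)
    (hΛ : κ.Λ = -(224 * κ.γ / (361 * (κ.α - 3 * κ.β))))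
    (hR : R₀ ^ 2 = 19 * (κ.α - 3 * κ.β) / (96 * κ.γ)) (b c : ℝ) :
    IsKundtVacuum κ (fun r => -(96 * κ.γ * (r + b) ^ 2 / (19 * (κ.α - 3 * κ.β)))
      + c * (r + b) ^ (5 / 2 : ℝ)) (Set.Ioi (-b)) R₀ := by
  obtain ⟨δ, hδdef⟩ : ∃ δ, δ = κ.α - 3 * κ.β := ⟨_, rfl⟩
  have hδ0 : δ ≠ 0 := by rw [hδdef]; exact sub_ne_zero.2 hδ
  have hα : κ.α = δ + 3 * κ.β := by rw [hδdef]; ring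
  rw [← hδdef] at h₄ h₆ h₇ h₈ hΛ hR ⊢
  have e := isKundtVacuum_power hR₀ κ (-(96 * κ.γ / (19 * δ))) c b (5 / 2) isOpen_Ioi
    (fun r hr => (neg_lt_iff_pos_add.1 hr).ne') fun z => ?_
  · convert e using 2
    ring
  rw [hR, h₈, h₇, h₆, h₄, h₁, hΛ, hα]
  rintro _ _ _ _ _ _ _ rfl rfl rfl rfl rfl rfl rfl
  refine ⟨?_, ?_, ?_⟩ <;> field_simp <;> ring

theorem isKundtVacuum_fiveHalves₂ (hR₀ : 0 < R₀) (hγ : κ.γ ≠ 0) (hδ : κ.α ≠ 3 * κ.β)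
    (h₁ : κ.η₁ = 0) (h₂ : κ.η₂ = 0)
    (h₈ : κ.η₈ = (κ.α - 3 * κ.β) * (7 * κ.α - 93 * κ.β) / (52 * κ.γ) + 36 * κ.η₃)
    (h₇ : κ.η₇ = -((κ.α - 3 * κ.β) * (19 * κ.α - 129 * κ.β) / (312 * κ.γ)) - 9 * κ.η₃)
    (h₆ : κ.η₆ = (κ.α - 3 * κ.β) * (κ.α + 69 * κ.β) / (78 * κ.γ))
    (h₄ : κ.η₄ = (κ.α - 3 * κ.β) * (11 * κ.α - 105 * κ.β) / (234 * κ.γ))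
    (hΛ : κ.Λ = -(247 * κ.γ / (24 * (κ.α - 3 * κ.β))))
    (hR : R₀ ^ 2 = -(4 * (κ.α - 3 * κ.β) / (13 * κ.γ))) (b c : ℝ) :
    IsKundtVacuum κ (fun r => -(8 * κ.γ / (κ.α - 3 * κ.β) * (r + b) ^ 2)
      + c * (r + b) ^ (5 / 2 : ℝ)) (Set.Ioi (-b)) R₀ := by
  obtain ⟨δ, hδdef⟩ : ∃ δ, δ = κ.α - 3 * κ.β := ⟨_, rfl⟩
  have hδ0 : δ ≠ 0 := by rw [hδdef]; exact sub_ne_zero.2 hδ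
  have hα : κ.α = δ + 3 * κ.β := by rw [hδdef]; ring
  rw [← hδdef] at h₄ h₆ h₇ h₈ hΛ hR ⊢
  have e := isKundtVacuum_power hR₀ κ (-(8 * κ.γ / δ)) c b (5 / 2) isOpen_Ioi
    (fun r hr => (neg_lt_iff_pos_add.1 hr).ne') fun z => ?_
  · convert e using 2
    ring
  rw [hR, h₈, h₇, h₆, h₄, h₁, h₂, hΛ, hα]
  rintro _ _ _ _ _ _ _ rfl rfl rfl rfl rfl rfl rfl
  refine ⟨?_, ?_, ?_⟩ <;> field_simp <;> ring

theorem isKundtVacuum_fiveHalves₃ (hR₀ : 0 < R₀) (hγ : κ.γ ≠ 0) (hδ : κ.α ≠ 3 * κ.β)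
    (h₁ : κ.η₁ = 0) (h₂ : κ.η₂ = 0)
    (h₈ : κ.η₈ = -(17 * (κ.α - 3 * κ.β) * (7 * κ.α - 93 * κ.β) / (256 * κ.γ)) + 36 * κ.η₃)
    (h₇ : κ.η₇ = 17 * (κ.α - 3 * κ.β) * (19 * κ.α - 129 * κ.β) / (1536 * κ.γ) - 9 * κ.η₃)
    (h₆ : κ.η₆ = -(17 * (κ.α - 3 * κ.β) * (κ.α + 69 * κ.β) / (384 * κ.γ)))
    (h₄ : κ.η₄ = -(17 * (κ.α - 3 * κ.β) * (11 * κ.α - 105 * κ.β) / (1152 * κ.γ)))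
    (hΛ : κ.Λ = 304 * κ.γ / (867 * (κ.α - 3 * κ.β)))
    (hR : R₀ ^ 2 = 17 * (κ.α - 3 * κ.β) / (16 * κ.γ)) (b c : ℝ) :
    IsKundtVacuum κ (fun r => -(16 * κ.γ / (17 * (κ.α - 3 * κ.β)) * (r + b) ^ 2)
      + c * (r + b) ^ (5 / 2 : ℝ)) (Set.Ioi (-b)) R₀ := by
  obtain ⟨δ, hδdef⟩ : ∃ δ, δ = κ.α - 3 * κ.β := ⟨_, rfl⟩
  have hδ0 : δ ≠ 0 := by rw [hδdef]; exact sub_ne_zero.2 hδ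
  have hα : κ.α = δ + 3 * κ.β := by rw [hδdef]; ring
  rw [← hδdef] at h₄ h₆ h₇ h₈ hΛ hR ⊢
  have e := isKundtVacuum_power hR₀ κ (-(16 * κ.γ / (17 * δ))) c b (5 / 2) isOpen_Ioi
    (fun r hr => (neg_lt_iff_pos_add.1 hr).ne') fun z => ?_
  · convert e using 2
    ring
  rw [hR, h₈, h₇, h₆, h₄, h₁, h₂, hΛ, hα]
  rintro _ _ _ _ _ _ _ rfl rfl rfl rfl rfl rfl rfl
  refine ⟨?_, ?_, ?_⟩ <;> field_simp <;> ring

theorem isKundtVacuum_fiveHalves₄ (hR₀ : 0 < R₀) (hγ : κ.γ ≠ 0) (hδ : κ.α ≠ 3 * κ.β)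
    (h₁ : κ.η₁ = 3 * κ.η₂)
    (h₈ : κ.η₈ = -((37 * κ.α - 516 * κ.β) * (κ.α - 3 * κ.β) / (135 * κ.γ)) - 249 * κ.η₂ / 40
      + 36 * κ.η₃)
    (h₇ : κ.η₇ = (361 * κ.α - 1893 * κ.β) * (κ.α - 3 * κ.β) / (1620 * κ.γ) + 83 * κ.η₂ / 80
      - 9 * κ.η₃)
    (h₆ : κ.η₆ = 2 * (2 * κ.α - 33 * κ.β) * (κ.α - 3 * κ.β) / (27 * κ.γ) - 9 * κ.η₂ / 4)
    (h₄ : κ.η₄ = -((13 * κ.α - 93 * κ.β) * (κ.α - 3 * κ.β) / (81 * κ.γ)) + 3 * κ.η₂ / 4)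
    (hΛ : κ.Λ = 0) (hR : R₀ ^ 2 = 2 * (κ.α - 3 * κ.β) / (3 * κ.γ)) (b c : ℝ) :
    IsKundtVacuum κ (fun r => 3 * κ.γ * (r + b) ^ 2 / (2 * (κ.α - 3 * κ.β))
      + c * (r + b) ^ (5 / 2 : ℝ)) (Set.Ioi (-b)) R₀ := by
  obtain ⟨δ, hδdef⟩ : ∃ δ, δ = κ.α - 3 * κ.β := ⟨_, rfl⟩
  have hδ0 : δ ≠ 0 := by rw [hδdef]; exact sub_ne_zero.2 hδ
  have hα : κ.α = δ + 3 * κ.β := by rw [hδdef]; ring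
  rw [← hδdef] at h₄ h₆ h₇ h₈ hR ⊢
  have e := isKundtVacuum_power hR₀ κ (3 * κ.γ / (2 * δ)) c b (5 / 2) isOpen_Ioi
    (fun r hr => (neg_lt_iff_pos_add.1 hr).ne') fun z => ?_
  · convert e using 2
    ring
  rw [hR, h₈, h₇, h₆, h₄, h₁, hΛ, hα]
  rintro _ _ _ _ _ _ _ rfl rfl rfl rfl rfl rfl rfl
  refine ⟨?_, ?_, ?_⟩ <;> field_simp <;> ring

end

end SixDerivativeGravity

/-! ### The individual families of solutions -/

theorem mainTheorem7 (κ : Couplings) (R₀ : ℝ) (hR₀ : 0 < R₀) :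
    -- The Nariai metric, in particular for a vanishing cosmological constant.
    (0 < κ.c₁ / κ.γ → κ.Λ = 0 → R₀ ^ 2 = 2 / 3 * √(κ.c₁ / κ.γ) →
      ∀ a₀ a₁ a₂ : ℝ, a₂ = -1 / R₀ ^ 2 →
        IsKundtVacuum κ (fun r => a₀ + a₁ * r + a₂ * r ^ 2) Set.univ R₀) ∧
    (9 * κ.γ * R₀ ^ 4 * (κ.Λ * R₀ ^ 2 - 1) + 4 * κ.c₁ = 0 →
      ∀ a₀ a₁ a₂ : ℝ, a₂ = -1 / R₀ ^ 2 →
        IsKundtVacuum κ (fun r => a₀ + a₁ * r + a₂ * r ^ 2) Set.univ R₀) ∧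
    -- The Bertotti-Robinson metric.
    (κ.Λ = 0 → 0 < κ.c₂ / κ.γ → R₀ ^ 2 = 2 / 3 * √(κ.c₂ / κ.γ) →
      ∀ a₀ a₁ a₂ : ℝ, a₂ = 1 / R₀ ^ 2 →
        IsKundtVacuum κ (fun r => a₀ + a₁ * r + a₂ * r ^ 2) Set.univ R₀) ∧
    (κ.γ = 0 → κ.c₂ = 0 →
      ∀ a₀ a₁ a₂ : ℝ, a₂ = 1 / R₀ ^ 2 →
        IsKundtVacuum κ (fun r => a₀ + a₁ * r + a₂ * r ^ 2) Set.univ R₀) ∧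
    -- The Bachian versions of these two metrics, for `s = ±1`.
    (κ.Λ = 0 → κ.α = 3 * κ.β → ∀ s : ℝ, s = 1 ∨ s = -1 →
      0 ≤ κ.c₂ ^ 3 * (2 * κ.c₁ - κ.c₂) →
      0 < (κ.c₁ * κ.c₂ + s * √(κ.c₂ ^ 3 * (2 * κ.c₁ - κ.c₂))) / ((κ.c₂ - κ.c₁) * κ.γ) →
      R₀ ^ 2 = √2 / 3 *
        √((κ.c₁ * κ.c₂ + s * √(κ.c₂ ^ 3 * (2 * κ.c₁ - κ.c₂))) / ((κ.c₂ - κ.c₁) * κ.γ)) →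
      ∀ a₀ a₁ a₂ : ℝ, a₂ = -(9 * κ.γ * R₀ ^ 2) / (2 * κ.c₂) →
        IsKundtVacuum κ (fun r => a₀ + a₁ * r + a₂ * r ^ 2) Set.univ R₀) ∧
    -- Linear functions, for `s = ±1`.
    (κ.γ ≠ 0 → ∀ s : ℝ, s = 1 ∨ s = -1 →
      0 ≤ 4 * (κ.α - 3 * κ.β) ^ 2 - 3 * κ.γ * κ.c₃ →
      R₀ ^ 2 = (2 * (κ.α - 3 * κ.β) + s * √(4 * (κ.α - 3 * κ.β) ^ 2 - 3 * κ.γ * κ.c₃))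
        / (3 * κ.γ) →
      κ.Λ = -(2 * (κ.α - 3 * κ.β - 3 * κ.γ * R₀ ^ 2)) / (9 * κ.γ * R₀ ^ 4) →
      ∀ a₀ a₁ : ℝ, a₁ ≠ 0 → IsKundtVacuum κ (fun r => a₀ + a₁ * r) Set.univ R₀) ∧
    -- Models for which every static spherically symmetric Kundt metric (of a given radius) is
    -- a solution.
    (κ.γ = 0 → κ.α = 0 → κ.β = 0 → κ.η₁ = 0 → κ.η₂ = 0 → κ.η₃ = 0 → κ.η₄ = 0 → κ.η₆ = 0 →
      κ.η₇ = 0 → κ.η₈ = 0 →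
      ∀ (f : ℝ → ℝ) (I : Set ℝ), IsOpen I → ContDiffOn ℝ ∞ f I → IsKundtVacuum κ f I R₀) ∧
    (κ.γ = 0 → κ.η₁ = 0 → κ.η₂ = 0 → κ.α = 3 * κ.β → κ.β ≠ 0 → κ.η₆ = -3 * κ.η₄ → κ.η₄ ≠ 0 →
      κ.η₇ = -(3 / 4) * (12 * κ.η₃ + κ.η₄) → κ.η₈ = 9 / 2 * (8 * κ.η₃ + κ.η₄) →
      R₀ ^ 2 = κ.η₄ / κ.β →
      ∀ (f : ℝ → ℝ) (I : Set ℝ), IsOpen I → ContDiffOn ℝ ∞ f I → IsKundtVacuum κ f I R₀) ∧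
    -- Cubic functions, without and with a cosmological constant.
    (κ.Λ = 0 → κ.γ ≠ 0 → κ.β = 0 → κ.η₁ = 3 * κ.η₂ → κ.η₁ = 1 / 6 * (6 * κ.η₄ - κ.η₆) →
      κ.η₃ = -(1 / 108) * (3 * κ.η₄ + 4 * κ.η₆ + 12 * κ.η₇) →
      2 * κ.η₁ - 6 * κ.η₂ + κ.c₃ = 0 →
      0 < κ.c₂ / κ.γ → R₀ ^ 2 = 2 / 3 * √(κ.c₂ / κ.γ) →
      ∀ a₀ a₁ a₂ a₃ : ℝ, a₃ ≠ 0 → a₁ = (a₂ ^ 2 * R₀ ^ 4 - 1) / (3 * a₃ * R₀ ^ 4) →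
        IsKundtVacuum κ (fun r => a₀ + a₁ * r + a₂ * r ^ 2 + a₃ * r ^ 3) Set.univ R₀) ∧
    (κ.γ ≠ 0 → κ.β = 0 → κ.η₁ = 3 * κ.η₂ → κ.η₁ = 1 / 6 * (6 * κ.η₄ - κ.η₆) →
      κ.η₃ = -(1 / 108) * (3 * κ.η₄ + 4 * κ.η₆ + 12 * κ.η₇) →
      2 * κ.η₁ - 6 * κ.η₂ + κ.c₃ = 0 →
      κ.α = Real.sign κ.γ * (1 / 2) * √(κ.γ * κ.c₂) →
      0 < κ.c₂ / κ.γ → R₀ ^ 2 = 2 / 3 * √(κ.c₂ / κ.γ) →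
      ∀ a₀ a₁ a₂ a₃ : ℝ, a₃ ≠ 0 →
        a₁ = (a₂ ^ 2 * R₀ ^ 4 + 2 * κ.Λ * R₀ ^ 2 - 1) / (3 * a₃ * R₀ ^ 4) →
        IsKundtVacuum κ (fun r => a₀ + a₁ * r + a₂ * r ^ 2 + a₃ * r ^ 3) Set.univ R₀) ∧
    -- The functions `a₂ r² + a_p r^p`, for real `p`.
    (∀ p : ℝ, p ≠ 0 → p ≠ 1 →
      κ.γ = 0 → κ.α = 3 * κ.β → κ.η₁ = 3 * κ.η₂ → κ.η₆ = -3 * κ.η₄ →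
      κ.η₇ = 6 * (p - 2) * (2 * p - 3) * κ.η₂ / ((p - 1) * p) - 9 * κ.η₃ - 3 * κ.η₄ / 4 →
      κ.η₈ = -6 * (3 * κ.η₃ + κ.η₇) →
      ∀ a₂ a_p : ℝ, a_p ≠ 0 →
        (p - 1) * p * κ.β + (p - 3) * (p - 2) * (p ^ 2 + p - 4) * a₂ * κ.η₂ ≠ 0 →
        R₀ ^ 2 = -(4 * (p - 2) * (2 * p - 3) * κ.η₂ - (p - 1) * p * κ.η₄) /
          ((p - 1) * p * κ.β + (p - 3) * (p - 2) * (p ^ 2 + p - 4) * a₂ * κ.η₂) →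
        IsKundtVacuum κ (fun r => a₂ * r ^ 2 + a_p * r ^ p) (powDomain p) R₀) ∧
    -- The functions `a_p r^p`, for real `p`.
    (∀ p : ℝ, p ≠ 0 → p ≠ 1 → p ≠ 3 / 2 → p ≠ 2 → p * (5 * p - 21) + 20 ≠ 0 →
      κ.Λ ≠ 0 →
      κ.α = 9 * κ.η₄ * κ.Λ
        - κ.γ * (p - 1) * (3 * p - 4) * p ^ 2 /
          (36 * κ.Λ * (p - 2) * (2 * p - 3) * (p * (5 * p - 21) + 20))
        - 12 * κ.η₁ * κ.Λ * (p - 2) * (2 * p - 3) / ((p - 1) * p) →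
      κ.β = -(κ.γ / (6 * κ.Λ)) + 3 * κ.η₄ * κ.Λ
        - κ.γ * (p - 1) * (3 * p - 4) * p ^ 2 /
          (108 * κ.Λ * (p - 2) * (2 * p - 3) * (p * (5 * p - 21) + 20))
        - 4 * κ.η₁ * κ.Λ * (p - 2) * (2 * p - 3) / ((p - 1) * p) →
      κ.η₂ = κ.η₁ / 3
        + κ.γ * (p - 1) * p * (2 * p - 5) /
          (54 * κ.Λ ^ 2 * (p - 2) * (p * (5 * p - 21) + 20)) →
      κ.η₆ = -3 * κ.η₄ →
      κ.η₇ = -9 * κ.η₃ - 3 * κ.η₄ / 4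
        + κ.γ * (7 * p - 15) * (13 * (p - 4) * p + 48) /
          (216 * κ.Λ ^ 2 * (p - 2) * (p * (5 * p - 21) + 20))
        + 2 * κ.η₁ * (p - 2) * (2 * p - 3) / ((p - 1) * p) →
      κ.η₈ = 36 * κ.η₃ + 9 * κ.η₄ / 2
        + κ.γ * (p * ((373 - 61 * p) * p - 744) + 480) /
          (36 * κ.Λ ^ 2 * (p - 2) * (p * (5 * p - 21) + 20))
        - 12 * κ.η₁ * (p - 2) * (2 * p - 3) / ((p - 1) * p) →
      R₀ ^ 2 = 1 / (3 * κ.Λ) →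
      ∀ a_p : ℝ, a_p ≠ 0 → IsKundtVacuum κ (fun r => a_p * r ^ p) (powDomain p) R₀) ∧
    -- A further quartic function.
    (κ.γ ≠ 0 → κ.α ≠ 3 * κ.β →
      κ.η₁ = -69 * κ.η₂ → κ.η₁ = 391 * (κ.α - 3 * κ.β) ^ 2 / (2214 * κ.γ) →
      κ.η₄ = 2 * (104 * κ.α - 5847 * κ.β) * (κ.α - 3 * κ.β) / (16605 * κ.γ) →
      κ.η₆ = 2 * (κ.α - 3 * κ.β) * (1201 * κ.α + 1932 * κ.β) / (5535 * κ.γ) →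
      κ.η₇ = -((1987 * κ.α - 22566 * κ.β) * (κ.α - 3 * κ.β) / (33210 * κ.γ)) - 9 * κ.η₃ →
      κ.η₈ = -((κ.α - 3 * κ.β) * (4648 * κ.α + 2661 * κ.β) / (5535 * κ.γ)) + 36 * κ.η₃ →
      κ.Λ = -(8883 * κ.γ / (1312 * (κ.α - 3 * κ.β))) →
      R₀ ^ 2 = -(2 * (κ.α - 3 * κ.β) / (3 * κ.γ)) →
      ∀ a₄ : ℝ, a₄ ≠ 0 →
        IsKundtVacuum κ (fun r => 15 * κ.γ * r ^ 2 / (8 * (κ.α - 3 * κ.β)) + a₄ * r ^ 4)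
          Set.univ R₀) ∧
    -- Four families with `(r + b) ^ (5 / 2)`.
    (κ.γ ≠ 0 → κ.α ≠ 3 * κ.β →
      κ.η₁ = 3 * κ.η₂ →
      κ.η₈ = 19 * (κ.α - 3 * κ.β) * (κ.α + 141 * κ.β) / (3072 * κ.γ)
        - 27 * κ.η₂ / 8 + 36 * κ.η₃ →
      κ.η₇ = 19 * (7 * κ.α - 165 * κ.β) * (κ.α - 3 * κ.β) / (18432 * κ.γ)
        + 9 * κ.η₂ / 16 - 9 * κ.η₃ →
      κ.η₆ = 19 * (31 * κ.α - 237 * κ.β) * (κ.α - 3 * κ.β) / (4608 * κ.γ)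
        - 83 * κ.η₂ / 20 →
      κ.η₄ = -(19 * (7 * κ.α - 165 * κ.β) * (κ.α - 3 * κ.β) / (13824 * κ.γ))
        + 83 * κ.η₂ / 60 →
      κ.Λ = -(224 * κ.γ / (361 * (κ.α - 3 * κ.β))) →
      R₀ ^ 2 = 19 * (κ.α - 3 * κ.β) / (96 * κ.γ) →
      ∀ b c : ℝ, c ≠ 0 →
        IsKundtVacuum κ (fun r => -(96 * κ.γ * (r + b) ^ 2 / (19 * (κ.α - 3 * κ.β)))
          + c * (r + b) ^ (5 / 2 : ℝ)) (Set.Ioi (-b)) R₀) ∧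
    (κ.γ ≠ 0 → κ.α ≠ 3 * κ.β →
      κ.η₁ = 0 → κ.η₂ = 0 →
      κ.η₈ = (κ.α - 3 * κ.β) * (7 * κ.α - 93 * κ.β) / (52 * κ.γ) + 36 * κ.η₃ →
      κ.η₇ = -((κ.α - 3 * κ.β) * (19 * κ.α - 129 * κ.β) / (312 * κ.γ)) - 9 * κ.η₃ →
      κ.η₆ = (κ.α - 3 * κ.β) * (κ.α + 69 * κ.β) / (78 * κ.γ) →
      κ.η₄ = (κ.α - 3 * κ.β) * (11 * κ.α - 105 * κ.β) / (234 * κ.γ) →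
      κ.Λ = -(247 * κ.γ / (24 * (κ.α - 3 * κ.β))) →
      R₀ ^ 2 = -(4 * (κ.α - 3 * κ.β) / (13 * κ.γ)) →
      ∀ b c : ℝ, c ≠ 0 →
        IsKundtVacuum κ (fun r => -(8 * κ.γ / (κ.α - 3 * κ.β) * (r + b) ^ 2)
          + c * (r + b) ^ (5 / 2 : ℝ)) (Set.Ioi (-b)) R₀) ∧
    (κ.γ ≠ 0 → κ.α ≠ 3 * κ.β →
      κ.η₁ = 0 → κ.η₂ = 0 →
      κ.η₈ = -(17 * (κ.α - 3 * κ.β) * (7 * κ.α - 93 * κ.β) / (256 * κ.γ)) + 36 * κ.η₃ →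
      κ.η₇ = 17 * (κ.α - 3 * κ.β) * (19 * κ.α - 129 * κ.β) / (1536 * κ.γ) - 9 * κ.η₃ →
      κ.η₆ = -(17 * (κ.α - 3 * κ.β) * (κ.α + 69 * κ.β) / (384 * κ.γ)) →
      κ.η₄ = -(17 * (κ.α - 3 * κ.β) * (11 * κ.α - 105 * κ.β) / (1152 * κ.γ)) →
      κ.Λ = 304 * κ.γ / (867 * (κ.α - 3 * κ.β)) →
      R₀ ^ 2 = 17 * (κ.α - 3 * κ.β) / (16 * κ.γ) →
      ∀ b c : ℝ, c ≠ 0 →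
        IsKundtVacuum κ (fun r => -(16 * κ.γ / (17 * (κ.α - 3 * κ.β)) * (r + b) ^ 2)
          + c * (r + b) ^ (5 / 2 : ℝ)) (Set.Ioi (-b)) R₀) ∧
    (κ.γ ≠ 0 → κ.α ≠ 3 * κ.β →
      κ.η₁ = 3 * κ.η₂ →
      κ.η₈ = -((37 * κ.α - 516 * κ.β) * (κ.α - 3 * κ.β) / (135 * κ.γ))
        - 249 * κ.η₂ / 40 + 36 * κ.η₃ →
      κ.η₇ = (361 * κ.α - 1893 * κ.β) * (κ.α - 3 * κ.β) / (1620 * κ.γ)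
        + 83 * κ.η₂ / 80 - 9 * κ.η₃ →
      κ.η₆ = 2 * (2 * κ.α - 33 * κ.β) * (κ.α - 3 * κ.β) / (27 * κ.γ) - 9 * κ.η₂ / 4 →
      κ.η₄ = -((13 * κ.α - 93 * κ.β) * (κ.α - 3 * κ.β) / (81 * κ.γ)) + 3 * κ.η₂ / 4 →
      κ.Λ = 0 →
      R₀ ^ 2 = 2 * (κ.α - 3 * κ.β) / (3 * κ.γ) →
      ∀ b c : ℝ, c ≠ 0 →
        IsKundtVacuum κ (fun r => 3 * κ.γ * (r + b) ^ 2 / (2 * (κ.α - 3 * κ.β))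
          + c * (r + b) ^ (5 / 2 : ℝ)) (Set.Ioi (-b)) R₀) := by
  refine ⟨fun hc hΛ hR a₀ a₁ a₂ ha => ?_, fun h a₀ a₁ a₂ ha => ?_, fun hΛ hc hR a₀ a₁ a₂ ha => ?_,
    fun hγ hc a₀ a₁ a₂ ha => ?_, fun hΛ hδ s hs hQ hρ hR a₀ a₁ a₂ ha => ?_,
    fun hγ s hs hQ hR hΛ a₀ a₁ _ => ?_, fun hγ hα hβ h₁ h₂ h₃ h₄ h₆ h₇ h₈ f I hI hf => ?_,
    fun hγ h₁ h₂ hδ hβ h₆ h₄ h₇ h₈ hR f I hI hf => ?_,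
    fun hΛ hγ hβ h₁ h₆ h₃ h₈ hc hR a₀ a₁ a₂ a₃ ha₃ ha => ?_,
    fun hγ hβ h₁ h₆ h₃ h₈ hα hc hR a₀ a₁ a₂ a₃ ha₃ ha => ?_,
    fun p hp0 hp1 hγ hδ h₁ h₆ h₇ h₈ a₂ a_p _ hd hR => ?_,
    fun p hp0 hp1 hp3 hp2 hq hΛ hα hβ h₂ h₆ h₇ h₈ hR a_p _ => ?_,
    fun hγ hδ h₁₂ h₁ h₄ h₆ h₇ h₈ hΛ hR a₄ _ => ?_,
    fun hγ hδ h₁ h₈ h₇ h₆ h₄ hΛ hR b c _ => ?_, fun hγ hδ h₁ h₂ h₈ h₇ h₆ h₄ hΛ hR b c _ => ?_,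
    fun hγ hδ h₁ h₂ h₈ h₇ h₆ h₄ hΛ hR b c _ => ?_, fun hγ hδ h₁ h₈ h₇ h₆ h₄ hΛ hR b c _ => ?_⟩
  · refine isKundtVacuum_nariai hR₀ ?_ a₀ a₁ a₂ ha
    rw [hΛ]
    -- Without cosmological constant the general relation for the Nariai radius is `9 γ R₀⁴ = 4 c₁`.
    linear_combination -radius_relation hc hR
  · exact isKundtVacuum_nariai hR₀ h a₀ a₁ a₂ ha
  · exact isKundtVacuum_bertottiRobinson hR₀ (by rw [hΛ, mul_zero]) (radius_relation hc hR)
      a₀ a₁ a₂ ha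
  · exact isKundtVacuum_bertottiRobinson hR₀ (by rw [hγ, zero_mul]) (by rw [hγ, hc]; ring)
      a₀ a₁ a₂ ha
  · exact isKundtVacuum_bachian hR₀ hΛ hδ hs hQ hρ hR a₀ a₁ a₂ ha
  · exact isKundtVacuum_linear hR₀ hγ hs hQ hR hΛ a₀ a₁
  · exact isKundtVacuum_of_only_η₅ hR₀ hγ hα hβ h₁ h₂ h₃ h₄ h₆ h₇ h₈ hI hf
  · exact isKundtVacuum_of_radius hR₀ hγ h₁ h₂ hδ hβ h₆ h₄ h₇ h₈ hR hI hf
  · obtain ⟨k, hk, h2, h4⟩ := exists_sq_eq_inv hR₀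
    have hγk := radius_relation hc hR
    rw [h4] at hγk ha
    field_simp at hγk ha
    refine isKundtVacuum_cubic hR₀ h2 hβ h₁ h₆ h₃ h₈ (by linear_combination hγk)
      (by rw [hΛ, zero_mul]) a₀ a₁ a₂ a₃ ?_
    rw [hΛ]
    linear_combination ha
  · obtain ⟨k, hk, h2, h4⟩ := exists_sq_eq_inv hR₀
    have hγk := radius_relation hc hR
    rw [h4] at hγk
    rw [h2, h4] at ha
    field_simp at hγk ha
    refine isKundtVacuum_cubic hR₀ h2 hβ h₁ h₆ h₃ h₈ (by linear_combination hγk) ?_ a₀ a₁ a₂ a₃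
      (by linear_combination ha)
    -- The radius relation gives `c₂ = 9 γ/(4 k²)`, so `γ c₂` is a perfect square.
    have hs : √(κ.γ * κ.c₂) = 3 * |κ.γ| / (2 * k) := by
      rw [← Real.sqrt_sq (by positivity : 0 ≤ 3 * |κ.γ| / (2 * k)), div_pow, mul_pow, sq_abs]
      congr 1
      field_simp
      linear_combination -hγk
    have hsign : Real.sign κ.γ * |κ.γ| = κ.γ := by
      rcases hγ.lt_or_gt with h | h
      · rw [Real.sign_of_neg h, abs_of_neg h]; ring
      · rw [Real.sign_of_pos h, abs_of_pos h]; ring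
    -- The sign of `γ` undoes the absolute value from the root. The result is `4 k α = 3 γ`, the
    -- alternative to `Λ = 0` in `isKundtVacuum_cubic`.
    have hα' : κ.α = 3 / (4 * k) * κ.γ := by
      rw [hα, hs]
      linear_combination 3 / (4 * k) * hsign
    rw [hα']
    field_simp
    ring
  · exact isKundtVacuum_square_add_power hR₀ hp0 hp1 hγ hδ h₁ h₆ h₇ h₈ a_p hd hR
  · exact isKundtVacuum_monomial hR₀ hp0 hp1 hp3 hp2 hq hΛ hα hβ h₂ h₆ h₇ h₈ hR a_p
  · exact isKundtVacuum_square_add_fourth hR₀ hγ hδ h₁₂ h₁ h₄ h₆ h₇ h₈ hΛ hR a₄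
  · exact isKundtVacuum_fiveHalves₁ hR₀ hγ hδ h₁ h₈ h₇ h₆ h₄ hΛ hR b c
  · exact isKundtVacuum_fiveHalves₂ hR₀ hγ hδ h₁ h₂ h₈ h₇ h₆ h₄ hΛ hR b c
  · exact isKundtVacuum_fiveHalves₃ hR₀ hγ hδ h₁ h₂ h₈ h₇ h₆ h₄ hΛ hR b c
  · exact isKundtVacuum_fiveHalves₄ hR₀ hγ hδ h₁ h₈ h₇ h₆ h₄ hΛ hR b c
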